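/- **Lemma.** Let $\Omega\subset\mathbb{R}^2$ be a simply connected polygonal domain (a bounded connected open set, equal to the interior of its closure, whose boundary consists of finitely many line segments), and let $\tau_h^M$ be a finite conforming triangulation of $\overline\Omega$. An edge or vertex of $\tau_h^M$ is called exterior if it lies on $\partial\Omega$, and interior otherwise; let $E_{int}^M$ be the set of interior edges and $V_i^M$ the set of interior vertices of $\tau_h^M$. Let $\tau_h$ be the Powell–Sabin split of $\tau_h^M$: every triangle of $\tau_h^M$ is cut into six triangles by joining its incenter to its three vertices and to one point on each of its three edges, namely to the point where the edge meets the segment that joins the incenters of the two adjacent triangles if the edge is interior, and to the midpoint of the edge if it is exterior. Let $S$ be the set of singular vertices of $\tau_h$, i.e. of the vertices such that all edges of $\tau_h$ meeting there fall on precisely two straight lines. For $\mathbf z\in S$ let $T_1,T_2,\dots$ be the triangles of $\tau_h$ with vertex $\mathbf z$, in counter-clockwise order such that consecutive triangles share an edge (there are four of them if $\mathbf z\in\Omega$, and two if $\mathbf z\in\partial\Omega$), and for a function $q$ that is constant on every triangle of $\tau_h$ put $\theta_{\mathbf z}(q)=\sum_{j}(-1)^{j-1}q|_{T_j}(\mathbf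 z)$. Define $$\mathbf X_h^0=\{\mathbf v\in C(\overline\Omega)^2 : \mathbf v|_T\in\mathcal P_1(T)^2\ \forall T\in\tau_h,\ \mathbf v=\mathbf 0\text{ on }\partial\Omega\},\qquad \mathbf V_h^0=\{\mathbf v\in\mathbf X_h^0 : \mathbf v\in H^1(\Omega)^2,\ \nabla\cdot\mathbf v=0\text{ on }\Omega\},$$ $$P_h=\Big\{q\in L^2(\Omega) : \int_\Omega q\,d\mathbf x=0,\ q|_T\in\mathcal P_0(T)\ \forall T\in\tau_h,\ \theta_{\mathbf z}(q)=0\ \forall \mathbf z\in S\Big\}.$$ Then $\mathbf X_h^0$ and $P_h$ are finite-dimensional and, for every subspace $\mathbf W$ of $\mathbf X_h^0$ with $\mathbf X_h^0=\mathbf V_h^0\oplus\mathbf W$ (a non-solenoidal complement, written $\mathbf X_h^0\setminus\mathbf V_h^0$), $$\dim(\mathbf W)=\dim(P_h)=2|\tau_h^M|+2|E_{int}^M|-|V_i^M| .$$ Consequently the pressure system, i.e. the linear system for $p_h\in P_h$ obtained by prescribing $\int_\Omega p_h\,\nabla\cdot\mathbf v_h\,d\mathbf x$ for all $\mathbf v_h\in\mathbf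 W$, is square: with respect to any bases of $\mathbf W$ and $P_h$ it has as many equations as unknowns. -/

import Mathlib

open MeasureTheory Set Filter Topology
open scoped ContDiff

noncomputable section

namespace PowellSabin

/-- The Euclidean plane `ℝ²`. -/
abbrev Plane := EuclideanSpace ℝ (Fin 2)

/-! ### Domain and macro-mesh -/

/-- A polygonal domain: a bounded connected open set that coincides with the interior of its closure
(so that it lies on one side of its boundary only: no slits, no punctures) and whose boundary
consists of finitely many line segments. -/
structure IsPolygonalDomain (Ω : Set Plane) : Prop where
  isOpen : IsOpen Ω
  isConnected : IsConnected Ω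
  isBounded : Bornology.IsBounded Ω
  interior_closure : interior (closure Ω) = Ω
  frontier_segments : ∃ F : Finset (Plane × Plane), frontier Ω ⊆ ⋃ p ∈ F, segment ℝ p.1 p.2

/-- `K` is a (finite) conforming triangulation of `Ω`. The conformity condition, that two faces meet
in a common face or not at all, is part of `Geometry.SimplicialComplex`. If `Ω` is open, then every
face of `K` is automatically a face of a triangle of `K`. -/
structure IsTriangulation (K : Geometry.SimplicialComplex ℝ Plane) (Ω : Set Plane) : Prop where
  finite : K.faces.Finite
  space_eq : K.space = closure Ω

/-- The triangles of the macro-mesh, given by their sets of vertices. -/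
def macroTriangles (K : Geometry.SimplicialComplex ℝ Plane) : Set (Finset Plane) :=
  {s | s ∈ K.faces ∧ s.card = 3}

/-- The edges of the macro-mesh, given by their sets of endpoints. -/
def macroEdges (K : Geometry.SimplicialComplex ℝ Plane) : Set (Finset Plane) :=
  {e | e ∈ K.faces ∧ e.card = 2}

/-- The exterior edges: those that lie on the boundary of `Ω`. -/
def exteriorEdges (K : Geometry.SimplicialComplex ℝ Plane) (Ω : Set Plane) :
    Set (Finset Plane) :=
  {e | e ∈ macroEdges K ∧ convexHull ℝ (e : Set Plane) ⊆ frontier Ω}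

/-- The interior edges: those that do not lie on the boundary of `Ω`. -/
def interiorEdges (K : Geometry.SimplicialComplex ℝ Plane) (Ω : Set Plane) :
    Set (Finset Plane) :=
  {e | e ∈ macroEdges K ∧ ¬ convexHull ℝ (e : Set Plane) ⊆ frontier Ω}

/-- The interior vertices: those that do not lie on the boundary of `Ω`. -/
def interiorVertices (K : Geometry.SimplicialComplex ℝ Plane) (Ω : Set Plane) : Set Plane :=
  {x | x ∈ K.vertices ∧ x ∉ frontier Ω}

/-! ### The Powell-Sabin split -/

/-- `c` is the incenter of the triangle with vertex set `s`. -/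
def IsIncenter (s : Finset Plane) (c : Plane) : Prop :=
  ∃ t : Affine.Triangle ℝ Plane, Set.range t.points = (s : Set Plane) ∧ t.incenter = c

/-- `z` is the point at which the macro-edge `e` is split: for an interior edge, the intersection of
`e` with the segment that joins the incenters of the two triangles adjacent to `e`; for an exterior
edge, the midpoint of `e`. -/
def IsSplitPoint (K : Geometry.SimplicialComplex ℝ Plane) (Ω : Set Plane)
    (e : Finset Plane) (z : Plane) : Prop :=
  (e ∈ interiorEdges K Ω ∧ ∃ s₁ ∈ macroTriangles K, ∃ s₂ ∈ macroTriangles K,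
      s₁ ≠ s₂ ∧ e ⊆ s₁ ∧ e ⊆ s₂ ∧
      ∃ c₁ c₂ : Plane, IsIncenter s₁ c₁ ∧ IsIncenter s₂ c₂ ∧
        z ∈ convexHull ℝ (e : Set Plane) ∧ z ∈ segment ℝ c₁ c₂) ∨
  (e ∈ exteriorEdges K Ω ∧ ∃ a b : Plane, (e : Set Plane) = {a, b} ∧ z = midpoint ℝ a b)

/-- The triangles of the Powell-Sabin mesh, given by their sets of vertices: every macro-triangle is
cut into six triangles, whose vertices are the incenter, the split point of an edge `e`, and an
endpoint of `e`. -/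
def psTriangles (K : Geometry.SimplicialComplex ℝ Plane) (Ω : Set Plane) : Set (Set Plane) :=
  {t | ∃ s ∈ macroTriangles K, ∃ e ∈ macroEdges K, e ⊆ s ∧ ∃ v ∈ e,
      ∃ c z : Plane, IsIncenter s c ∧ IsSplitPoint K Ω e z ∧ t = {c, z, v}}

/-- The vertices `w` that are joined to `z` by an edge of the Powell-Sabin mesh. -/
def psNeighbors (K : Geometry.SimplicialComplex ℝ Plane) (Ω : Set Plane) (z : Plane) :
    Set Plane :=
  {w | w ≠ z ∧ ∃ t ∈ psTriangles K Ω, z ∈ t ∧ w ∈ t}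

/-- The singular vertices of the Powell-Sabin mesh: the vertices such that all edges that meet there
fall on precisely two straight lines. -/
def singularVertices (K : Geometry.SimplicialComplex ℝ Plane) (Ω : Set Plane) : Set Plane :=
  {z | (∃ t ∈ psTriangles K Ω, z ∈ t) ∧
    ((fun w : Plane => line[ℝ, z, w]) '' psNeighbors K Ω z).ncard = 2}

/-- The cross product of two vectors of the plane; it is positive if `b` is reached from `a` by a
counter-clockwise rotation by an angle in `(0, π)`. -/
def cross (a b : Plane) : ℝ := a 0 * b 1 - a 1 * b 0

/-- The triangles `s` and `t` share an edge with endpoint `z`, and a point that rotates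
counter-clockwise around `z` crosses this edge from `s` into `t`. -/
def Follows (z : Plane) (s t : Set Plane) : Prop :=
  ∃ a b d : Plane, s = {z, a, b} ∧ t = {z, b, d} ∧
    0 < cross (a - z) (b - z) ∧ 0 < cross (b - z) (d - z)

/-- `T 0, T 1, …` lists the triangles of the Powell-Sabin mesh with vertex `z`, each of them once,
in counter-clockwise order. -/
structure IsLocalOrdering (K : Geometry.SimplicialComplex ℝ Plane) (Ω : Set Plane) (z : Plane)
    {n : ℕ} (T : Fin n → Set Plane) : Prop where
  injective : Function.Injective T
  range_eq : Set.range T = {t | t ∈ psTriangles K Ω ∧ z ∈ t}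
  follows : ∀ i j : Fin n, (j : ℕ) = (i : ℕ) + 1 → Follows z (T i) (T j)

/-- The alternating sum `q|_{T₁}(z) - q|_{T₂}(z) + …` for a function `q` that takes the constant
value `c t` on the triangle `t`. At a singular vertex it has four terms if the vertex is interior
and two terms if it is exterior. -/
def theta {n : ℕ} (T : Fin n → Set Plane) (c : Set Plane → ℝ) : ℝ :=
  ∑ j : Fin n, (-1 : ℝ) ^ (j : ℕ) * c (T j)

/-! ### The pressure space -/

/-- `P_h`: the functions `q ∈ L²(Ω)` with integral zero, constant on every triangle of the
Powell-Sabin mesh, with `θ_z(q) = 0` at every singular vertex `z`. (On a bounded set, as on every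
set of finite measure, the integrability is automatic.) -/
def pressureSpace (K : Geometry.SimplicialComplex ℝ Plane) (Ω : Set Plane) :
    Submodule ℝ (Lp ℝ 2 (volume.restrict Ω)) where
  carrier := {q | Integrable q (volume.restrict Ω) ∧ ∫ x in Ω, q x = 0 ∧
    ∃ c : Set Plane → ℝ,
      (∀ t ∈ psTriangles K Ω, ∀ᵐ x ∂(volume.restrict Ω), x ∈ convexHull ℝ t → q x = c t) ∧
      ∀ z ∈ singularVertices K Ω, ∀ (n : ℕ) (T : Fin n → Set Plane),
        IsLocalOrdering K Ω z T → theta T c = 0}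
  zero_mem' := by
    have h0 := Lp.coeFn_zero ℝ 2 (volume.restrict Ω)
    refine ⟨(integrable_zero Plane ℝ (volume.restrict Ω)).congr h0.symm, ?_, fun _ => 0, ?_, ?_⟩
    · rw [integral_congr_ae h0]; simp
    · intro t _
      filter_upwards [h0] with x hx _
      simpa using hx
    · intro z _ n T _
      simp [theta]
  add_mem' := by
    rintro p q ⟨hp, hp0, c, hc, hcS⟩ ⟨hq, hq0, d, hd, hdS⟩
    have h := Lp.coeFn_add p q
    refine ⟨(hp.add hq).congr h.symm, ?_, fun t => c t + d t, ?_, ?_⟩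
    · rw [integral_congr_ae h]
      simp only [Pi.add_apply]
      rw [integral_add hp hq, hp0, hq0, add_zero]
    · intro t ht
      filter_upwards [h, hc t ht, hd t ht] with x hx h1 h2 hxt
      rw [hx, Pi.add_apply, h1 hxt, h2 hxt]
    · intro z hz n T hT
      have h1 := hcS z hz n T hT
      have h2 := hdS z hz n T hT
      simp only [theta] at h1 h2 ⊢
      simp only [mul_add, Finset.sum_add_distrib, h1, h2, add_zero]
  smul_mem' := by
    rintro r q ⟨hq, hq0, d, hd, hdS⟩
    have h := Lp.coeFn_smul r q
    refine ⟨(hq.smul r).congr h.symm, ?_, fun t => r * d t, ?_, ?_⟩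
    · rw [integral_congr_ae h]
      simp only [Pi.smul_apply]
      rw [integral_smul, hq0, smul_zero]
    · intro t ht
      filter_upwards [h, hd t ht] with x hx h2 hxt
      rw [hx, Pi.smul_apply, h2 hxt, smul_eq_mul]
    · intro z hz n T hT
      have h2 := hdS z hz n T hT
      simp only [theta] at h2 ⊢
      simp only [mul_left_comm _ r, ← Finset.mul_sum, h2, mul_zero]

/-! ### Velocity spaces -/

/-- `X_h`: the continuous vector fields on the closure of `Ω` that are polynomials of degree at most
one on every triangle of the Powell-Sabin mesh. -/
def velocitySpace (K : Geometry.SimplicialComplex ℝ Plane) (Ω : Set Plane) :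
    Submodule ℝ C(closure Ω, Plane) where
  carrier := {v | ∀ t ∈ psTriangles K Ω, ∃ A : Plane →ᵃ[ℝ] Plane,
    ∀ x : closure Ω, (x : Plane) ∈ convexHull ℝ t → v x = A x}
  zero_mem' := fun _ _ => ⟨0, fun _ _ => by simp⟩
  add_mem' := by
    intro v w hv hw t ht
    obtain ⟨A, hA⟩ := hv t ht
    obtain ⟨B, hB⟩ := hw t ht
    exact ⟨A + B, fun x hx => by simp [hA x hx, hB x hx]⟩
  smul_mem' := by
    intro r v hv t ht
    obtain ⟨A, hA⟩ := hv t ht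
    exact ⟨r • A, fun x hx => by simp [hA x hx]⟩

/-- The continuous vector fields on the closure of `Ω` that vanish on the boundary of `Ω`. -/
def zeroOnBoundary (Ω : Set Plane) : Submodule ℝ C(closure Ω, Plane) where
  carrier := {v | ∀ x : closure Ω, (x : Plane) ∈ frontier Ω → v x = 0}
  zero_mem' := fun _ _ => by simp
  add_mem' := fun hv hw x hx => by simp [hv x hx, hw x hx]
  smul_mem' := fun r v hv x hx => by simp [hv x hx]

/-- `g` is the weak `i`-th partial derivative of `f` on `Ω`. -/
def IsWeakPartial (Ω : Set Plane) (i : Fin 2) (f g : Plane → ℝ) : Prop :=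
  ∀ φ : Plane → ℝ, ContDiff ℝ ∞ φ → HasCompactSupport φ → tsupport φ ⊆ Ω →
    ∫ x in Ω, f x * fderiv ℝ φ x (EuclideanSpace.single i 1) = - ∫ x in Ω, g x * φ x

open Classical in
/-- The `i`-th component of a vector field on the closure of `Ω`, extended by zero. -/
def component {Ω : Set Plane} (v : C(closure Ω, Plane)) (i : Fin 2) (x : Plane) : ℝ :=
  if h : x ∈ closure Ω then v ⟨x, h⟩ i else 0

lemma IsWeakPartial.add {Ω : Set Plane} {i : Fin 2} {f g f' g' : Plane → ℝ}
    (hf : MemLp f 2 (volume.restrict Ω)) (hg : MemLp g 2 (volume.restrict Ω))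
    (hf' : MemLp f' 2 (volume.restrict Ω)) (hg' : MemLp g' 2 (volume.restrict Ω))
    (h : IsWeakPartial Ω i f g) (h' : IsWeakPartial Ω i f' g') :
    IsWeakPartial Ω i (fun x => f x + f' x) (fun x => g x + g' x) := by
  intro φ hφ hc hs
  have hφ2 : MemLp φ 2 (volume.restrict Ω) := hφ.continuous.memLp_of_hasCompactSupport hc
  have hd2 : MemLp (fun x => fderiv ℝ φ x (EuclideanSpace.single i 1)) 2 (volume.restrict Ω) := by
    apply Continuous.memLp_of_hasCompactSupport
    · exact (hφ.continuous_fderiv (by simp)).clm_apply continuous_const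
    · exact hc.fderiv_apply ℝ _
  simp only [add_mul]
  have e1 := integral_add (hf.integrable_mul hd2) (hf'.integrable_mul hd2)
  have e2 := integral_add (hg.integrable_mul hφ2) (hg'.integrable_mul hφ2)
  simp only [Pi.mul_apply] at e1 e2
  rw [e1, e2, h φ hφ hc hs, h' φ hφ hc hs]
  ring

lemma IsWeakPartial.smul {Ω : Set Plane} {i : Fin 2} {f g : Plane → ℝ} (r : ℝ)
    (h : IsWeakPartial Ω i f g) : IsWeakPartial Ω i (fun x => r * f x) (fun x => r * g x) := by
  intro φ hφ hc hs
  simp only [mul_assoc]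
  rw [integral_const_mul, integral_const_mul, h φ hφ hc hs]
  ring

/-- The continuous vector fields on the closure of `Ω` that belong to
`V(Ω) = {v ∈ H¹(Ω)² | ∇ · v = 0}`; here `G i j` is the weak derivative `∂ⱼ vᵢ`. -/
def solenoidal (Ω : Set Plane) : Submodule ℝ C(closure Ω, Plane) where
  carrier := {v | (∀ i, MemLp (component v i) 2 (volume.restrict Ω)) ∧
    ∃ G : Fin 2 → Fin 2 → Plane → ℝ,
      (∀ i j, MemLp (G i j) 2 (volume.restrict Ω) ∧ IsWeakPartial Ω j (component v i) (G i j)) ∧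
      ∀ᵐ x ∂(volume.restrict Ω), G 0 0 x + G 1 1 x = 0}
  zero_mem' := by
    have h0 : ∀ i, component (0 : C(closure Ω, Plane)) i = fun _ => 0 := by
      intro i; funext x; simp [component]
    refine ⟨fun i => by rw [h0]; exact MemLp.zero, fun _ _ _ => 0, fun i j => ⟨MemLp.zero, ?_⟩, ?_⟩
    · rw [h0]
      intro φ _ _ _
      simp
    · simp
  add_mem' := by
    rintro v w ⟨hv, G, hG, hdG⟩ ⟨hw, H, hH, hdH⟩
    have h0 : ∀ i, component (v + w) i = fun x => component v i x + component w i x := by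
      intro i; funext x
      by_cases hx : x ∈ closure Ω <;> simp [component, hx]
    refine ⟨fun i => by rw [h0]; exact (hv i).add (hw i), fun i j x => G i j x + H i j x,
      fun i j => ⟨(hG i j).1.add (hH i j).1, ?_⟩, ?_⟩
    · rw [h0]
      exact (hG i j).2.add (hv i) (hG i j).1 (hw i) (hH i j).1 (hH i j).2
    · filter_upwards [hdG, hdH] with x h1 h2
      linarith
  smul_mem' := by
    rintro r v ⟨hv, G, hG, hdG⟩
    have h0 : ∀ i, component (r • v) i = fun x => r * component v i x := by
      intro i; funext x
      by_cases hx : x ∈ closure Ω <;> simp [component, hx]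
    refine ⟨fun i => by rw [h0]; exact (hv i).const_mul r, fun i j x => r * G i j x,
      fun i j => ⟨(hG i j).1.const_mul r, ?_⟩, ?_⟩
    · rw [h0]
      exact (hG i j).2.smul r
    · filter_upwards [hdG] with x h1
      rw [← mul_add, h1, mul_zero]

/-- `X_h⁰`: the fields in `X_h` that vanish on the boundary. -/
def velocitySpaceZero (K : Geometry.SimplicialComplex ℝ Plane) (Ω : Set Plane) :
    Submodule ℝ C(closure Ω, Plane) :=
  velocitySpace K Ω ⊓ zeroOnBoundary Ω

/-- `V_h = X_h ∩ V(Ω)`. -/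
def solenoidalSpace (K : Geometry.SimplicialComplex ℝ Plane) (Ω : Set Plane) :
    Submodule ℝ C(closure Ω, Plane) :=
  velocitySpace K Ω ⊓ solenoidal Ω

/-- `V_h⁰ = V_h ∩ V₀(Ω)`: the fields in `V_h` with zero boundary values. (The trace of an `H¹` field
that is continuous up to the boundary is its restriction.) -/
def solenoidalSpaceZero (K : Geometry.SimplicialComplex ℝ Plane) (Ω : Set Plane) :
    Submodule ℝ C(closure Ω, Plane) :=
  solenoidalSpace K Ω ⊓ zeroOnBoundary Ω

end PowellSabin

end

noncomputable section

namespace PowellSabin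

open scoped NNReal

/-! ### Plane geometry -/

/-! Everything is reduced to linear algebra on ℝ^N, where N is the number of cells (triangles of the
split). A cell is indexed by a flag: a macro-triangle `s` with an ordered pair `a`, `b` of its
vertices. A field in X_h⁰ is affine on each cell, so its divergence is a vector `divMap K Ω v` of
ℝ^N. Extended by zero the field is Lipschitz, its line derivatives are weak derivatives, and V_h⁰ is
the kernel of `divMap` on X_h⁰ (`mem_solenoidal_iff`). A complement W is therefore isomorphic to the
image of X_h⁰.

This image equals the kernel of `constraints`: one alternating sum per macro-edge, taken at its
split point, and the vanishing of the integral. The image satisfies them: two pairs of opposite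
directions meet at a split point, so the divergence on a cell there is a term of the incenter plus a
term of the macro-vertex, and both cancel (`edgeTheta_divMap`). The E + 1 constraints, E being the
number of macro-edges, are independent (`constraints_surjective`). For the converse, a vector
orthogonal to the image is tested with the nodal fields of incenters and of interior split points.
The resulting relations propagate its values from cell to cell, so that E + 1 numbers determine it
(`annihilator_eq_zero`); here the connectedness of Ω enters through `dualConnected`. So the image
has dimension at least N - E - 1, and equality follows (`map_divMap_eq`).

The singular vertices are exactly the split points (`spl_mem_singularVertices`, `exists_eq_spl`), so
P_h is the same kernel, read as step functions (`pressureSpace_eq_map`). What is left is to count N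
- E - 1. Counting flags by triangles and by edges gives N = 6T = 4E_int + 2E_ext, with T triangles,
and Euler's formula T + V_i = E_int + 1 does the rest. Euler's formula is proved as the exactness of
0 → ℝ → ℝ^T → ℝ^E_int → ℝ^V_i → 0, whose maps are the constants, the jumps across edges and the
circulations about vertices. Simple connectedness is used only for exactness in the middle: local
potentials form a covering space of Ω with discrete fibre ℝ, which has a global section
(`exists_glued_function`, `exists_jump_eq`). -/

lemma plane_ext {x y : Plane} (h0 : x 0 = y 0) (h1 : x 1 = y 1) : x = y := by
  ext i
  fin_cases i
  · exact h0
  · exact h1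

/-- The convex combination of three points with the given weights. -/
def comb (α β δ : ℝ) (a b d : Plane) : Plane := α • a + β • b + δ • d

@[simp] lemma comb_apply (α β δ : ℝ) (a b d : Plane) (i : Fin 2) :
    comb α β δ a b d i = α * a i + β * b i + δ * d i := by
  simp [comb]

lemma cross_swap (a b : Plane) : cross b a = -cross a b := by
  simp only [cross]; ring

lemma area_rotate (a b d : Plane) : cross (d - b) (a - b) = cross (b - a) (d - a) := by
  simp only [cross, PiLp.sub_apply]; ring

lemma area_swap (a b d : Plane) : cross (d - a) (b - a) = -cross (b - a) (d - a) :=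
  cross_swap _ _

/-- The barycentric coordinate of `x` that belongs to the vertex `a` of the triangle `a b d`. -/
def bary (a b d x : Plane) : ℝ := cross (b - x) (d - x) / cross (b - a) (d - a)

lemma continuous_bary (a b d : Plane) : Continuous (bary a b d) := by
  unfold bary cross
  simp only [PiLp.sub_apply]
  fun_prop

lemma bary_swap (a b d x : Plane) : bary a d b x = bary a b d x := by
  unfold bary
  rw [area_swap a, cross_swap (b - x), neg_div_neg_eq]

lemma cross_comb {a b d : Plane} {α β δ : ℝ} (h : α + β + δ = 1) :
    cross (b - comb α β δ a b d) (d - comb α β δ a b d) = α * cross (b - a) (d - a) := by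
  obtain rfl : α = 1 - β - δ := by linarith
  simp only [cross, PiLp.sub_apply, comb_apply]; ring

lemma bary_comb {a b d : Plane} (hΔ : cross (b - a) (d - a) ≠ 0) {α β δ : ℝ}
    (h : α + β + δ = 1) : bary a b d (comb α β δ a b d) = α := by
  rw [bary, cross_comb h, mul_div_cancel_right₀ _ hΔ]

lemma comb_rotate (α β δ : ℝ) (a b d : Plane) : comb α β δ a b d = comb β δ α b d a := by
  simp only [comb]; abel

lemma bary_sum {a b d : Plane} (hΔ : cross (b - a) (d - a) ≠ 0) (x : Plane) :
    bary a b d x + bary b d a x + bary d a b x = 1 := by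
  unfold bary
  rw [area_rotate a b d, ← area_rotate d a b, ← add_div, ← add_div, div_eq_one_iff_eq hΔ]
  simp only [cross, PiLp.sub_apply]; ring

lemma comb_bary {a b d : Plane} (hΔ : cross (b - a) (d - a) ≠ 0) (x : Plane) :
    comb (bary a b d x) (bary b d a x) (bary d a b x) a b d = x := by
  unfold bary
  rw [area_rotate a b d, ← area_rotate d a b]
  apply plane_ext <;> rw [comb_apply] <;> field_simp <;>
    simp only [cross, PiLp.sub_apply] <;> ring

lemma mem_hull3 {a b d x : Plane} : x ∈ convexHull ℝ ({a, b, d} : Set Plane) ↔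
    ∃ α β δ : ℝ, 0 ≤ α ∧ 0 ≤ β ∧ 0 ≤ δ ∧ α + β + δ = 1 ∧ x = comb α β δ a b d := by
  rw [convexHull_insert (by simp), convexHull_pair, mem_convexJoin]
  constructor
  · rintro ⟨y, hy, w, ⟨p, q, hp, hq, hpq, rfl⟩, ⟨r, t, hr, ht, hrt, rfl⟩⟩
    rw [mem_singleton_iff.1 hy]
    refine ⟨r, t * p, t * q, hr, by positivity, by positivity, ?_, ?_⟩
    · rw [add_assoc, ← mul_add, hpq, mul_one, hrt]
    · simp only [comb, smul_add, smul_smul, add_assoc]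
  · rintro ⟨α, β, δ, hα, hβ, hδ, h, rfl⟩
    refine ⟨a, rfl, ?_⟩
    rcases eq_or_lt_of_le (add_nonneg hβ hδ) with h0 | h0
    · have hβ0 : β = 0 := by linarith
      have hδ0 : δ = 0 := by linarith
      have hα1 : α = 1 := by linarith
      exact ⟨b, left_mem_segment _ _ _, by
        simpa [comb, hβ0, hδ0, hα1] using left_mem_segment ℝ a b⟩
    · refine ⟨(β / (β + δ)) • b + (δ / (β + δ)) • d,
        ⟨_, _, by positivity, by positivity, by field_simp, rfl⟩,
        ⟨α, β + δ, hα, h0.le, by linarith, ?_⟩⟩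
      simp only [comb, smul_add, smul_smul, mul_div_cancel₀ _ h0.ne', add_assoc]

lemma mem_hull3_iff_bary {a b d : Plane} (hΔ : cross (b - a) (d - a) ≠ 0) {x : Plane} :
    x ∈ convexHull ℝ ({a, b, d} : Set Plane) ↔
      0 ≤ bary a b d x ∧ 0 ≤ bary b d a x ∧ 0 ≤ bary d a b x := by
  rw [mem_hull3]
  constructor
  · rintro ⟨α, β, δ, hα, hβ, hδ, h, rfl⟩
    refine ⟨by rwa [bary_comb hΔ h], ?_, ?_⟩
    · rwa [comb_rotate, bary_comb (by rwa [area_rotate]) (by linarith)]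
    · rwa [comb_rotate, comb_rotate, bary_comb (by rwa [area_rotate d a b] at hΔ) (by linarith)]
  · rintro ⟨h1, h2, h3⟩
    exact ⟨_, _, _, h1, h2, h3, bary_sum hΔ x, (comb_bary hΔ x).symm⟩

/-- The interior of the triangle `a b d`. -/
def openTri (a b d : Plane) : Set Plane :=
  {x | ∃ α β δ : ℝ, 0 < α ∧ 0 < β ∧ 0 < δ ∧ α + β + δ = 1 ∧ x = comb α β δ a b d}

lemma mem_openTri_iff_bary {a b d : Plane} (hΔ : cross (b - a) (d - a) ≠ 0) {x : Plane} :
    x ∈ openTri a b d ↔ 0 < bary a b d x ∧ 0 < bary b d a x ∧ 0 < bary d a b x := by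
  constructor
  · rintro ⟨α, β, δ, hα, hβ, hδ, h, rfl⟩
    refine ⟨by rwa [bary_comb hΔ h], ?_, ?_⟩
    · rwa [comb_rotate, bary_comb (by rwa [area_rotate]) (by linarith)]
    · rwa [comb_rotate, comb_rotate, bary_comb (by rwa [area_rotate d a b] at hΔ) (by linarith)]
  · rintro ⟨h1, h2, h3⟩
    exact ⟨_, _, _, h1, h2, h3, bary_sum hΔ x, (comb_bary hΔ x).symm⟩

lemma isOpen_openTri {a b d : Plane} (hΔ : cross (b - a) (d - a) ≠ 0) :
    IsOpen (openTri a b d) := by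
  have : openTri a b d = {x | 0 < bary a b d x} ∩ ({x | 0 < bary b d a x} ∩
      {x | 0 < bary d a b x}) := by
    ext x
    exact mem_openTri_iff_bary hΔ
  rw [this]
  exact (isOpen_lt continuous_const (continuous_bary _ _ _)).inter
    ((isOpen_lt continuous_const (continuous_bary _ _ _)).inter
      (isOpen_lt continuous_const (continuous_bary _ _ _)))

lemma openTri_subset_hull (a b d : Plane) : openTri a b d ⊆ convexHull ℝ {a, b, d} := by
  rintro _ ⟨α, β, δ, hα, hβ, hδ, h, rfl⟩
  exact mem_hull3.2 ⟨α, β, δ, hα.le, hβ.le, hδ.le, h, rfl⟩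

lemma openTri_nonempty (a b d : Plane) : (openTri a b d).Nonempty :=
  ⟨_, 1 / 3, 1 / 3, 1 / 3, by norm_num, by norm_num, by norm_num, by norm_num, rfl⟩

lemma volume_segment (p q : Plane) : volume (segment ℝ p q) = 0 := by
  refine measure_mono_null ((convexHull_pair (𝕜 := ℝ) p q).symm.subset.trans (convexHull_subset_affineSpan _)) ?_
  apply Measure.addHaar_affineSubspace
  intro h
  have h1 : Module.finrank ℝ (line[ℝ, p, q]).direction = 2 := by
    rw [h, AffineSubspace.direction_top, finrank_top]
    simp
  have h2 := finrank_vectorSpan_insert_le_set ℝ {q} p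
  rw [← direction_affineSpan, h1] at h2
  simp at h2

lemma volume_hull_diff_openTri (a b d : Plane) :
    volume (convexHull ℝ {a, b, d} \ openTri a b d) = 0 := by
  have hsub : convexHull ℝ {a, b, d} \ openTri a b d ⊆
      segment ℝ a b ∪ (segment ℝ b d ∪ segment ℝ a d) := by
    rintro x ⟨hx, hx'⟩
    obtain ⟨α, β, δ, hα, hβ, hδ, h, rfl⟩ := mem_hull3.1 hx
    by_cases h1 : α = 0
    · exact Or.inr (Or.inl ⟨β, δ, hβ, hδ, by linarith, by simp [comb, h1]⟩)
    by_cases h2 : β = 0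
    · exact Or.inr (Or.inr ⟨α, δ, hα, hδ, by linarith, by simp [comb, h2]⟩)
    by_cases h3 : δ = 0
    · exact Or.inl ⟨α, β, hα, hβ, by linarith, by simp [comb, h3]⟩
    exact absurd ⟨α, β, δ, hα.lt_of_ne' h1, hβ.lt_of_ne' h2, hδ.lt_of_ne' h3, h, rfl⟩ hx'
  refine measure_mono_null hsub ?_
  simp [measure_union_null_iff, volume_segment]

lemma volume_openTri_pos {a b d : Plane} (hΔ : cross (b - a) (d - a) ≠ 0) :
    0 < volume (openTri a b d) :=
  (isOpen_openTri hΔ).measure_pos _ (openTri_nonempty a b d)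

lemma affineMap_comb (A : Plane →ᵃ[ℝ] Plane) {a b d : Plane} {α β δ : ℝ} (h : α + β + δ = 1) :
    A (comb α β δ a b d) = comb α β δ (A a) (A b) (A d) := by
  have key : ∀ x, A x = A.linear x + A 0 := fun x => congrFun (AffineMap.decomp A) x
  rw [key, key a, key b, key d]
  simp only [comb, map_add, map_smul, smul_add]
  nth_rewrite 1 [← one_smul ℝ (A 0), ← h]
  simp only [add_smul]
  abel

/-- The barycentric coordinate as an affine map. -/
def baryMap (a b d : Plane) : Plane →ᵃ[ℝ] ℝ where
  toFun := bary a b d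
  linear :=
    { toFun := fun x => cross (d - b) x / cross (b - a) (d - a)
      map_add' := fun x y => by simp only [cross, PiLp.add_apply]; ring
      map_smul' := fun r x => by simp only [cross, PiLp.smul_apply, smul_eq_mul, RingHom.id_apply]; ring }
  map_vadd' := fun p v => by
    simp only [bary, cross, vadd_eq_add, PiLp.add_apply, PiLp.sub_apply, LinearMap.coe_mk,
      AddHom.coe_mk]
    ring

lemma baryMap_apply (a b d x : Plane) : baryMap a b d x = bary a b d x := rfl

/-- The derivative of the determinant at the identity is the trace. This makes the divergence of an
affine field on a triangle computable from its three nodal values. -/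
lemma trace_identity (M : Plane →ₗ[ℝ] Plane) (u w : Plane) :
    cross (M u) w + cross u (M w) =
      (M (EuclideanSpace.single 0 1) 0 + M (EuclideanSpace.single 1 1) 1) * cross u w := by
  have key : ∀ x : Plane, M x = x 0 • M (EuclideanSpace.single 0 1) +
      x 1 • M (EuclideanSpace.single 1 1) := by
    intro x
    rw [← map_smul, ← map_smul, ← map_add]
    congr 1
    apply plane_ext <;> simp
  rw [key u, key w]
  simp only [cross, PiLp.add_apply, PiLp.smul_apply, smul_eq_mul]
  ring

/-! ### Incenters -/

lemma exists_reindex_of_range {t : Affine.Triangle ℝ Plane} {s : Finset Plane}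
    (ht : Set.range t.points = (s : Set Plane)) {a b d : Plane} (ha : a ∈ s) (hb : b ∈ s)
    (hd : d ∈ s) : ∃ i j k, t.points i = a ∧ t.points j = b ∧ t.points k = d := by
  have h : ∀ x ∈ s, ∃ i, t.points i = x := fun x hx => by
    have : x ∈ Set.range t.points := ht ▸ hx
    exact this
  obtain ⟨i, hi⟩ := h a ha
  obtain ⟨j, hj⟩ := h b hb
  obtain ⟨k, hk⟩ := h d hd
  exact ⟨i, j, k, hi, hj, hk⟩

lemma fin_three_univ {i j k : Fin 3} (h1 : i ≠ j) (h2 : i ≠ k) (h3 : j ≠ k) :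
    (Finset.univ : Finset (Fin 3)) = {i, j, k} := by
  revert i j k; decide

lemma IsIncenter.mem_openTri {s : Finset Plane} {c a b d : Plane} (hc : IsIncenter s c)
    (ha : a ∈ s) (hb : b ∈ s) (hd : d ∈ s) (hab : a ≠ b) (had : a ≠ d) (hbd : b ≠ d) :
    c ∈ openTri a b d := by
  obtain ⟨t, ht, rfl⟩ := hc
  obtain ⟨i, j, k, rfl, rfl, rfl⟩ := exists_reindex_of_range ht ha hb hd
  have hij : i ≠ j := fun h => hab (by rw [h])
  have hik : i ≠ k := fun h => had (by rw [h])
  have hjk : j ≠ k := fun h => hbd (by rw [h])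
  have hsum := t.excenterExists_empty.sum_excenterWeights_eq_one
  refine ⟨t.excenterWeights ∅ i, t.excenterWeights ∅ j, t.excenterWeights ∅ k,
    t.excenterWeights_empty_pos _, t.excenterWeights_empty_pos _, t.excenterWeights_empty_pos _,
    ?_, ?_⟩
  · rw [fin_three_univ hij hik hjk, Finset.sum_insert (by simp [hij, hik]),
      Finset.sum_pair hjk] at hsum
    linarith
  · rw [Affine.Simplex.incenter_eq_affineCombination,
      Finset.affineCombination_eq_linear_combination _ _ _ hsum, fin_three_univ hij hik hjk,
      Finset.sum_insert (by simp [hij, hik]), Finset.sum_pair hjk, comb, add_assoc]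

/-- The orthogonal projection of the incenter to a side is the touchpoint of the incircle, which
lies strictly between the endpoints. Hence the segment that joins two adjacent incenters meets the
common edge in its relative interior. -/
lemma IsIncenter.exists_foot {s : Finset Plane} {c a b d : Plane} (hc : IsIncenter s c)
    (ha : a ∈ s) (hb : b ∈ s) (hd : d ∈ s) (hab : a ≠ b) (had : a ≠ d) (hbd : b ≠ d) :
    ∃ r : ℝ, 0 < r ∧ r < 1 ∧ inner ℝ (b - a) (c - a) = r * inner ℝ (b - a) (b - a) := by
  obtain ⟨t, ht, rfl⟩ := hc
  obtain ⟨i, j, k, rfl, rfl, rfl⟩ := exists_reindex_of_range ht ha hb hd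
  have hij : i ≠ j := fun h => hab (by rw [h])
  have hik : i ≠ k := fun h => had (by rw [h])
  have hjk : j ≠ k := fun h => hbd (by rw [h])
  have hS : Sbtw ℝ (t.points i) (t.touchpoint ∅ k) (t.points j) :=
    Affine.Triangle.sbtw_touchpoint_empty t hik hij hjk.symm
  obtain ⟨⟨r, ⟨hr0, hr1⟩, hr⟩, hne, hne'⟩ := hS
  refine ⟨r, hr0.lt_of_ne ?_, hr1.lt_of_ne ?_, ?_⟩
  · rintro rfl
    exact hne (by rw [← hr]; simp)
  · rintro rfl
    exact hne' (by rw [← hr]; simp)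
  · have horth := EuclideanGeometry.vsub_orthogonalProjection_mem_direction_orthogonal
      (affineSpan ℝ (Set.range (t.faceOpposite k).points)) t.incenter
    have hmem : ∀ l, l ≠ k → t.points l ∈ affineSpan ℝ (Set.range (t.faceOpposite k).points) := by
      intro l hl
      apply subset_affineSpan
      rw [Affine.Simplex.range_faceOpposite_points]
      exact ⟨l, by simpa using hl, rfl⟩
    have hdir := AffineSubspace.vsub_mem_direction (hmem j hjk) (hmem i hik)
    have h0 := Submodule.inner_right_of_mem_orthogonal hdir horth
    have htp : (EuclideanGeometry.orthogonalProjection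
        (affineSpan ℝ (Set.range (t.faceOpposite k).points)) t.incenter : Plane) =
        t.touchpoint ∅ k := rfl
    rw [htp, ← hr] at h0
    simp only [vsub_eq_sub] at h0
    have : t.incenter - AffineMap.lineMap (t.points i) (t.points j) r =
        (t.incenter - t.points i) - r • (t.points j - t.points i) := by
      simp only [AffineMap.lineMap_apply, vsub_eq_sub, vadd_eq_add]; abel
    rw [this, inner_sub_right, inner_smul_right] at h0
    linarith

/-- Two triangles with the same vertex set differ by a permutation of the vertices, under which the
incenter is invariant. -/
lemma IsIncenter.unique {s : Finset Plane} {c c' : Plane} (h : IsIncenter s c)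
    (h' : IsIncenter s c') : c = c' := by
  obtain ⟨t, ht, rfl⟩ := h
  obtain ⟨t', ht', rfl⟩ := h'
  have hr : Set.range t.points = Set.range t'.points := ht.trans ht'.symm
  have hx : ∀ i, ∃ j, t'.points j = t.points i := fun i => by
    have : t.points i ∈ Set.range t'.points := hr ▸ Set.mem_range_self i
    exact this
  choose f hf using hx
  have hinj : Function.Injective f := fun i j hij =>
    t.independent.injective (by rw [← hf i, ← hf j, hij])
  let e : Fin 3 ≃ Fin 3 := Equiv.ofBijective f (Finite.injective_iff_bijective.1 hinj)
  have : t'.reindex e.symm = t := by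
    ext i
    rw [Affine.Simplex.reindex_points]
    exact congrFun (congrArg _ (hf i)) _
  rw [← this, Affine.Simplex.incenter_reindex]

open scoped Classical

/-! ### Faces of a planar complex -/

lemma exists_third {s : Finset Plane} (hs : s.card = 3) {a b : Plane} (ha : a ∈ s) (hb : b ∈ s)
    (hab : a ≠ b) : ∃ d ∈ s, a ≠ d ∧ b ≠ d ∧ s = {a, b, d} := by
  have h1 : ((s.erase a).erase b).card = 1 := by
    rw [Finset.card_erase_of_mem (by simp [hb, hab.symm]), Finset.card_erase_of_mem ha, hs]
  obtain ⟨d, hd⟩ := Finset.card_eq_one.1 h1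
  have hd' : d ∈ (s.erase a).erase b := by rw [hd]; simp
  simp only [Finset.mem_erase] at hd'
  refine ⟨d, hd'.2.2, Ne.symm hd'.2.1, Ne.symm hd'.1, ?_⟩
  symm
  apply Finset.eq_of_subset_of_card_le
  · intro x hx
    simp only [Finset.mem_insert, Finset.mem_singleton] at hx
    rcases hx with rfl | rfl | rfl
    exacts [ha, hb, hd'.2.2]
  · rw [hs, Finset.card_eq_three.2 ⟨a, b, d, hab, Ne.symm hd'.2.1, Ne.symm hd'.1, rfl⟩]

lemma coe_triple (a b d : Plane) : (({a, b, d} : Finset Plane) : Set Plane) = {a, b, d} := by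
  simp

variable {K : Geometry.SimplicialComplex ℝ Plane} {Ω : Set Plane}

/-- A point of the relative interior of `s` that lies in `t` lies in the hull of `s ∩ t` by
conformity. Affine independence makes its weights unique, so none of the positive weights can sit
outside `t`. -/
lemma subset_of_pos_weights {s t : Finset Plane} (hs : s ∈ K.faces) (ht : t ∈ K.faces)
    {w : Plane → ℝ} (hw : ∀ v ∈ s, 0 < w v) (hsum : ∑ v ∈ s, w v = 1)
    (hx : ∑ v ∈ s, w v • v ∈ convexHull ℝ (t : Set Plane)) : s ⊆ t := by
  have hxs : ∑ v ∈ s, w v • v ∈ convexHull ℝ (s : Set Plane) :=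
    Finset.mem_convexHull'.2 ⟨w, fun v hv => (hw v hv).le, hsum, rfl⟩
  have h := K.inter_subset_convexHull hs ht ⟨hxs, hx⟩
  rw [← Finset.coe_inter] at h
  obtain ⟨w', -, hsum', hx'⟩ := Finset.mem_convexHull'.1 h
  have hst : s ∩ t ⊆ s := Finset.inter_subset_left
  have hi := affineIndependent_iff.1 (K.indep hs) Finset.univ
    (fun v => w v - if (v : Plane) ∈ s ∩ t then w' v else 0) ?_ ?_
  · intro v hv
    by_contra hvt
    have := hi ⟨v, hv⟩ (Finset.mem_univ _)
    simp only [Finset.mem_inter, hvt, and_false, if_false, sub_zero] at this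
    exact (hw v hv).ne' this
  · rw [Finset.sum_coe_sort s (fun v => w v - if v ∈ s ∩ t then w' v else 0),
      Finset.sum_sub_distrib, hsum, Finset.sum_ite_mem, Finset.inter_eq_right.2 hst, hsum', sub_self]
  · rw [Finset.sum_coe_sort s (fun v => (w v - if v ∈ s ∩ t then w' v else 0) • v)]
    simp only [sub_smul, Finset.sum_sub_distrib, ite_smul, zero_smul]
    rw [Finset.sum_ite_mem, Finset.inter_eq_right.2 hst, hx', sub_self]

lemma subset_of_mem_openSegment {e t : Finset Plane} {a b x : Plane} (he : e ∈ K.faces)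
    (hab : a ≠ b) (hea : e = {a, b}) (ht : t ∈ K.faces) (hx : x ∈ openSegment ℝ a b)
    (hxt : x ∈ convexHull ℝ (t : Set Plane)) : e ⊆ t := by
  obtain ⟨p, q, hp, hq, hpq, rfl⟩ := hx
  subst hea
  refine subset_of_pos_weights he ht (w := fun v => if v = a then p else q) ?_ ?_ ?_
  · intro v _
    split_ifs <;> assumption
  · rw [Finset.sum_pair hab]; simpa [hab.symm] using hpq
  · rw [Finset.sum_pair hab]; simpa [hab.symm] using hxt

lemma subset_of_mem_openTri {s t : Finset Plane} {a b d x : Plane} (hs : s ∈ K.faces)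
    (hab : a ≠ b) (had : a ≠ d) (hbd : b ≠ d) (hsa : s = {a, b, d}) (ht : t ∈ K.faces)
    (hx : x ∈ openTri a b d) (hxt : x ∈ convexHull ℝ (t : Set Plane)) : s ⊆ t := by
  obtain ⟨α, β, δ, hα, hβ, hδ, h, rfl⟩ := hx
  subst hsa
  refine subset_of_pos_weights hs ht (w := fun v => if v = a then α else if v = b then β else δ)
    ?_ ?_ ?_
  · intro v _
    split_ifs <;> assumption
  · rw [Finset.sum_insert (by simp [hab, had]), Finset.sum_pair hbd]
    simpa [hab.symm, had.symm, hbd.symm, ← add_assoc] using h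
  · rw [Finset.sum_insert (by simp [hab, had]), Finset.sum_pair hbd]
    simpa [hab.symm, had.symm, hbd.symm, comb, ← add_assoc] using hxt

lemma area_ne_zero {s : Finset Plane} (hs : s ∈ K.faces) {a b d : Plane} (ha : a ∈ s)
    (hb : b ∈ s) (hd : d ∈ s) (hab : a ≠ b) (had : a ≠ d) (hbd : b ≠ d) :
    cross (b - a) (d - a) ≠ 0 := by
  intro h0
  have hind : ∀ w : Plane → ℝ, ∑ v ∈ {a, b, d}, w v = 0 → ∑ v ∈ {a, b, d}, w v • v = 0 →
      ∀ v ∈ ({a, b, d} : Finset Plane), w v = 0 := by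
    intro w h1 h2 v hv
    have hf : ({a, b, d} : Finset Plane) ∈ K.faces :=
      K.down_closed hs (by simp [Finset.insert_subset_iff, ha, hb, hd]) (by simp)
    refine affineIndependent_iff.1 (K.indep hf) Finset.univ (fun v => w v) ?_ ?_ ⟨v, hv⟩
      (Finset.mem_univ _)
    · rw [Finset.sum_coe_sort _ w, h1]
    · rw [Finset.sum_coe_sort _ (fun v => w v • v), h2]
  have key : ∀ p q : ℝ, p • (b - a) + q • (d - a) = 0 → q = 0 := by
    intro p q hpq
    have := hind (fun v => if v = a then -p - q else if v = b then p else q) ?_ ?_ d (by simp)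
    · simpa [had.symm, hbd.symm] using this
    · rw [Finset.sum_insert (by simp [hab, had]), Finset.sum_pair hbd]
      simp [hab.symm, had.symm, hbd.symm]
    · rw [Finset.sum_insert (by simp [hab, had]), Finset.sum_pair hbd]
      simp only [hab.symm, had.symm, hbd.symm, if_true, if_false]
      rw [← hpq]
      module
  -- If the area vanishes, then `-(d - a) k • (b - a) + (b - a) k • (d - a) = 0` for both
  -- coordinates `k`. The second coefficient must vanish, which gives `b = a`.
  have h1 := key (-(d - a) 0) ((b - a) 0) (by
    apply plane_ext <;> simp [cross] at h0 ⊢ <;> linarith)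
  have h2 := key (-(d - a) 1) ((b - a) 1) (by
    apply plane_ext <;> simp [cross] at h0 ⊢ <;> linarith)
  apply hab
  apply plane_ext <;> simp at h1 h2 <;> linarith

lemma exists_isIncenter {s : Finset Plane} (hs : s ∈ macroTriangles K) :
    ∃ c, IsIncenter s c := by
  have e : Fin 3 ≃ s := (Fintype.equivFinOfCardEq (by simp [hs.2])).symm
  let t : Affine.Triangle ℝ Plane :=
    ⟨fun i => (e i : Plane), (K.indep hs.1).comp_embedding e.toEmbedding⟩
  refine ⟨t.incenter, t, ?_, rfl⟩
  ext x
  constructor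
  · rintro ⟨i, rfl⟩
    exact (e i).2
  · intro hx
    exact ⟨e.symm ⟨x, hx⟩, by simp [t]⟩

/-! ### Triangulations of a polygonal domain -/

lemma IsTriangulation.finite_macroTriangles (hK : IsTriangulation K Ω) :
    (macroTriangles K).Finite := hK.finite.subset fun _ h => h.1

lemma IsTriangulation.finite_macroEdges (hK : IsTriangulation K Ω) :
    (macroEdges K).Finite := hK.finite.subset fun _ h => h.1

lemma isClosed_hull (s : Finset Plane) : IsClosed (convexHull ℝ (s : Set Plane)) :=
  (s.finite_toSet.isCompact_convexHull (𝕜 := ℝ)).isClosed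

lemma hull_subset_closure (hK : IsTriangulation K Ω) {s : Finset Plane} (hs : s ∈ K.faces) :
    convexHull ℝ (s : Set Plane) ⊆ closure Ω :=
  hK.space_eq ▸ K.convexHull_subset_space hs

lemma card_face_le (s : Finset Plane) (hs : s ∈ K.faces) : s.card ≤ 3 := by
  have h := (K.indep hs).card_le_finrank_succ
  have h2 : Module.finrank ℝ (vectorSpan ℝ (Set.range ((↑) : s → Plane))) ≤ 2 :=
    (Submodule.finrank_le _).trans (by simp)
  rw [Fintype.card_coe] at h
  omega

/-- The part of Ω outside the closed triangles is open and covered by the finitely many vertices and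
edges, a null set; so it is empty. -/
lemma closure_subset_triangles (hΩ : IsPolygonalDomain Ω) (hK : IsTriangulation K Ω) :
    closure Ω ⊆ ⋃ s ∈ macroTriangles K, convexHull ℝ (s : Set Plane) := by
  have hcl : IsClosed (⋃ s ∈ macroTriangles K, convexHull ℝ (s : Set Plane)) :=
    hK.finite_macroTriangles.isClosed_biUnion fun s _ => isClosed_hull s
  refine closure_minimal (fun x hx => ?_) hcl
  by_contra hxn
  have hopen : IsOpen (Ω \ ⋃ s ∈ macroTriangles K, convexHull ℝ (s : Set Plane)) :=
    hΩ.isOpen.sdiff hcl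
  have hpos := hopen.measure_pos volume ⟨x, hx, hxn⟩
  refine hpos.ne' (measure_mono_null (t := ⋃ s ∈ {s ∈ K.faces | s.card ≤ 2},
    convexHull ℝ (s : Set Plane)) ?_ ?_)
  · rintro y ⟨hy, hyn⟩
    have hys : y ∈ K.space := hK.space_eq ▸ subset_closure hy
    obtain ⟨s, hs, hys⟩ := Geometry.SimplicialComplex.mem_space_iff.1 hys
    refine mem_iUnion₂.2 ⟨s, ⟨hs, ?_⟩, hys⟩
    by_contra hc
    have h3 : s.card = 3 := by have := card_face_le s hs; omega
    exact hyn (mem_iUnion₂.2 ⟨s, ⟨hs, h3⟩, hys⟩)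
  · refine (measure_biUnion_null_iff (hK.finite.subset fun _ h => h.1).countable).2 ?_
    rintro s ⟨hs, hc⟩
    have h0 : s.card ≠ 0 := (K.nonempty_of_mem_faces hs).card_ne_zero
    rcases (by omega : s.card = 1 ∨ s.card = 2) with h | h
    · obtain ⟨a, rfl⟩ := Finset.card_eq_one.1 h
      simp
    · obtain ⟨a, b, -, rfl⟩ := Finset.card_eq_two.1 h
      rw [Finset.coe_pair, convexHull_pair]
      exact volume_segment a b

/-- The barycentre of `f` has positive weights and lies in some triangle, which must then contain
`f`. -/
lemma exists_triangle_superset (hΩ : IsPolygonalDomain Ω) (hK : IsTriangulation K Ω)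
    {f : Finset Plane} (hf : f ∈ K.faces) : ∃ s ∈ macroTriangles K, f ⊆ s := by
  have h0 : (f.card : ℝ) ≠ 0 := by exact_mod_cast (K.nonempty_of_mem_faces hf).card_ne_zero
  have hsum : ∑ _v ∈ f, (1 / f.card : ℝ) = 1 := by
    rw [Finset.sum_const, nsmul_eq_mul, mul_one_div_cancel h0]
  have hx : ∑ v ∈ f, (1 / f.card : ℝ) • v ∈ convexHull ℝ (f : Set Plane) :=
    Finset.mem_convexHull'.2 ⟨fun _ => 1 / f.card, fun _ _ => by positivity, hsum, rfl⟩
  obtain ⟨s, hs, hxs⟩ := mem_iUnion₂.1 (closure_subset_triangles hΩ hK (hull_subset_closure hK hf hx))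
  refine ⟨s, hs, subset_of_pos_weights hf hs.1 (w := fun _ => 1 / f.card) (fun v _ => ?_) hsum hxs⟩
  have : 0 < f.card := Finset.card_pos.2 (K.nonempty_of_mem_faces hf)
  positivity

lemma eventually_mem_hull (hK : IsTriangulation K Ω) (x : Plane) :
    ∀ᶠ y in 𝓝 x, ∀ s ∈ macroTriangles K, y ∈ convexHull ℝ (s : Set Plane) →
      x ∈ convexHull ℝ (s : Set Plane) := by
  rw [hK.finite_macroTriangles.eventually_all]
  intro s _
  by_cases hx : x ∈ convexHull ℝ (s : Set Plane)
  · exact Eventually.of_forall fun _ _ => hx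
  · filter_upwards [(isClosed_hull s).isOpen_compl.mem_nhds hx] with y hy hys
    exact absurd hys hy

lemma frontier_eq (hΩ : IsPolygonalDomain Ω) : frontier Ω = closure Ω \ Ω := by
  rw [frontier, hΩ.isOpen.interior_eq]

/-- Regularity of Ω rules out slits and punctures: a point that is surrounded by triangles cannot be
a boundary point. -/
lemma mem_of_mem_nhds_closure (hΩ : IsPolygonalDomain Ω) {x : Plane} (h : closure Ω ∈ 𝓝 x) :
    x ∈ Ω := by
  rw [← hΩ.interior_closure]; exact mem_interior_iff_mem_nhds.2 h

/-- In this form the sign of the coordinate tells on which side of the line through `a` and `b` the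
point lies. -/
lemma bary_third (a b d x : Plane) :
    bary d a b x = cross (b - a) (x - a) / cross (b - a) (d - a) := by
  unfold bary
  rw [← area_rotate d a b]
  congr 1
  simp only [cross, PiLp.sub_apply]; ring

lemma bary_pos_of_mem_openSegment {a b d x : Plane} (hΔ : cross (b - a) (d - a) ≠ 0)
    (hx : x ∈ openSegment ℝ a b) : 0 < bary a b d x ∧ 0 < bary b d a x ∧ bary d a b x = 0 := by
  obtain ⟨p, q, hp, hq, hpq, rfl⟩ := hx
  have hx : p • a + q • b = comb p q 0 a b d := by simp [comb]
  refine ⟨?_, ?_, ?_⟩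
  · rwa [hx, bary_comb hΔ (by linarith)]
  · rwa [hx, comb_rotate, bary_comb (by rwa [area_rotate]) (by linarith)]
  · rw [hx, comb_rotate, comb_rotate, bary_comb (by rwa [area_rotate d a b] at hΔ) (by linarith)]

lemma eq_of_same_side {a b d d' : Plane} {s s' : Finset Plane}
    (hs : s ∈ macroTriangles K) (hs' : s' ∈ macroTriangles K) (hsa : s = {a, b, d})
    (hsa' : s' = {a, b, d'}) (hab : a ≠ b) (had : a ≠ d) (hbd : b ≠ d)
    (h : 0 < cross (b - a) (d - a) * cross (b - a) (d' - a)) : s = s' := by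
  have hΔ : cross (b - a) (d - a) ≠ 0 := left_ne_zero_of_mul h.ne'
  have hΔ' : cross (b - a) (d' - a) ≠ 0 := right_ne_zero_of_mul h.ne'
  -- The path starts at the midpoint of the edge and moves into the triangle `a b d`. For small
  -- positive parameters it is also interior to `a b d'`, but different triangles have disjoint
  -- interiors.
  let f : ℝ → Plane := fun t => comb ((1 - t) / 2) ((1 - t) / 2) t a b d
  have hf : Continuous f := by unfold f comb; fun_prop
  have hf0 : f 0 ∈ openSegment ℝ a b :=
    ⟨1 / 2, 1 / 2, by norm_num, by norm_num, by norm_num, by simp [f, comb]⟩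
  obtain ⟨h1, h2, -⟩ := bary_pos_of_mem_openSegment hΔ' hf0
  have e1 : ∀ᶠ t in 𝓝[>] (0 : ℝ), 0 < bary a b d' (f t) :=
    (((continuous_bary a b d').comp hf).tendsto 0 |>.eventually (lt_mem_nhds h1)).filter_mono
      nhdsWithin_le_nhds
  have e2 : ∀ᶠ t in 𝓝[>] (0 : ℝ), 0 < bary b d' a (f t) :=
    (((continuous_bary b d' a).comp hf).tendsto 0 |>.eventually (lt_mem_nhds h2)).filter_mono
      nhdsWithin_le_nhds
  obtain ⟨t, h1, h2, ht0, ht1⟩ := (e1.and (e2.and (Ioo_mem_nhdsGT (zero_lt_one' ℝ)))).exists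
  have h3 : 0 < bary d' a b (f t) := by
    have : bary d a b (f t) = t := by
      simp only [f]
      rw [comb_rotate, comb_rotate, bary_comb (by rwa [area_rotate d a b] at hΔ) (by ring)]
    rw [bary_third] at this ⊢
    rw [div_eq_iff hΔ] at this
    rw [this, mul_div_assoc]
    exact mul_pos ht0 (div_pos_iff.2 (mul_pos_iff.1 h))
  have ho : f t ∈ openTri a b d' := (mem_openTri_iff_bary hΔ').2 ⟨h1, h2, h3⟩
  have ho' : f t ∈ openTri a b d :=
    ⟨_, _, _, by linarith, by linarith, ht0, by ring, rfl⟩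
  have hsub := subset_of_mem_openTri hs.1 hab had hbd hsa hs'.1 ho'
    (by rw [hsa', coe_triple]; exact openTri_subset_hull _ _ _ ho)
  exact Finset.eq_of_subset_of_card_le hsub (by rw [hs.2, hs'.2])

/-! ### Interior and exterior edges -/

lemma area_mul_neg {a b d d' : Plane} {s s' : Finset Plane}
    (hs : s ∈ macroTriangles K) (hs' : s' ∈ macroTriangles K) (hne : s ≠ s') (hsa : s = {a, b, d})
    (hsa' : s' = {a, b, d'}) (hab : a ≠ b) (had : a ≠ d) (hbd : b ≠ d) (had' : a ≠ d')
    (hbd' : b ≠ d') : cross (b - a) (d - a) * cross (b - a) (d' - a) < 0 := by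
  have hΔ : cross (b - a) (d - a) ≠ 0 :=
    area_ne_zero hs.1 (by simp [hsa]) (by simp [hsa]) (by simp [hsa]) hab had hbd
  have hΔ' : cross (b - a) (d' - a) ≠ 0 :=
    area_ne_zero hs'.1 (by simp [hsa']) (by simp [hsa']) (by simp [hsa']) hab had' hbd'
  rcases (mul_ne_zero hΔ hΔ').lt_or_gt with h | h
  · exact h
  · exact absurd (eq_of_same_side hs hs' hsa hsa' hab had hbd h) hne

/-- Triangles on a common edge lie pairwise on opposite sides of it, and there are only two sides.
-/
lemma eq_or_eq_of_edge {s₁ s₂ s₃ : Finset Plane} (h₁ : s₁ ∈ macroTriangles K)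
    (h₂ : s₂ ∈ macroTriangles K) (h₃ : s₃ ∈ macroTriangles K) (hne : s₁ ≠ s₂)
    {e : Finset Plane} (he : e.card = 2) (he₁ : e ⊆ s₁) (he₂ : e ⊆ s₂) (he₃ : e ⊆ s₃) :
    s₃ = s₁ ∨ s₃ = s₂ := by
  obtain ⟨a, b, hab, rfl⟩ := Finset.card_eq_two.1 he
  simp only [Finset.insert_subset_iff, Finset.singleton_subset_iff] at he₁ he₂ he₃
  obtain ⟨d₁, -, ha1, hb1, e1⟩ := exists_third h₁.2 he₁.1 he₁.2 hab
  obtain ⟨d₂, -, ha2, hb2, e2⟩ := exists_third h₂.2 he₂.1 he₂.2 hab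
  obtain ⟨d₃, -, ha3, hb3, e3⟩ := exists_third h₃.2 he₃.1 he₃.2 hab
  by_contra! hcon
  have h12 := area_mul_neg h₁ h₂ hne e1 e2 hab ha1 hb1 ha2 hb2
  have h31 := area_mul_neg h₃ h₁ hcon.1 e3 e1 hab ha3 hb3 ha1 hb1
  have h32 := area_mul_neg h₃ h₂ hcon.2 e3 e2 hab ha3 hb3 ha2 hb2
  rcases mul_neg_iff.1 h12 with h | h <;> rcases mul_neg_iff.1 h31 with h' | h' <;>
    rcases mul_neg_iff.1 h32 with h'' | h'' <;> linarith

/-- The two triangles lie on opposite sides of the edge, so together they cover a neighbourhood of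
each of its relatively interior points. -/
lemma openSegment_subset_interior (hΩ : IsPolygonalDomain Ω) (hK : IsTriangulation K Ω)
    {s s' : Finset Plane} (hs : s ∈ macroTriangles K) (hs' : s' ∈ macroTriangles K) (hne : s ≠ s')
    {a b : Plane} (hab : a ≠ b) (ha : a ∈ s) (hb : b ∈ s) (ha' : a ∈ s') (hb' : b ∈ s') :
    openSegment ℝ a b ⊆ Ω := by
  obtain ⟨d, hd, had, hbd, e1⟩ := exists_third hs.2 ha hb hab
  obtain ⟨d', hd', had', hbd', e2⟩ := exists_third hs'.2 ha' hb' hab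
  have hneg := area_mul_neg hs hs' hne e1 e2 hab had hbd had' hbd'
  have hΔ : cross (b - a) (d - a) ≠ 0 := left_ne_zero_of_mul hneg.ne
  have hΔ' : cross (b - a) (d' - a) ≠ 0 := right_ne_zero_of_mul hneg.ne
  intro x hx
  apply mem_of_mem_nhds_closure hΩ
  obtain ⟨h1, h2, -⟩ := bary_pos_of_mem_openSegment hΔ hx
  obtain ⟨h1', h2', -⟩ := bary_pos_of_mem_openSegment hΔ' hx
  filter_upwards [(continuous_bary _ _ _).tendsto x |>.eventually (lt_mem_nhds h1),
    (continuous_bary _ _ _).tendsto x |>.eventually (lt_mem_nhds h2),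
    (continuous_bary _ _ _).tendsto x |>.eventually (lt_mem_nhds h1'),
    (continuous_bary _ _ _).tendsto x |>.eventually (lt_mem_nhds h2')] with y g1 g2 g1' g2'
  by_cases h3 : 0 ≤ bary d a b y
  · apply hull_subset_closure hK hs.1
    rw [e1, coe_triple]
    exact (mem_hull3_iff_bary hΔ).2 ⟨g1.le, g2.le, h3⟩
  · apply hull_subset_closure hK hs'.1
    rw [e2, coe_triple]
    refine (mem_hull3_iff_bary hΔ').2 ⟨g1'.le, g2'.le, ?_⟩
    rw [bary_third] at h3 ⊢
    rw [not_le, div_neg_iff] at h3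
    rw [div_nonneg_iff]
    rcases mul_neg_iff.1 hneg with h | h <;> rcases h3 with h' | h'
    · linarith
    · exact Or.inr ⟨h'.1.le, h.2.le⟩
    · exact Or.inl ⟨h'.1.le, h.2.le⟩
    · linarith

lemma hull_subset_frontier (hΩ : IsPolygonalDomain Ω) (hK : IsTriangulation K Ω)
    {s : Finset Plane} (hs : s ∈ macroTriangles K) {a b : Plane} (hab : a ≠ b) (ha : a ∈ s)
    (hb : b ∈ s) (huniq : ∀ t ∈ macroTriangles K, a ∈ t → b ∈ t → t = s) :
    convexHull ℝ ({a, b} : Set Plane) ⊆ frontier Ω := by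
  obtain ⟨d, hd, had, hbd, e1⟩ := exists_third hs.2 ha hb hab
  have hΔ : cross (b - a) (d - a) ≠ 0 := area_ne_zero hs.1 ha hb hd hab had hbd
  have he : ({a, b} : Finset Plane) ∈ K.faces :=
    K.down_closed hs.1 (by simp [Finset.insert_subset_iff, ha, hb]) (by simp)
  rw [convexHull_pair, ← closure_openSegment]
  refine closure_minimal (fun x hx => ?_) isClosed_frontier
  rw [frontier_eq hΩ]
  refine ⟨hull_subset_closure hK he ?_, fun hxΩ => ?_⟩
  · rw [Finset.coe_pair, convexHull_pair]; exact openSegment_subset_segment _ _ _ hx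
  -- From a point of the edge assumed to be in Ω, this path leaves `s` across the edge. Its points
  -- near `x` lie in triangles that contain `x`, hence the edge, hence in `s` itself; but there the
  -- coordinate of `d` would be negative.
  let f : ℝ → Plane := fun t => x - t • (d - x)
  have hf : Tendsto f (𝓝[>] 0) (𝓝 x) := by
    have : Continuous f := by unfold f; fun_prop
    have h0 := this.tendsto 0
    simp only [f, zero_smul, sub_zero] at h0
    exact h0.mono_left nhdsWithin_le_nhds
  obtain ⟨t, h1, h2, ht⟩ := ((hf.eventually (hΩ.isOpen.mem_nhds hxΩ)).and
    ((hf.eventually (eventually_mem_hull hK x)).and self_mem_nhdsWithin)).exists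
  obtain ⟨s', hs', hys'⟩ := mem_iUnion₂.1 (closure_subset_triangles hΩ hK (subset_closure h1))
  have hsub := subset_of_mem_openSegment he hab rfl hs'.1 hx (h2 s' hs' hys')
  simp only [Finset.insert_subset_iff, Finset.singleton_subset_iff] at hsub
  obtain rfl := huniq s' hs' hsub.1 hsub.2
  rw [e1, coe_triple] at hys'
  have h3 := ((mem_hull3_iff_bary hΔ).1 hys').2.2
  have h4 := (bary_pos_of_mem_openSegment hΔ hx).2.2
  rw [bary_third, div_eq_zero_iff, or_iff_left hΔ] at h4
  rw [bary_third] at h3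
  have h5 : cross (b - a) (f t - a) = -t * cross (b - a) (d - a) := by
    have : cross (b - a) (f t - a) = (1 + t) * cross (b - a) (x - a)
        - t * cross (b - a) (d - a) := by
      simp only [f, cross, PiLp.sub_apply, PiLp.smul_apply, smul_eq_mul]; ring
    rw [this, h4]; ring
  rw [h5, mul_div_cancel_right₀ _ hΔ] at h3
  have : (0 : ℝ) < t := ht
  linarith

/-- This translates the topological notion of an interior edge into a combinatorial one. -/
lemma mem_interiorEdges_iff (hΩ : IsPolygonalDomain Ω) (hK : IsTriangulation K Ω)
    {e : Finset Plane} (he : e ∈ macroEdges K) : e ∈ interiorEdges K Ω ↔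
      ∃ s ∈ macroTriangles K, ∃ s' ∈ macroTriangles K, s ≠ s' ∧ e ⊆ s ∧ e ⊆ s' := by
  obtain ⟨a, b, hab, rfl⟩ := Finset.card_eq_two.1 he.2
  simp only [Finset.insert_subset_iff, Finset.singleton_subset_iff]
  constructor
  · rintro ⟨-, hn⟩
    obtain ⟨s, hs, hes⟩ := exists_triangle_superset hΩ hK he.1
    simp only [Finset.insert_subset_iff, Finset.singleton_subset_iff] at hes
    by_contra! hcon
    apply hn
    rw [Finset.coe_pair]
    refine hull_subset_frontier hΩ hK hs hab hes.1 hes.2 fun t ht hat hbt => ?_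
    by_contra hts
    exact hcon s hs t ht (Ne.symm hts) hes hat hbt
  · rintro ⟨s, hs, s', hs', hne, h1, h2⟩
    refine ⟨he, fun hsub => ?_⟩
    have hm : midpoint ℝ a b ∈ openSegment ℝ a b :=
      ⟨1 / 2, 1 / 2, by norm_num, by norm_num, by norm_num, by
        rw [midpoint_eq_smul_add]; simp⟩
    have h3 := openSegment_subset_interior hΩ hK hs hs' hne hab h1.1 h1.2 h2.1 h2.2 hm
    rw [Finset.coe_pair, convexHull_pair] at hsub
    have h4 := hsub (openSegment_subset_segment _ _ _ hm)
    rw [frontier_eq hΩ] at h4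
    exact h4.2 h3

lemma mem_exteriorEdges_iff {e : Finset Plane} (he : e ∈ macroEdges K) :
    e ∈ exteriorEdges K Ω ↔ e ∉ interiorEdges K Ω := by
  simp [exteriorEdges, interiorEdges, he]

/-! ### Split points -/

lemma cross_pos_of_mem_openTri {a b d c : Plane} (hc : c ∈ openTri a b d) :
    ∃ δ : ℝ, 0 < δ ∧ cross (b - a) (c - a) = δ * cross (b - a) (d - a) := by
  obtain ⟨α, β, δ, -, -, hδ, h, rfl⟩ := hc
  refine ⟨δ, hδ, ?_⟩
  obtain rfl : α = 1 - β - δ := by linarith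
  simp only [cross, PiLp.sub_apply, comb_apply]; ring

/-- The incenters lie on opposite sides of the line through `a` and `b`, so their segment crosses it
once. The position of the crossing along the edge is a convex combination of `r₁` and `r₂`, hence
strictly between 0 and 1. -/
lemma exists_crossing {a b c₁ c₂ : Plane} {r₁ r₂ : ℝ} (hab : a ≠ b)
    (hr₁ : 0 < r₁) (hr₁' : r₁ < 1) (hr₂ : 0 < r₂) (hr₂' : r₂ < 1)
    (h₁ : inner ℝ (b - a) (c₁ - a) = r₁ * inner ℝ (b - a) (b - a))
    (h₂ : inner ℝ (b - a) (c₂ - a) = r₂ * inner ℝ (b - a) (b - a))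
    (hneg : cross (b - a) (c₁ - a) * cross (b - a) (c₂ - a) < 0) :
    ∃ z ∈ openSegment ℝ a b, z ∈ openSegment ℝ c₁ c₂ ∧
      ∀ z' ∈ convexHull ℝ ({a, b} : Set Plane), z' ∈ segment ℝ c₁ c₂ → z' = z := by
  set f₁ := cross (b - a) (c₁ - a) with hf₁
  set f₂ := cross (b - a) (c₂ - a) with hf₂
  have hd : f₁ - f₂ ≠ 0 := by
    intro h
    have : f₁ = f₂ := by linarith
    rw [this] at hneg
    nlinarith [mul_self_nonneg f₂]
  have key : ∀ p q : ℝ, p + q = 1 →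
      cross (b - a) (p • c₁ + q • c₂ - a) = p * f₁ + q * f₂ := by
    intro p q hpq
    obtain rfl : p = 1 - q := by linarith
    simp only [hf₁, hf₂, cross, PiLp.sub_apply, PiLp.add_apply, PiLp.smul_apply, smul_eq_mul]; ring
  obtain ⟨t, ht0, ht1, htf⟩ : ∃ t : ℝ, 0 < t ∧ t < 1 ∧ (1 - t) * f₁ + t * f₂ = 0 := by
    -- The zero of the affine function that interpolates the signed heights `f₁` and `f₂`.
    refine ⟨f₁ / (f₁ - f₂), ?_, ?_, ?_⟩
    · rcases mul_neg_iff.1 hneg with h | h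
      · exact div_pos h.1 (by linarith)
      · exact div_pos_of_neg_of_neg h.1 (by linarith)
    · rcases mul_neg_iff.1 hneg with h | h
      · rw [div_lt_one (by linarith)]; linarith
      · rw [div_lt_one_of_neg (by linarith)]; linarith
    · field_simp; ring
  refine ⟨(1 - t) • c₁ + t • c₂, ?_, ⟨1 - t, t, by linarith, ht0, by ring, rfl⟩, ?_⟩
  · refine ⟨1 - ((1 - t) * r₁ + t * r₂), (1 - t) * r₁ + t * r₂, ?_, ?_, by ring, ?_⟩
    · nlinarith
    · have : 0 < 1 - t := by linarith
      positivity
    · have hc := key (1 - t) t (by ring)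
      rw [htf] at hc
      simp only [PiLp.inner_apply, Fin.sum_univ_two, RCLike.inner_apply, conj_trivial] at h₁ h₂
      simp only [cross, PiLp.sub_apply, PiLp.add_apply, PiLp.smul_apply, smul_eq_mul] at hc h₁ h₂
      have hu : (b 0 - a 0) * (b 0 - a 0) + (b 1 - a 1) * (b 1 - a 1) ≠ 0 := by
        intro h
        have h0 : b 0 - a 0 = 0 := by nlinarith [mul_self_nonneg (b 0 - a 0), mul_self_nonneg (b 1 - a 1)]
        have h1 : b 1 - a 1 = 0 := by nlinarith [mul_self_nonneg (b 0 - a 0), mul_self_nonneg (b 1 - a 1)]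
        exact hab (plane_ext (by linarith) (by linarith))
      apply plane_ext <;> apply mul_left_cancel₀ hu <;>
        simp only [PiLp.add_apply, PiLp.smul_apply, smul_eq_mul]
      · linear_combination (-(b 1 - a 1)) * hc * (-1) - (b 0 - a 0) * ((1 - t) * h₁ + t * h₂)
      · linear_combination (b 0 - a 0) * hc * (-1) - (b 1 - a 1) * ((1 - t) * h₁ + t * h₂)
  · intro z' hz' hz''
    obtain ⟨p, q, hp, hq, hpq, rfl⟩ := hz''
    have h0 : cross (b - a) (p • c₁ + q • c₂ - a) = 0 := by
      rw [convexHull_pair] at hz'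
      obtain ⟨p', q', -, -, hpq', he⟩ := hz'
      rw [← he]
      obtain rfl : p' = 1 - q' := by linarith
      simp only [cross, PiLp.sub_apply, PiLp.add_apply, PiLp.smul_apply, smul_eq_mul]; ring
    rw [key p q hpq] at h0
    have : (q - t) * (f₁ - f₂) = 0 := by
      obtain rfl : p = 1 - q := by linarith
      linarith
    have hqt : q = t := by
      rcases mul_eq_zero.1 this with h | h
      · linarith
      · exact absurd h hd
    rw [hqt, show p = 1 - t by linarith]

lemma exists_splitPoint_interior {a b c₁ c₂ : Plane} {s₁ s₂ : Finset Plane}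
    (h₁ : s₁ ∈ macroTriangles K) (h₂ : s₂ ∈ macroTriangles K) (hne : s₁ ≠ s₂) (hab : a ≠ b)
    (ha₁ : a ∈ s₁) (hb₁ : b ∈ s₁) (ha₂ : a ∈ s₂) (hb₂ : b ∈ s₂)
    (hc₁ : IsIncenter s₁ c₁) (hc₂ : IsIncenter s₂ c₂) :
    ∃ z ∈ openSegment ℝ a b, z ∈ openSegment ℝ c₁ c₂ ∧
      ∀ z' ∈ convexHull ℝ ({a, b} : Set Plane), z' ∈ segment ℝ c₁ c₂ → z' = z := by
  obtain ⟨d, hd, had, hbd, e1⟩ := exists_third h₁.2 ha₁ hb₁ hab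
  obtain ⟨d', hd', had', hbd', e2⟩ := exists_third h₂.2 ha₂ hb₂ hab
  have hneg := area_mul_neg h₁ h₂ hne e1 e2 hab had hbd had' hbd'
  obtain ⟨r₁, hr₁, hr₁', hi₁⟩ := hc₁.exists_foot ha₁ hb₁ hd hab had hbd
  obtain ⟨r₂, hr₂, hr₂', hi₂⟩ := hc₂.exists_foot ha₂ hb₂ hd' hab had' hbd'
  obtain ⟨δ₁, hδ₁, hx₁⟩ := cross_pos_of_mem_openTri (hc₁.mem_openTri ha₁ hb₁ hd hab had hbd)
  obtain ⟨δ₂, hδ₂, hx₂⟩ := cross_pos_of_mem_openTri (hc₂.mem_openTri ha₂ hb₂ hd' hab had' hbd')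
  refine exists_crossing hab hr₁ hr₁' hr₂ hr₂' hi₁ hi₂ ?_
  rw [hx₁, hx₂]
  have : δ₁ * δ₂ * (cross (b - a) (d - a) * cross (b - a) (d' - a)) < 0 :=
    mul_neg_of_pos_of_neg (mul_pos hδ₁ hδ₂) hneg
  linarith

/-- The incenter of a macro-triangle. -/
def cen (s : Finset Plane) : Plane := if h : ∃ c, IsIncenter s c then h.choose else 0

lemma isIncenter_cen {s : Finset Plane} (hs : s ∈ macroTriangles K) : IsIncenter s (cen s) := by
  have h := exists_isIncenter hs
  rw [cen, dif_pos h]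
  exact h.choose_spec

lemma isIncenter_iff {s : Finset Plane} (hs : s ∈ macroTriangles K) {c : Plane} :
    IsIncenter s c ↔ c = cen s :=
  ⟨fun h => h.unique (isIncenter_cen hs), fun h => h ▸ isIncenter_cen hs⟩

lemma existsUnique_splitPoint (hΩ : IsPolygonalDomain Ω) (hK : IsTriangulation K Ω)
    {e : Finset Plane} (he : e ∈ macroEdges K) : ∃! z, IsSplitPoint K Ω e z := by
  obtain ⟨a, b, hab, rfl⟩ := Finset.card_eq_two.1 he.2
  by_cases hi : ({a, b} : Finset Plane) ∈ interiorEdges K Ω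
  · have hx : ({a, b} : Finset Plane) ∉ exteriorEdges K Ω := by
      rw [mem_exteriorEdges_iff he]; exact not_not.2 hi
    obtain ⟨s₁, h₁, s₂, h₂, hne, he₁, he₂⟩ := (mem_interiorEdges_iff hΩ hK he).1 hi
    have he₁' := he₁
    have he₂' := he₂
    simp only [Finset.insert_subset_iff, Finset.singleton_subset_iff] at he₁' he₂'
    obtain ⟨z, hz1, hz2, hz3⟩ := exists_splitPoint_interior h₁ h₂ hne hab he₁'.1 he₁'.2 he₂'.1
      he₂'.2 (isIncenter_cen h₁) (isIncenter_cen h₂)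
    refine ⟨z, Or.inl ⟨hi, s₁, h₁, s₂, h₂, hne, he₁, he₂, _, _, isIncenter_cen h₁,
      isIncenter_cen h₂, ?_, openSegment_subset_segment _ _ _ hz2⟩, ?_⟩
    · rw [Finset.coe_pair, convexHull_pair]
      exact openSegment_subset_segment _ _ _ hz1
    · rintro z' (⟨-, t₁, g₁, t₂, g₂, hne', hf₁, hf₂, c₁, c₂, hc₁, hc₂, hz', hz''⟩ | ⟨h, -⟩)
      · rw [isIncenter_iff g₁] at hc₁
        rw [isIncenter_iff g₂] at hc₂
        subst hc₁ hc₂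
        rw [Finset.coe_pair] at hz'
        rcases eq_or_eq_of_edge h₁ h₂ g₁ hne he.2 he₁ he₂ hf₁ with rfl | rfl <;>
          rcases eq_or_eq_of_edge h₁ h₂ g₂ hne he.2 he₁ he₂ hf₂ with rfl | rfl
        · exact absurd rfl hne'
        · exact hz3 z' hz' hz''
        · exact hz3 z' hz' (by rwa [segment_symm])
        · exact absurd rfl hne'
      · exact absurd h hx
  · have hx : ({a, b} : Finset Plane) ∈ exteriorEdges K Ω := (mem_exteriorEdges_iff he).2 hi
    refine ⟨midpoint ℝ a b, Or.inr ⟨hx, a, b, by simp, rfl⟩, ?_⟩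
    rintro z' (⟨h, -⟩ | ⟨-, a', b', hab', rfl⟩)
    · exact absurd h hi
    · rw [Finset.coe_pair, Set.pair_eq_pair_iff] at hab'
      rcases hab' with ⟨rfl, rfl⟩ | ⟨rfl, rfl⟩
      · rfl
      · exact midpoint_comm _ _

/-- The point at which a macro-edge is split. -/
def spl (K : Geometry.SimplicialComplex ℝ Plane) (Ω : Set Plane) (e : Finset Plane) : Plane :=
  if h : ∃ z, IsSplitPoint K Ω e z then h.choose else 0

lemma isSplitPoint_iff (hΩ : IsPolygonalDomain Ω) (hK : IsTriangulation K Ω)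
    {e : Finset Plane} (he : e ∈ macroEdges K) {z : Plane} :
    IsSplitPoint K Ω e z ↔ z = spl K Ω e := by
  have h := existsUnique_splitPoint hΩ hK he
  have h1 : IsSplitPoint K Ω e (spl K Ω e) := by
    rw [spl, dif_pos h.exists]
    exact h.exists.choose_spec
  exact ⟨fun h2 => h.unique h2 h1, fun h2 => h2 ▸ h1⟩

lemma spl_mem_openSegment (hΩ : IsPolygonalDomain Ω) (hK : IsTriangulation K Ω)
    {a b : Plane} (hab : a ≠ b) (he : {a, b} ∈ macroEdges K) :
    spl K Ω {a, b} ∈ openSegment ℝ a b := by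
  rcases (isSplitPoint_iff hΩ hK he).2 rfl with
    ⟨-, t₁, g₁, t₂, g₂, hne', hf₁, hf₂, c₁, c₂, hc₁, hc₂, hz', hz''⟩ | ⟨-, a', b', hab', h⟩
  · simp only [Finset.insert_subset_iff, Finset.singleton_subset_iff] at hf₁ hf₂
    obtain ⟨z, hz1, hz2, hz3⟩ := exists_splitPoint_interior g₁ g₂ hne' hab hf₁.1 hf₁.2 hf₂.1
      hf₂.2 hc₁ hc₂
    rw [Finset.coe_pair] at hz'
    rwa [hz3 _ hz' hz'']
  · rw [h]
    have hm : ∀ p q : Plane, midpoint ℝ p q ∈ openSegment ℝ p q := fun p q =>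
      ⟨1 / 2, 1 / 2, by norm_num, by norm_num, by norm_num, by rw [midpoint_eq_smul_add]; simp⟩
    rw [Finset.coe_pair, Set.pair_eq_pair_iff] at hab'
    rcases hab' with ⟨rfl, rfl⟩ | ⟨rfl, rfl⟩
    · exact hm _ _
    · rw [midpoint_comm]; exact hm _ _

/-- Seen from the split point, the two incenters lie in opposite directions. Together with the
collinearity along the macro-edge this makes the split point singular. -/
lemma spl_mem_openSegment_cen (hΩ : IsPolygonalDomain Ω) (hK : IsTriangulation K Ω)
    {s₁ s₂ e : Finset Plane} (h₁ : s₁ ∈ macroTriangles K) (h₂ : s₂ ∈ macroTriangles K)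
    (hne : s₁ ≠ s₂) (he : e ∈ macroEdges K) (he₁ : e ⊆ s₁) (he₂ : e ⊆ s₂) :
    spl K Ω e ∈ openSegment ℝ (cen s₁) (cen s₂) := by
  obtain ⟨a, b, hab, rfl⟩ := Finset.card_eq_two.1 he.2
  have he₁' := he₁
  have he₂' := he₂
  simp only [Finset.insert_subset_iff, Finset.singleton_subset_iff] at he₁' he₂'
  obtain ⟨z, hz1, hz2, hz3⟩ := exists_splitPoint_interior h₁ h₂ hne hab he₁'.1 he₁'.2 he₂'.1
    he₂'.2 (isIncenter_cen h₁) (isIncenter_cen h₂)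
  have : IsSplitPoint K Ω {a, b} z := by
    refine Or.inl ⟨(mem_interiorEdges_iff hΩ hK he).2 ⟨s₁, h₁, s₂, h₂, hne, he₁, he₂⟩, s₁, h₁,
      s₂, h₂, hne, he₁, he₂, _, _, isIncenter_cen h₁, isIncenter_cen h₂, ?_,
      openSegment_subset_segment _ _ _ hz2⟩
    rw [Finset.coe_pair, convexHull_pair]
    exact openSegment_subset_segment _ _ _ hz1
  rwa [← (isSplitPoint_iff hΩ hK he).1 this]

/-! ### The cells of the Powell-Sabin mesh -/

/-- `a` and `b` are distinct vertices of the macro-triangle `s`. -/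
structure IsFlag (K : Geometry.SimplicialComplex ℝ Plane) (s : Finset Plane) (a b : Plane) :
    Prop where
  tri : s ∈ macroTriangles K
  left : a ∈ s
  right : b ∈ s
  ne : a ≠ b

namespace IsFlag
variable {s : Finset Plane} {a b : Plane}

lemma symm (h : IsFlag K s a b) : IsFlag K s b a := ⟨h.tri, h.right, h.left, h.ne.symm⟩

lemma pair_subset (h : IsFlag K s a b) : ({a, b} : Finset Plane) ⊆ s := by
  simp [Finset.insert_subset_iff, h.left, h.right]

lemma edge (h : IsFlag K s a b) : ({a, b} : Finset Plane) ∈ macroEdges K :=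
  ⟨K.down_closed h.tri.1 h.pair_subset (by simp), Finset.card_pair h.ne⟩

lemma third (h : IsFlag K s a b) : ∃ d, a ≠ d ∧ b ≠ d ∧ s = {a, b, d} := by
  obtain ⟨d, -, h1, h2, h3⟩ := exists_third h.tri.2 h.left h.right h.ne
  exact ⟨d, h1, h2, h3⟩

lemma exists_isFlag (hs : s ∈ macroTriangles K) : ∃ a b, IsFlag K s a b := by
  obtain ⟨a, b, d, hab, -, -, rfl⟩ := Finset.card_eq_three.1 hs.2
  exact ⟨a, b, hs, by simp, by simp, hab⟩

end IsFlag

lemma isFlag_triple {s : Finset Plane} (hs : s ∈ macroTriangles K) {a b d : Plane}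
    (e : s = {a, b, d}) (hab : a ≠ b) (had : a ≠ d) (hbd : b ≠ d) :
    IsFlag K s a b ∧ IsFlag K s b d ∧ IsFlag K s d a := by
  subst e
  exact ⟨⟨hs, by simp, by simp, hab⟩, ⟨hs, by simp, by simp, hbd⟩, ⟨hs, by simp, by simp, had.symm⟩⟩

/-- The barycentric coordinate of `x` with respect to the vertex `p` of the triangle `s`. -/
def coord (s : Finset Plane) (p x : Plane) : ℝ :=
  if h : ∃ q r, p ≠ q ∧ p ≠ r ∧ q ≠ r ∧ s = {p, q, r} then
    bary p h.choose h.choose_spec.choose x else 0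

/-- The choice made in `coord` is unique up to interchanging the two other vertices, which does not
affect `bary`. -/
lemma coord_eq {s : Finset Plane} {a b d : Plane} (e : s = {a, b, d}) (hab : a ≠ b) (had : a ≠ d)
    (hbd : b ≠ d) (x : Plane) : coord s a x = bary a b d x := by
  have h : ∃ q r, a ≠ q ∧ a ≠ r ∧ q ≠ r ∧ s = {a, q, r} := ⟨b, d, hab, had, hbd, e⟩
  rw [coord, dif_pos h]
  obtain ⟨h1, h2, h3, h4⟩ := h.choose_spec.choose_spec
  generalize h.choose_spec.choose = r at h2 h3 h4 ⊢
  generalize h.choose = q at h1 h3 h4 ⊢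
  rw [e] at h4
  have h5 : q ∈ ({a, b, d} : Finset Plane) := by rw [h4]; simp
  have h6 : r ∈ ({a, b, d} : Finset Plane) := by rw [h4]; simp
  simp only [Finset.mem_insert, Finset.mem_singleton, h1.symm, h2.symm, false_or] at h5 h6
  rcases h5 with rfl | rfl <;> rcases h6 with rfl | rfl
  · exact absurd rfl h3
  · rfl
  · exact bary_swap _ _ _ _
  · exact absurd rfl h3

lemma bary_affine (a b d x y w : Plane) {α β δ : ℝ} (h : α + β + δ = 1) :
    bary a b d (comb α β δ x y w) = α * bary a b d x + β * bary a b d y + δ * bary a b d w := by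
  unfold bary
  obtain rfl : α = 1 - β - δ := by linarith
  simp only [cross, PiLp.sub_apply, comb_apply]; ring

lemma coord_comb {s : Finset Plane} (p x y w : Plane) {α β δ : ℝ} (h : α + β + δ = 1) :
    coord s p (comb α β δ x y w) = α * coord s p x + β * coord s p y + δ * coord s p w := by
  unfold coord
  split_ifs
  · exact bary_affine _ _ _ _ _ _ h
  · ring

/-! ### Barycentric coordinates in a macro-triangle -/

section triple
variable {s : Finset Plane} (hs : s ∈ macroTriangles K) {a b d : Plane}
  (e : s = {a, b, d}) (hab : a ≠ b) (had : a ≠ d) (hbd : b ≠ d)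
include hs e hab had hbd

lemma triple_area : cross (b - a) (d - a) ≠ 0 :=
  area_ne_zero hs.1 (by simp [e]) (by simp [e]) (by simp [e]) hab had hbd

omit hs in
lemma coord_triple (x : Plane) : coord s a x = bary a b d x ∧ coord s b x = bary b d a x ∧
    coord s d x = bary d a b x := by
  refine ⟨coord_eq e hab had hbd x, coord_eq (s := s) ?_ hbd hab.symm had.symm x,
    coord_eq (s := s) ?_ had.symm hbd.symm hab x⟩
  · rw [e]; ext; simp only [Finset.mem_insert, Finset.mem_singleton]; tauto
  · rw [e]; ext; simp only [Finset.mem_insert, Finset.mem_singleton]; tauto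

lemma coord_of_comb {α β δ : ℝ} (h : α + β + δ = 1) :
    coord s a (comb α β δ a b d) = α ∧ coord s b (comb α β δ a b d) = β ∧
      coord s d (comb α β δ a b d) = δ := by
  have hΔ := triple_area hs e hab had hbd
  obtain ⟨h1, h2, h3⟩ := coord_triple e hab had hbd (comb α β δ a b d)
  rw [h1, h2, h3]
  refine ⟨bary_comb hΔ h, ?_, ?_⟩
  · rw [comb_rotate, bary_comb (by rwa [area_rotate]) (by linarith)]
  · rw [comb_rotate, comb_rotate, bary_comb (by rwa [area_rotate d a b] at hΔ) (by linarith)]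

lemma coord_vertex : coord s a a = 1 ∧ coord s b a = 0 ∧ coord s d a = 0 := by
  have h := coord_of_comb hs e hab had hbd (α := 1) (β := 0) (δ := 0) (by norm_num)
  simpa [comb] using h

lemma coord_cen : 0 < coord s a (cen s) ∧ 0 < coord s b (cen s) ∧ 0 < coord s d (cen s) := by
  have h := (isIncenter_cen hs).mem_openTri (a := a) (b := b) (d := d) (by simp [e]) (by simp [e])
    (by simp [e]) hab had hbd
  obtain ⟨h1, h2, h3⟩ := coord_triple e hab had hbd (cen s)
  rw [h1, h2, h3]
  exact (mem_openTri_iff_bary (triple_area hs e hab had hbd)).1 h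

lemma coord_sum (x : Plane) : coord s a x + coord s b x + coord s d x = 1 := by
  obtain ⟨h1, h2, h3⟩ := coord_triple e hab had hbd x
  rw [h1, h2, h3]
  exact bary_sum (triple_area hs e hab had hbd) x

lemma eq_of_coord {x y : Plane} (h1 : coord s a x = coord s a y) (h2 : coord s b x = coord s b y) :
    x = y := by
  have hx := coord_sum hs e hab had hbd x
  have hy := coord_sum hs e hab had hbd y
  have h3 : coord s d x = coord s d y := by linarith
  obtain ⟨g1, g2, g3⟩ := coord_triple e hab had hbd x
  obtain ⟨g1', g2', g3'⟩ := coord_triple e hab had hbd y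
  have hΔ := triple_area hs e hab had hbd
  rw [← comb_bary hΔ x, ← comb_bary hΔ y, ← g1, ← g2, ← g3, ← g1', ← g2', ← g3', h1, h2, h3]

lemma mem_hull_iff_coord {x : Plane} : x ∈ convexHull ℝ (s : Set Plane) ↔
    0 ≤ coord s a x ∧ 0 ≤ coord s b x ∧ 0 ≤ coord s d x := by
  obtain ⟨h1, h2, h3⟩ := coord_triple e hab had hbd x
  rw [h1, h2, h3]
  nth_rewrite 1 [e]
  rw [coe_triple]
  exact mem_hull3_iff_bary (triple_area hs e hab had hbd)

lemma mem_openTri_iff_coord {x : Plane} : x ∈ openTri a b d ↔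
    0 < coord s a x ∧ 0 < coord s b x ∧ 0 < coord s d x := by
  obtain ⟨h1, h2, h3⟩ := coord_triple e hab had hbd x
  rw [h1, h2, h3]
  exact mem_openTri_iff_bary (triple_area hs e hab had hbd)

lemma subset_of_coord_pos {x : Plane} (h : 0 < coord s a x ∧ 0 < coord s b x ∧ 0 < coord s d x)
    {t : Finset Plane} (ht : t ∈ K.faces) (hx : x ∈ convexHull ℝ (t : Set Plane)) : s ⊆ t :=
  subset_of_mem_openTri hs.1 hab had hbd e ht ((mem_openTri_iff_coord hs e hab had hbd).2 h) hx

lemma coord_spl (hΩ : IsPolygonalDomain Ω) (hK : IsTriangulation K Ω) :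
    0 < coord s a (spl K Ω {a, b}) ∧ 0 < coord s b (spl K Ω {a, b}) ∧
      coord s d (spl K Ω {a, b}) = 0 := by
  obtain ⟨h1, h2, h3⟩ := coord_triple e hab had hbd (spl K Ω {a, b})
  rw [h1, h2, h3]
  exact bary_pos_of_mem_openSegment (triple_area hs e hab had hbd)
    (spl_mem_openSegment hΩ hK hab (isFlag_triple hs e hab had hbd).1.edge)

/-- The macro-coordinates of a point given by its coordinates in a cell. -/
lemma coord_cell (hΩ : IsPolygonalDomain Ω) (hK : IsTriangulation K Ω) {α β δ : ℝ}
    (h : α + β + δ = 1) :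
    coord s a (comb α β δ (cen s) (spl K Ω {a, b}) a) =
        α * coord s a (cen s) + β * coord s a (spl K Ω {a, b}) + δ ∧
      coord s b (comb α β δ (cen s) (spl K Ω {a, b}) a) =
        α * coord s b (cen s) + β * coord s b (spl K Ω {a, b}) ∧
      coord s d (comb α β δ (cen s) (spl K Ω {a, b}) a) = α * coord s d (cen s) := by
  obtain ⟨h1, h2, h3⟩ := coord_vertex hs e hab had hbd
  have h4 := (coord_spl hs e hab had hbd hΩ hK).2.2
  rw [coord_comb _ _ _ _ h, coord_comb _ _ _ _ h, coord_comb _ _ _ _ h, h1, h2, h3, h4]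
  simp

end triple

/-- The triangle of the Powell-Sabin mesh with the vertex `a` in the macro-triangle `s` on the
macro-edge with endpoints `a` and `b`. -/
def cell (K : Geometry.SimplicialComplex ℝ Plane) (Ω : Set Plane) (s : Finset Plane)
    (a b : Plane) : Set Plane :=
  {cen s, spl K Ω {a, b}, a}

lemma mem_psTriangles_iff (hΩ : IsPolygonalDomain Ω) (hK : IsTriangulation K Ω) {t : Set Plane} :
    t ∈ psTriangles K Ω ↔ ∃ s a b, IsFlag K s a b ∧ t = cell K Ω s a b := by
  constructor
  · rintro ⟨s, hs, e, he, hes, v, hv, c, z, hc, hz, rfl⟩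
    obtain ⟨p, q, hpq, rfl⟩ := Finset.card_eq_two.1 he.2
    rw [isIncenter_iff hs] at hc
    rw [isSplitPoint_iff hΩ hK he] at hz
    subst hc hz
    simp only [Finset.insert_subset_iff, Finset.singleton_subset_iff] at hes
    simp only [Finset.mem_insert, Finset.mem_singleton] at hv
    rcases hv with rfl | rfl
    · exact ⟨s, v, q, ⟨hs, hes.1, hes.2, hpq⟩, rfl⟩
    · exact ⟨s, v, p, ⟨hs, hes.2, hes.1, hpq.symm⟩, by rw [cell, Finset.pair_comm]⟩
  · rintro ⟨s, a, b, h, rfl⟩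
    exact ⟨s, h.tri, {a, b}, h.edge, h.pair_subset, a, by simp, _, _, isIncenter_cen h.tri,
      (isSplitPoint_iff hΩ hK h.edge).2 rfl, rfl⟩

lemma mem_cell_hull {s : Finset Plane} {a b x : Plane} :
    x ∈ convexHull ℝ (cell K Ω s a b) ↔ ∃ α β δ : ℝ, 0 ≤ α ∧ 0 ≤ β ∧ 0 ≤ δ ∧ α + β + δ = 1 ∧
      x = comb α β δ (cen s) (spl K Ω {a, b}) a := mem_hull3

lemma coord_cen_pos {s : Finset Plane} {p : Plane} (hs : s ∈ macroTriangles K) (hp : p ∈ s) :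
    0 < coord s p (cen s) := by
  obtain ⟨a, b, h⟩ := IsFlag.exists_isFlag hs
  obtain ⟨d, had, hbd, e⟩ := h.third
  obtain ⟨h1, h2, h3⟩ := coord_cen h.tri e h.ne had hbd
  rw [e] at hp
  simp only [Finset.mem_insert, Finset.mem_singleton] at hp
  rcases hp with rfl | rfl | rfl
  exacts [h1, h2, h3]

/-! ### Cells: disjoint interiors and covering -/

section cells
variable (hΩ : IsPolygonalDomain Ω) (hK : IsTriangulation K Ω)
include hΩ hK

lemma cell_area {s : Finset Plane} {a b d : Plane} (hs : s ∈ macroTriangles K)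
    (e : s = {a, b, d}) (hab : a ≠ b) (had : a ≠ d) (hbd : b ≠ d) :
    ∃ k : ℝ, 0 < k ∧ cross (cen s - spl K Ω {a, b}) (a - spl K Ω {a, b}) =
      k * cross (b - a) (d - a) := by
  have hc := (isIncenter_cen hs).mem_openTri (a := a) (b := b) (d := d) (by simp [e]) (by simp [e])
    (by simp [e]) hab had hbd
  obtain ⟨γa, γb, γd, -, -, hγd, hγ, hc⟩ := hc
  obtain ⟨p, q, -, hq, hpq, hz⟩ :=
    spl_mem_openSegment hΩ hK hab (isFlag_triple hs e hab had hbd).1.edge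
  -- The factor is the weight of `b` in the split point times the weight of `d` in the incenter. Its
  -- positivity makes the orientation of the cell that of `(a, b, d)`.
  refine ⟨q * γd, mul_pos hq hγd, ?_⟩
  rw [← hz, hc]
  obtain rfl : p = 1 - q := by linarith
  obtain rfl : γa = 1 - γb - γd := by linarith
  simp only [cross, PiLp.sub_apply, comb_apply, PiLp.add_apply, PiLp.smul_apply, smul_eq_mul]
  ring

lemma IsFlag.area_ne_zero {s : Finset Plane} {a b : Plane} (h : IsFlag K s a b) :
    cross (cen s - spl K Ω {a, b}) (a - spl K Ω {a, b}) ≠ 0 := by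
  obtain ⟨d, had, hbd, e⟩ := h.third
  obtain ⟨k, hk, hk'⟩ := cell_area hΩ hK h.tri e h.ne had hbd
  rw [hk']
  exact mul_ne_zero hk.ne' (triple_area h.tri e h.ne had hbd)

lemma IsFlag.area_ne_zero' {s : Finset Plane} {a b : Plane} (h : IsFlag K s a b) :
    cross (spl K Ω {a, b} - cen s) (a - cen s) ≠ 0 := by
  rw [← area_rotate (cen s), cross_swap, neg_ne_zero]
  exact h.area_ne_zero hΩ hK

lemma cell_hull_subset {s : Finset Plane} {a b : Plane} (h : IsFlag K s a b) :
    convexHull ℝ (cell K Ω s a b) ⊆ convexHull ℝ (s : Set Plane) := by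
  obtain ⟨d, had, hbd, e⟩ := h.third
  intro x hx
  obtain ⟨α, β, δ, hα, hβ, hδ, hsum, rfl⟩ := (mem_cell_hull).1 hx
  rw [mem_hull_iff_coord h.tri e h.ne had hbd]
  obtain ⟨h1, h2, h3⟩ := coord_cell h.tri e h.ne had hbd hΩ hK hsum
  obtain ⟨g1, g2, g3⟩ := coord_cen h.tri e h.ne had hbd
  obtain ⟨k1, k2, -⟩ := coord_spl h.tri e h.ne had hbd hΩ hK
  rw [h1, h2, h3]
  refine ⟨by positivity, by positivity, by positivity⟩

lemma coord_pos_of_cen_pos {s : Finset Plane} {a b d : Plane} (hs : s ∈ macroTriangles K)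
    (e : s = {a, b, d}) (hab : a ≠ b) (had : a ≠ d) (hbd : b ≠ d) {α β δ : ℝ} (hα : 0 < α)
    (hβ : 0 ≤ β) (hδ : 0 ≤ δ) (hsum : α + β + δ = 1) :
    0 < coord s a (comb α β δ (cen s) (spl K Ω {a, b}) a) ∧
      0 < coord s b (comb α β δ (cen s) (spl K Ω {a, b}) a) ∧
      0 < coord s d (comb α β δ (cen s) (spl K Ω {a, b}) a) := by
  obtain ⟨h1, h2, h3⟩ := coord_cell hs e hab had hbd hΩ hK hsum
  obtain ⟨g1, g2, g3⟩ := coord_cen hs e hab had hbd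
  obtain ⟨k1, k2, -⟩ := coord_spl hs e hab had hbd hΩ hK
  rw [h1, h2, h3]
  refine ⟨by positivity, by positivity, by positivity⟩

/-- A positive weight at the incenter puts the point into the interior of the macro-triangle, where
no other macro-triangle reaches. -/
lemma tri_eq_of_cen_pos {s s' : Finset Plane} {a b a' b' : Plane} (h : IsFlag K s a b)
    (h' : IsFlag K s' a' b') {α β δ : ℝ} (hα : 0 < α) (hβ : 0 ≤ β) (hδ : 0 ≤ δ)
    (hsum : α + β + δ = 1)
    (hx : comb α β δ (cen s) (spl K Ω {a, b}) a ∈ convexHull ℝ (cell K Ω s' a' b')) :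
    s = s' := by
  obtain ⟨d, had, hbd, e⟩ := h.third
  have hsub := subset_of_coord_pos h.tri e h.ne had hbd
    (coord_pos_of_cen_pos hΩ hK h.tri e h.ne had hbd hα hβ hδ hsum) h'.tri.1
    (cell_hull_subset hΩ hK h' hx)
  exact Finset.eq_of_subset_of_card_le hsub (by rw [h.tri.2, h'.tri.2])

/-- The weight of the incenter at `x` is the minimum over the vertices `p` of the ratio of `coord s
p x` to `coord s p (cen s)`, attained at the vertex opposite to the edge of the cell. This
description does not mention the cell; the present lemma is the bound half. -/
lemma le_coord_of_mem_cell {s : Finset Plane} {a b p : Plane} (h : IsFlag K s a b) (hp : p ∈ s)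
    {α β δ : ℝ} (hβ : 0 ≤ β) (hδ : 0 ≤ δ) (hsum : α + β + δ = 1) :
    α * coord s p (cen s) ≤ coord s p (comb α β δ (cen s) (spl K Ω {a, b}) a) := by
  obtain ⟨d, had, hbd, e⟩ := h.third
  obtain ⟨h1, h2, h3⟩ := coord_cell h.tri e h.ne had hbd hΩ hK hsum
  obtain ⟨k1, k2, -⟩ := coord_spl h.tri e h.ne had hbd hΩ hK
  rw [e] at hp
  simp only [Finset.mem_insert, Finset.mem_singleton] at hp
  rcases hp with rfl | rfl | rfl
  · rw [h1]; linarith [mul_nonneg hβ k1.le]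
  · rw [h2]; linarith [mul_nonneg hβ k2.le]
  · rw [h3]

lemma cen_weight_le {s : Finset Plane} {a b a' b' : Plane} (h : IsFlag K s a b)
    (h' : IsFlag K s a' b') {α β δ α' β' δ' : ℝ}
    (hsum : α + β + δ = 1) (hβ' : 0 ≤ β') (hδ' : 0 ≤ δ') (hsum' : α' + β' + δ' = 1)
    (hx : comb α β δ (cen s) (spl K Ω {a, b}) a = comb α' β' δ' (cen s) (spl K Ω {a', b'}) a') :
    α' ≤ α := by
  obtain ⟨d, had, hbd, e⟩ := h.third
  have h3 := (coord_cell h.tri e h.ne had hbd hΩ hK hsum).2.2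
  have hd : d ∈ s := by simp [e]
  have := le_coord_of_mem_cell hΩ hK h' hd hβ' hδ' hsum'
  rw [← hx, h3] at this
  exact le_of_mul_le_mul_right this (coord_cen_pos h.tri hd)

/-- The weight of the incenter does not depend on the cell. -/
lemma cen_weight_eq {s : Finset Plane} {a b a' b' : Plane} (h : IsFlag K s a b)
    (h' : IsFlag K s a' b') {α β δ α' β' δ' : ℝ} (hβ : 0 ≤ β) (hδ : 0 ≤ δ)
    (hsum : α + β + δ = 1) (hβ' : 0 ≤ β') (hδ' : 0 ≤ δ') (hsum' : α' + β' + δ' = 1)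
    (hx : comb α β δ (cen s) (spl K Ω {a, b}) a = comb α' β' δ' (cen s) (spl K Ω {a', b'}) a') :
    α = α' :=
  le_antisymm (cen_weight_le hΩ hK h' h hsum' hβ hδ hsum hx.symm)
    (cen_weight_le hΩ hK h h' hsum hβ' hδ' hsum' hx)

lemma edge_eq_of_spl_pos {s s' : Finset Plane} {a b a' b' : Plane} (h : IsFlag K s a b)
    (h' : IsFlag K s' a' b') {α β δ : ℝ} (hα : 0 ≤ α) (hβ : 0 < β) (hδ : 0 ≤ δ)
    (hsum : α + β + δ = 1)
    (hx : comb α β δ (cen s) (spl K Ω {a, b}) a ∈ convexHull ℝ (cell K Ω s' a' b')) :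
    ({a, b} : Finset Plane) = {a', b'} := by
  obtain ⟨α', β', δ', hα', hβ', hδ', hsum', hx'⟩ := (mem_cell_hull).1 hx
  suffices hsub : ({a, b} : Finset Plane) ⊆ {a', b'} from
    Finset.eq_of_subset_of_card_le hsub (by rw [Finset.card_pair h.ne, Finset.card_pair h'.ne])
  obtain ⟨d, had, hbd, e⟩ := h.third
  obtain ⟨h1, h2, h3⟩ := coord_cell h.tri e h.ne had hbd hΩ hK hsum
  obtain ⟨k1, k2, -⟩ := coord_spl h.tri e h.ne had hbd hΩ hK
  -- With weight zero at the incenter, both representations describe a point of a macro-edge,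
  -- relatively interior to `{a, b}`, and conformity of the macro-mesh applies. Otherwise both cells
  -- lie in the same macro-triangle and have the same incenter weight.
  rcases hα.eq_or_lt with rfl | hα
  · have hα0 : α' = 0 := by
      by_contra hne
      have hpos := hα'.lt_of_ne' hne
      have hs := tri_eq_of_cen_pos hΩ hK h' h hpos hβ' hδ' hsum'
        (by rw [← hx']; exact (mem_cell_hull).2 ⟨0, β, δ, le_rfl, hβ.le, hδ, hsum, rfl⟩)
      subst hs
      have := cen_weight_eq hΩ hK h h' hβ.le hδ hsum hβ' hδ' hsum' hx'
      exact hne this.symm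
    subst hα0
    obtain ⟨p, q, hp, hq, hpq, hz⟩ := spl_mem_openSegment hΩ hK h.ne h.edge
    obtain ⟨p', q', hp', hq', hpq', hz'⟩ := spl_mem_openSegment hΩ hK h'.ne h'.edge
    refine subset_of_mem_openSegment h.edge.1 h.ne rfl h'.edge.1
      (x := comb 0 β δ (cen s) (spl K Ω {a, b}) a) ?_ ?_
    · refine ⟨β * p + δ, β * q, by positivity, by positivity, ?_, ?_⟩
      · linear_combination hsum + β * hpq
      · rw [← hz, comb]; module
    · rw [hx', Finset.coe_pair, convexHull_pair]
      refine ⟨β' * p' + δ', β' * q', by positivity, by positivity, ?_, ?_⟩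
      · linear_combination hsum' + β' * hpq'
      · rw [← hz', comb]; module
  · obtain rfl := tri_eq_of_cen_pos hΩ hK h h' hα hβ.le hδ hsum hx
    obtain rfl := cen_weight_eq hΩ hK h h' hβ.le hδ hsum hβ' hδ' hsum' hx'
    obtain ⟨d', had', hbd', e'⟩ := h'.third
    obtain ⟨-, -, h3'⟩ := coord_cell h'.tri e' h'.ne had' hbd' hΩ hK hsum'
    have hd' : d' ∈ s := by simp [e']
    -- The minimal ratio is attained at `d'`, but a positive weight at the split point makes the
    -- ratios at `a` and `b` strictly larger.
    have hne : d' = d := by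
      rw [← hx'] at h3'
      rw [e] at hd'
      simp only [Finset.mem_insert, Finset.mem_singleton] at hd'
      rcases hd' with rfl | rfl | rfl
      · rw [h1] at h3'
        have := mul_pos hβ k1
        linarith
      · rw [h2] at h3'
        have := mul_pos hβ k2
        linarith
      · rfl
    intro x hxab
    have hxs : x ∈ s := h.pair_subset hxab
    have hxd : x ≠ d' := by
      rintro rfl
      simp only [Finset.mem_insert, Finset.mem_singleton] at hxab
      rw [hne] at hxab
      rcases hxab with hh | hh
      · exact had hh.symm
      · exact hbd hh.symm
    rw [e'] at hxs
    simpa [hxd] using hxs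

lemma spl_weight_eq_aux {s : Finset Plane} {a b a' b' : Plane} (h : IsFlag K s a b)
    (he : ({a, b} : Finset Plane) = {a', b'}) {α β δ β' δ' : ℝ} (hδ : 0 ≤ δ)
    (hsum : α + β + δ = 1) (hδ' : 0 ≤ δ') (hsum' : α + β' + δ' = 1)
    (hx : comb α β δ (cen s) (spl K Ω {a, b}) a = comb α β' δ' (cen s) (spl K Ω {a', b'}) a') :
    β = β' ∧ (0 < δ → a = a') := by
  obtain ⟨d, had, hbd, e⟩ := h.third
  rw [← he] at hx
  obtain ⟨h1, h2, h3⟩ := coord_cell h.tri e h.ne had hbd hΩ hK hsum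
  obtain ⟨k1, k2, -⟩ := coord_spl h.tri e h.ne had hbd hΩ hK
  have ha' : a' = a ∨ a' = b := by
    have : a' ∈ ({a, b} : Finset Plane) := by rw [he]; simp
    simpa using this
  rcases ha' with rfl | rfl
  · obtain ⟨g1, g2, g3⟩ := coord_cell h.tri e h.ne had hbd hΩ hK hsum'
    rw [← hx, h2] at g2
    have : β * coord s b (spl K Ω {a', b}) = β' * coord s b (spl K Ω {a', b}) := by linarith
    exact ⟨mul_right_cancel₀ k2.ne' this, fun _ => rfl⟩
  -- The two cells lie on different sides of the split point. Comparing the coordinates of `a` gives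
  -- `β ≤ β'`, comparing those of `a'` gives `β' ≤ β`; equality then leaves no weight `δ`.
  · have ga := coord_comb (s := s) a (cen s) (spl K Ω {a, a'}) a' hsum'
    have gb := coord_comb (s := s) a' (cen s) (spl K Ω {a, a'}) a' hsum'
    have e2 : s = {a', a, d} := by rw [e, Finset.insert_comm]
    obtain ⟨v1, v2, -⟩ := coord_vertex h.tri e2 h.ne.symm hbd had
    rw [← hx, h1, v2] at ga
    rw [← hx, h2, v1] at gb
    have i1 : β * coord s a (spl K Ω {a, a'}) ≤ β' * coord s a (spl K Ω {a, a'}) := by linarith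
    have i2 : β' * coord s a' (spl K Ω {a, a'}) ≤ β * coord s a' (spl K Ω {a, a'}) := by linarith
    have := le_antisymm (le_of_mul_le_mul_right i1 k1) (le_of_mul_le_mul_right i2 k2)
    refine ⟨this, fun hpos => ?_⟩
    rw [this] at ga
    linarith

/-- The weight of the split point does not depend on the cell. -/
lemma spl_weight_eq {s s' : Finset Plane} {a b a' b' : Plane} (h : IsFlag K s a b)
    (h' : IsFlag K s' a' b') (he : ({a, b} : Finset Plane) = {a', b'}) {α β δ α' β' δ' : ℝ}
    (hα : 0 ≤ α) (hβ : 0 ≤ β) (hδ : 0 ≤ δ) (hsum : α + β + δ = 1)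
    (hα' : 0 ≤ α') (hβ' : 0 ≤ β') (hδ' : 0 ≤ δ') (hsum' : α' + β' + δ' = 1)
    (hx : comb α β δ (cen s) (spl K Ω {a, b}) a =
      comb α' β' δ' (cen s') (spl K Ω {a', b'}) a') :
    β = β' ∧ (s = s' → 0 < δ → a = a') := by
  by_cases hs : s = s'
  · subst hs
    obtain rfl := cen_weight_eq hΩ hK h h' hβ hδ hsum hβ' hδ' hsum' hx
    obtain ⟨h1, h2⟩ := spl_weight_eq_aux hΩ hK h he hδ hsum hδ' hsum' hx
    exact ⟨h1, fun _ => h2⟩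
  -- In different macro-triangles neither point has weight at an incenter, so one incenter may be
  -- replaced by the other without changing the point.
  · have h0 : α = 0 := by
      by_contra hne
      exact hs (tri_eq_of_cen_pos hΩ hK h h' (hα.lt_of_ne' hne) hβ hδ hsum
        ((mem_cell_hull).2 ⟨α', β', δ', hα', hβ', hδ', hsum', hx⟩))
    have h0' : α' = 0 := by
      by_contra hne
      exact hs (tri_eq_of_cen_pos hΩ hK h' h (hα'.lt_of_ne' hne) hβ' hδ' hsum'
        ((mem_cell_hull).2 ⟨α, β, δ, hα, hβ, hδ, hsum, hx.symm⟩)).symm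
    subst h0 h0'
    refine ⟨(spl_weight_eq_aux hΩ hK h he hδ hsum hδ' hsum' ?_).1, fun h => absurd h hs⟩
    rw [hx]; simp [comb]

/-- Different cells have disjoint interiors. -/
lemma flag_eq_of_mem_openTri {s s' : Finset Plane} {a b a' b' x : Plane} (h : IsFlag K s a b)
    (h' : IsFlag K s' a' b') (hx : x ∈ openTri (cen s) (spl K Ω {a, b}) a)
    (hx' : x ∈ convexHull ℝ (cell K Ω s' a' b')) : s = s' ∧ a = a' ∧ b = b' := by
  obtain ⟨α, β, δ, hα, hβ, hδ, hsum, rfl⟩ := hx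
  have hs := tri_eq_of_cen_pos hΩ hK h h' hα hβ.le hδ.le hsum hx'
  have he := edge_eq_of_spl_pos hΩ hK h h' hα.le hβ hδ.le hsum hx'
  obtain ⟨α', β', δ', hα', hβ', hδ', hsum', hx''⟩ := (mem_cell_hull).1 hx'
  have ha := (spl_weight_eq hΩ hK h h' he hα.le hβ.le hδ.le hsum hα' hβ' hδ' hsum' hx'').2 hs hδ
  subst ha
  refine ⟨hs, rfl, ?_⟩
  have : b ∈ ({a, b'} : Finset Plane) := by rw [← he]; simp
  simpa [h.ne.symm] using this

lemma spl_mem_hull_cell {s s' : Finset Plane} {a b a' b' : Plane} (h : IsFlag K s a b)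
    (h' : IsFlag K s' a' b') (hx : spl K Ω {a, b} ∈ convexHull ℝ (cell K Ω s' a' b')) :
    ({a, b} : Finset Plane) = {a', b'} := by
  refine edge_eq_of_spl_pos hΩ hK h h' (α := 0) (β := 1) (δ := 0) le_rfl one_pos le_rfl
    (by norm_num) ?_
  simpa [comb] using hx

/-- The cells of a macro-triangle cover it. -/
lemma hull_subset_cells {s : Finset Plane} (hs : s ∈ macroTriangles K) {x : Plane}
    (hx : x ∈ convexHull ℝ (s : Set Plane)) :
    ∃ a b, IsFlag K s a b ∧ x ∈ convexHull ℝ (cell K Ω s a b) := by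
  -- The minimal ratio is the weight of the incenter, and the vertex where it is attained is
  -- opposite to the edge of the desired cell.
  obtain ⟨d, hd, hmin⟩ := s.exists_min_image (fun p => coord s p x / coord s p (cen s))
    (K.nonempty_of_mem_faces hs.1)
  obtain ⟨a, ha⟩ : (s.erase d).Nonempty := by
    rw [← Finset.card_pos, Finset.card_erase_of_mem hd, hs.2]; norm_num
  rw [Finset.mem_erase] at ha
  obtain ⟨b, -, hdb, hab, e⟩ := exists_third hs.2 hd ha.2 (Ne.symm ha.1)
  have had := ha.1
  have hbd := hdb.symm
  have e1 : s = {a, b, d} := by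
    rw [e]; ext; simp only [Finset.mem_insert, Finset.mem_singleton]; tauto
  obtain ⟨g1, g2, g3⟩ := coord_cen hs e1 hab had hbd
  obtain ⟨k1, k2, -⟩ := coord_spl hs e1 hab had hbd hΩ hK
  obtain ⟨x1, x2, x3⟩ := (mem_hull_iff_coord hs e1 hab had hbd).1 hx
  have m1 := hmin a ha.2
  have m2 := hmin b (by simp [e1])
  have hsx := coord_sum hs e1 hab had hbd x
  have hsc := coord_sum hs e1 hab had hbd (cen s)
  have hsz := coord_sum hs e1 hab had hbd (spl K Ω {a, b})
  rw [(coord_spl hs e1 hab had hbd hΩ hK).2.2] at hsz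
  set α := coord s d x / coord s d (cen s) with hα
  have hα0 : 0 ≤ α := by positivity
  have hαd : α * coord s d (cen s) = coord s d x := div_mul_cancel₀ _ g3.ne'
  rw [le_div_iff₀ g1] at m1
  rw [le_div_iff₀ g2] at m2
  have main : ∀ p q : Plane, s = {p, q, d} → p ≠ q → p ≠ d → q ≠ d → ∀ β : ℝ, 0 ≤ β →
      β * coord s q (spl K Ω {p, q}) = coord s q x - α * coord s q (cen s) →
      β * coord s p (spl K Ω {p, q}) ≤ coord s p x - α * coord s p (cen s) →
      ∃ a b, IsFlag K s a b ∧ x ∈ convexHull ℝ (cell K Ω s a b) := by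
    intro p q e2 hpq hpd hqd β hβ h1 h2
    refine ⟨p, q, (isFlag_triple hs e2 hpq hpd hqd).1, (mem_cell_hull).2 ?_⟩
    have hsx := coord_sum hs e2 hpq hpd hqd x
    have hsc := coord_sum hs e2 hpq hpd hqd (cen s)
    have hsz := coord_sum hs e2 hpq hpd hqd (spl K Ω {p, q})
    rw [(coord_spl hs e2 hpq hpd hqd hΩ hK).2.2] at hsz
    have hsum : α + β + (coord s p x - α * coord s p (cen s) - β * coord s p (spl K Ω {p, q}))
        = 1 := by
      linear_combination hsx - α * hsc - β * hsz + hαd + h1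
    refine ⟨α, β, _, hα0, hβ, by linarith, hsum, ?_⟩
    obtain ⟨f1, f2, -⟩ := coord_cell hs e2 hpq hpd hqd hΩ hK hsum
    exact eq_of_coord hs e2 hpq hpd hqd (by rw [f1]; ring) (by rw [f2, h1]; ring)
  have e2 : s = {b, a, d} := by rw [e1, Finset.insert_comm]
  have hμa : 0 ≤ coord s a x - α * coord s a (cen s) := by linarith
  have hμb : 0 ≤ coord s b x - α * coord s b (cen s) := by linarith
  -- After the incenter has been subtracted, the smaller of the two ratios to the coordinates of the
  -- split point becomes its weight. What remains is a nonnegative multiple of one endpoint.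
  rcases le_total ((coord s b x - α * coord s b (cen s)) / coord s b (spl K Ω {a, b}))
    ((coord s a x - α * coord s a (cen s)) / coord s a (spl K Ω {a, b})) with hle | hle
  · have h1 := div_mul_cancel₀ (coord s b x - α * coord s b (cen s)) k2.ne'
    have h2 := (le_div_iff₀ k1).1 hle
    have h3 := div_nonneg hμb k2.le
    exact main a b e1 hab had hbd _ h3 h1 h2
  · rw [Finset.pair_comm] at hle k1 k2
    have h1 := div_mul_cancel₀ (coord s a x - α * coord s a (cen s)) k1.ne'
    have h2 := (le_div_iff₀ k2).1 hle
    have h3 := div_nonneg hμa k1.le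
    exact main b a e2 hab.symm hbd had _ h3 h1 h2

lemma exists_cell {x : Plane} (hx : x ∈ closure Ω) :
    ∃ s a b, IsFlag K s a b ∧ x ∈ convexHull ℝ (cell K Ω s a b) := by
  obtain ⟨s, hs, hxs⟩ := mem_iUnion₂.1 (closure_subset_triangles hΩ hK hx)
  obtain ⟨a, b, h⟩ := hull_subset_cells hΩ hK hs hxs
  exact ⟨s, a, b, h⟩

lemma cell_subset_closure {s : Finset Plane} {a b : Plane} (h : IsFlag K s a b) :
    convexHull ℝ (cell K Ω s a b) ⊆ closure Ω :=
  (cell_hull_subset hΩ hK h).trans (hull_subset_closure hK h.tri.1)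

lemma openTri_subset_domain {s : Finset Plane} {a b : Plane} (h : IsFlag K s a b) :
    openTri (cen s) (spl K Ω {a, b}) a ⊆ Ω := by
  have hsub : openTri (cen s) (spl K Ω {a, b}) a ⊆ closure Ω :=
    (openTri_subset_hull _ _ _).trans (cell_subset_closure hΩ hK h)
  have := interior_maximal hsub (isOpen_openTri (h.area_ne_zero' hΩ hK))
  rwa [hΩ.interior_closure] at this

end cells

/-! ### Nodal fields and their divergence -/

/-- The set of flags of the macro-mesh, which index the cells of the Powell-Sabin mesh. -/
def flagSet (K : Geometry.SimplicialComplex ℝ Plane) : Set (Finset Plane × Plane × Plane) :=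
  {i | IsFlag K i.1 i.2.1 i.2.2}

lemma IsTriangulation.finite_flagSet (hK : IsTriangulation K Ω) : (flagSet K).Finite := by
  have : flagSet K ⊆ ⋃ s ∈ macroTriangles K, ({s} ×ˢ ((s : Set Plane) ×ˢ (s : Set Plane))) := by
    intro i hi
    exact mem_iUnion₂.2 ⟨i.1, hi.tri, rfl, hi.left, hi.right⟩
  refine Finite.subset (hK.finite_macroTriangles.biUnion fun s _ => ?_) this
  exact (finite_singleton s).prod (s.finite_toSet.prod s.finite_toSet)

/-- The closed cell that belongs to a flag. -/
def cellHull (K : Geometry.SimplicialComplex ℝ Plane) (Ω : Set Plane) (i : flagSet K) :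
    Set Plane :=
  convexHull ℝ (cell K Ω i.1.1 i.1.2.1 i.1.2.2)

/-- The incenter of a cell. -/
def cenOf (i : flagSet K) : Plane := cen i.1.1

/-- The split point of a cell. -/
def splOf (Ω : Set Plane) (i : flagSet K) : Plane := spl K Ω {i.1.2.1, i.1.2.2}

/-- The macro-vertex of a cell. -/
def vertOf (i : flagSet K) : Plane := i.1.2.1

lemma mem_cellHull {i : flagSet K} {x : Plane} : x ∈ cellHull K Ω i ↔
    ∃ α β δ : ℝ, 0 ≤ α ∧ 0 ≤ β ∧ 0 ≤ δ ∧ α + β + δ = 1 ∧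
      x = comb α β δ (cenOf i) (splOf Ω i) (vertOf i) := mem_hull3

lemma isClosed_cellHull (i : flagSet K) : IsClosed (cellHull K Ω i) :=
  (Finite.isCompact_convexHull (𝕜 := ℝ) (by simp [cell])).isClosed

lemma nodes_mem_cellHull (i : flagSet K) : cenOf i ∈ cellHull K Ω i ∧
    splOf Ω i ∈ cellHull K Ω i ∧ vertOf i ∈ cellHull K Ω i :=
  ⟨subset_convexHull ℝ _ (by simp [cell, cenOf]), subset_convexHull ℝ _ (by simp [cell, splOf]),
    subset_convexHull ℝ _ (by simp [cell, vertOf])⟩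

/-- The extension by zero of a field on the closure of `Ω`. -/
def extend (v : C(closure Ω, Plane)) (x : Plane) : Plane :=
  if h : x ∈ closure Ω then v ⟨x, h⟩ else 0

lemma component_eq (v : C(closure Ω, Plane)) (i : Fin 2) (x : Plane) :
    component v i x = extend v x i := by
  unfold component extend
  split_ifs <;> simp

lemma extend_apply (v : C(closure Ω, Plane)) (x : closure Ω) : extend v x = v x := by
  simp [extend]

lemma extend_add (v w : C(closure Ω, Plane)) (x : Plane) :
    extend (v + w) x = extend v x + extend w x := by
  unfold extend
  split_ifs <;> simp

lemma extend_smul (r : ℝ) (v : C(closure Ω, Plane)) (x : Plane) :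
    extend (r • v) x = r • extend v x := by
  unfold extend
  split_ifs <;> simp

/-- The divergence on a cell of a continuous field that is affine there. -/
def divMap (K : Geometry.SimplicialComplex ℝ Plane) (Ω : Set Plane) :
    C(closure Ω, Plane) →ₗ[ℝ] (flagSet K → ℝ) where
  toFun v i := (cross (extend v (cenOf i) - extend v (splOf Ω i)) (vertOf i - splOf Ω i) +
    cross (cenOf i - splOf Ω i) (extend v (vertOf i) - extend v (splOf Ω i))) /
      cross (cenOf i - splOf Ω i) (vertOf i - splOf Ω i)
  map_add' v w := by
    ext i
    simp only [extend_add, cross, PiLp.sub_apply, PiLp.add_apply, Pi.add_apply]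
    ring
  map_smul' r v := by
    ext i
    simp only [extend_smul, cross, PiLp.sub_apply, PiLp.smul_apply, Pi.smul_apply, smul_eq_mul,
      RingHom.id_apply]
    ring

section domain
variable (hΩ : IsPolygonalDomain Ω) (hK : IsTriangulation K Ω)
include hΩ hK

lemma cellHull_subset_closure (i : flagSet K) : cellHull K Ω i ⊆ closure Ω :=
  cell_subset_closure hΩ hK i.2

lemma exists_cellHull {x : Plane} (hx : x ∈ closure Ω) : ∃ i : flagSet K, x ∈ cellHull K Ω i := by
  obtain ⟨s, a, b, h, hx⟩ := exists_cell hΩ hK hx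
  exact ⟨⟨(s, a, b), h⟩, hx⟩

lemma cellArea_ne_zero (i : flagSet K) :
    cross (cenOf i - splOf Ω i) (vertOf i - splOf Ω i) ≠ 0 := i.2.area_ne_zero hΩ hK

lemma cellArea_ne_zero' (i : flagSet K) :
    cross (splOf Ω i - cenOf i) (vertOf i - cenOf i) ≠ 0 := i.2.area_ne_zero' hΩ hK

/-- Compatible functions on the cells can be glued to a nodal field. -/
lemma exists_glued_field (κ : flagSet K → Plane →ᵃ[ℝ] ℝ)
    (hcompat : ∀ i j x, x ∈ cellHull K Ω i → x ∈ cellHull K Ω j → κ i x = κ j x)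
    (hzero : ∀ i x, x ∈ cellHull K Ω i → x ∈ frontier Ω → κ i x = 0) (X : Plane) :
    ∃ v ∈ velocitySpaceZero K Ω, ∀ i, ∀ x ∈ cellHull K Ω i, extend v x = κ i x • X := by
  have hfin : Finite (flagSet K) := hK.finite_flagSet
  choose idx hidx using fun x : closure Ω => exists_cellHull hΩ hK x.2
  let f : closure Ω → ℝ := fun x => κ (idx x) x
  have hf : ∀ i (x : closure Ω), (x : Plane) ∈ cellHull K Ω i → f x = κ i x :=
    fun i x hx => hcompat _ _ _ (hidx x) hx
  have hcont : Continuous f := by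
    -- The closed cells form a finite cover, so continuity may be checked on each of them.
    refine (locallyFinite_of_finite (fun i : flagSet K => ((↑) : closure Ω → Plane) ⁻¹'
      cellHull K Ω i)).continuous ?_ ?_ ?_
    · exact eq_univ_of_forall fun x => mem_iUnion.2 ⟨idx x, hidx x⟩
    · exact fun i => (isClosed_cellHull i).preimage continuous_subtype_val
    · intro i
      have : Continuous fun x : closure Ω => κ i x :=
        (AffineMap.continuous_of_finiteDimensional (κ i)).comp continuous_subtype_val
      exact this.continuousOn.congr fun x hx => hf i x hx
  have hv : ∀ i, ∀ x ∈ cellHull K Ω i, extend (⟨fun x => f x • X, by fun_prop⟩ :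
      C(closure Ω, Plane)) x = κ i x • X := by
    intro i x hx
    have hxc := cellHull_subset_closure hΩ hK i hx
    rw [extend, dif_pos hxc, ContinuousMap.coe_mk, hf i ⟨x, hxc⟩ hx]
  refine ⟨⟨fun x => f x • X, by fun_prop⟩, ⟨?_, ?_⟩, hv⟩
  · intro t ht
    obtain ⟨s, a, b, h, rfl⟩ := (mem_psTriangles_iff hΩ hK).1 ht
    refine ⟨(LinearMap.toSpanSingleton ℝ Plane X).toAffineMap.comp (κ ⟨(s, a, b), h⟩), ?_⟩
    intro x hx
    rw [← extend_apply, hv ⟨(s, a, b), h⟩ x hx]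
    simp
  · intro x hx
    rw [← extend_apply, hv _ x (hidx x), hzero _ x (hidx x) hx, zero_smul]

/-- The nodal fields of an incenter. -/
lemma exists_cen_hat (s : Finset Plane) (X : Plane) :
    ∃ v ∈ velocitySpaceZero K Ω, ∀ i : flagSet K,
      extend v (cenOf i) = (if i.1.1 = s then X else 0) ∧
      extend v (splOf Ω i) = 0 ∧ extend v (vertOf i) = 0 := by
  have key : ∀ i : flagSet K, ∀ α β δ : ℝ, α + β + δ = 1 →
      bary (cenOf i) (splOf Ω i) (vertOf i) (comb α β δ (cenOf i) (splOf Ω i) (vertOf i)) = α :=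
    fun i α β δ h => bary_comb (cellArea_ne_zero' hΩ hK i) h
  refine Exists.imp ?_ (exists_glued_field hΩ hK
    (fun i => if i.1.1 = s then baryMap (cenOf i) (splOf Ω i) (vertOf i) else 0) ?_ ?_ X)
  · rintro v ⟨hv, hv'⟩
    refine ⟨hv, fun i => ?_⟩
    obtain ⟨h1, h2, h3⟩ := nodes_mem_cellHull (Ω := Ω) i
    rw [hv' i _ h1, hv' i _ h2, hv' i _ h3]
    have k1 := key i 1 0 0 (by norm_num)
    have k2 := key i 0 1 0 (by norm_num)
    have k3 := key i 0 0 1 (by norm_num)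
    simp only [comb, one_smul, zero_smul, add_zero, zero_add] at k1 k2 k3
    split_ifs <;> simp [baryMap_apply, k1, k2, k3]
  · intro i j x hxi hxj
    obtain ⟨α, β, δ, hα, hβ, hδ, hsum, hx⟩ := mem_cellHull.1 hxi
    obtain ⟨α', β', δ', hα', hβ', hδ', hsum', hx'⟩ := mem_cellHull.1 hxj
    have ki := key i α β δ hsum
    have kj := key j α' β' δ' hsum'
    rw [← hx] at ki
    rw [← hx'] at kj
    by_cases hij : i.1.1 = j.1.1
    · have hf : IsFlag K i.1.1 j.1.2.1 j.1.2.2 := hij ▸ j.2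
      have : α = α' := by
        refine cen_weight_eq hΩ hK i.2 hf hβ hδ hsum hβ' hδ' hsum' ?_
        have := hx.symm.trans hx'
        simpa only [cenOf, splOf, vertOf, hij] using this
      simp only [hij]
      split_ifs
      · rw [baryMap_apply, baryMap_apply, ki, kj, this]
      · rfl
    · have h0 : α = 0 := by
        by_contra hne
        exact hij (tri_eq_of_cen_pos hΩ hK i.2 j.2 (hα.lt_of_ne' hne) hβ hδ hsum (hx ▸ hxj))
      have h0' : α' = 0 := by
        by_contra hne
        exact hij (tri_eq_of_cen_pos hΩ hK j.2 i.2 (hα'.lt_of_ne' hne) hβ' hδ' hsum'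
          (hx' ▸ hxi)).symm
      rw [h0] at ki
      rw [h0'] at kj
      split_ifs <;> simp [baryMap_apply, ki, kj]
  · intro i x hxi hxf
    obtain ⟨α, β, δ, hα, hβ, hδ, hsum, hx⟩ := mem_cellHull.1 hxi
    have ki := key i α β δ hsum
    rw [← hx] at ki
    -- Otherwise the point lies in the interior of its macro-triangle, which is contained in Ω.
    have h0 : α = 0 := by
      by_contra hne
      obtain ⟨d, had, hbd, e⟩ := i.2.third
      have hpos := coord_pos_of_cen_pos hΩ hK i.2.tri e i.2.ne had hbd (hα.lt_of_ne' hne) hβ hδ hsum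
      have hmem := (mem_openTri_iff_coord i.2.tri e i.2.ne had hbd).2 hpos
      have hsub : openTri i.1.2.1 i.1.2.2 d ⊆ closure Ω := by
        refine (openTri_subset_hull _ _ _).trans ?_
        rw [← coe_triple, ← e]
        exact hull_subset_closure hK i.2.tri.1
      have := interior_maximal hsub (isOpen_openTri (triple_area i.2.tri e i.2.ne had hbd)) hmem
      rw [hΩ.interior_closure] at this
      rw [frontier_eq hΩ] at hxf
      rw [hx] at hxf
      exact hxf.2 this
    split_ifs
    · rw [baryMap_apply, ki, h0]
    · rfl

/-- The nodal fields of the split point of an interior edge. -/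
lemma exists_spl_hat {e : Finset Plane} (he : e ∈ interiorEdges K Ω) (X : Plane) :
    ∃ v ∈ velocitySpaceZero K Ω, ∀ i : flagSet K,
      extend v (splOf Ω i) = (if {i.1.2.1, i.1.2.2} = e then X else 0) ∧
      extend v (cenOf i) = 0 ∧ extend v (vertOf i) = 0 := by
  have key : ∀ i : flagSet K, ∀ α β δ : ℝ, α + β + δ = 1 →
      bary (splOf Ω i) (vertOf i) (cenOf i) (comb α β δ (cenOf i) (splOf Ω i) (vertOf i)) = β := by
    intro i α β δ h
    rw [comb_rotate]
    exact bary_comb (by rw [area_rotate]; exact cellArea_ne_zero' hΩ hK i) (by linarith)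
  refine Exists.imp ?_ (exists_glued_field hΩ hK
    (fun i => if {i.1.2.1, i.1.2.2} = e then baryMap (splOf Ω i) (vertOf i) (cenOf i) else 0)
    ?_ ?_ X)
  · rintro v ⟨hv, hv'⟩
    refine ⟨hv, fun i => ?_⟩
    obtain ⟨h1, h2, h3⟩ := nodes_mem_cellHull (Ω := Ω) i
    rw [hv' i _ h1, hv' i _ h2, hv' i _ h3]
    have k1 := key i 1 0 0 (by norm_num)
    have k2 := key i 0 1 0 (by norm_num)
    have k3 := key i 0 0 1 (by norm_num)
    simp only [comb, one_smul, zero_smul, add_zero, zero_add] at k1 k2 k3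
    split_ifs <;> simp [baryMap_apply, k1, k2, k3]
  · intro i j x hxi hxj
    obtain ⟨α, β, δ, hα, hβ, hδ, hsum, hx⟩ := mem_cellHull.1 hxi
    obtain ⟨α', β', δ', hα', hβ', hδ', hsum', hx'⟩ := mem_cellHull.1 hxj
    have ki := key i α β δ hsum
    have kj := key j α' β' δ' hsum'
    rw [← hx] at ki
    rw [← hx'] at kj
    by_cases hij : ({i.1.2.1, i.1.2.2} : Finset Plane) = {j.1.2.1, j.1.2.2}
    · have := (spl_weight_eq hΩ hK i.2 j.2 hij hα hβ hδ hsum hα' hβ' hδ' hsum'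
        (hx.symm.trans hx')).1
      simp only [hij]
      split_ifs
      · rw [baryMap_apply, baryMap_apply, ki, kj, this]
      · rfl
    · have h0 : β = 0 := by
        by_contra hne
        exact hij (edge_eq_of_spl_pos hΩ hK i.2 j.2 hα (hβ.lt_of_ne' hne) hδ hsum (hx ▸ hxj))
      have h0' : β' = 0 := by
        by_contra hne
        exact hij (edge_eq_of_spl_pos hΩ hK j.2 i.2 hα' (hβ'.lt_of_ne' hne) hδ' hsum'
          (hx' ▸ hxi)).symm
      rw [h0] at ki
      rw [h0'] at kj
      split_ifs <;> simp [baryMap_apply, ki, kj]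
  · intro i x hxi hxf
    split_ifs with hie
    swap
    · rfl
    obtain ⟨α, β, δ, hα, hβ, hδ, hsum, hx⟩ := mem_cellHull.1 hxi
    have ki := key i α β δ hsum
    rw [← hx] at ki
    rw [baryMap_apply, ki]
    by_contra hne
    have hβ0 := hβ.lt_of_ne' hne
    rw [frontier_eq hΩ] at hxf
    refine hxf.2 ?_
    -- A point with positive weight at the split point lies in the relative interior of the
    -- macro-edge, which is interior to Ω, or in the interior of the macro-triangle.
    rcases hα.eq_or_lt with rfl | hα0
    · obtain ⟨s, hs, s', hs', hss, h1, h2⟩ := (mem_interiorEdges_iff hΩ hK he.1).1 he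
      rw [← hie] at h1 h2
      simp only [Finset.insert_subset_iff, Finset.singleton_subset_iff] at h1 h2
      refine openSegment_subset_interior hΩ hK hs hs' hss i.2.ne h1.1 h1.2 h2.1 h2.2 ?_
      obtain ⟨p, q, hp, hq, hpq, hz⟩ := spl_mem_openSegment hΩ hK i.2.ne i.2.edge
      refine ⟨β * p + δ, β * q, by positivity, by positivity, ?_, ?_⟩
      · linear_combination hsum + β * hpq
      · rw [hx]
        simp only [splOf, vertOf, ← hz, comb]
        module
    · obtain ⟨d, had, hbd, e'⟩ := i.2.third
      have hpos := coord_pos_of_cen_pos hΩ hK i.2.tri e' i.2.ne had hbd hα0 hβ hδ hsum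
      have hmem := (mem_openTri_iff_coord i.2.tri e' i.2.ne had hbd).2 hpos
      have hsub : openTri i.1.2.1 i.1.2.2 d ⊆ closure Ω := by
        refine (openTri_subset_hull _ _ _).trans ?_
        rw [← coe_triple, ← e']
        exact hull_subset_closure hK i.2.tri.1
      have := interior_maximal hsub (isOpen_openTri (triple_area i.2.tri e' i.2.ne had hbd)) hmem
      rw [hΩ.interior_closure] at this
      rw [hx]
      exact this

end domain

/-! ### The rank of the divergence from below -/

lemma sum_ite_eq_sum {ι : Type*} [Fintype ι] (P : ι → Prop) [DecidablePred P] (F : ι → ℝ) (L : Finset ι)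
    (h : ∀ i, P i ↔ i ∈ L) : ∑ i, (if P i then F i else 0) = ∑ i ∈ L, F i := by
  rw [← Finset.sum_filter]
  congr 1
  ext i
  simp [h]

/-- A flag as an element of the set of flags. -/
def IsFlag.toFlag {s : Finset Plane} {a b : Plane} (h : IsFlag K s a b) : flagSet K :=
  ⟨(s, a, b), h⟩

lemma toFlag_coe {s : Finset Plane} {a b : Plane} (h : IsFlag K s a b) :
    (h.toFlag : Finset Plane × Plane × Plane) = (s, a, b) := rfl

lemma toFlag_eq_iff {s s' : Finset Plane} {a b a' b' : Plane} {h : IsFlag K s a b}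
    {h' : IsFlag K s' a' b'} : h.toFlag = h'.toFlag ↔ s = s' ∧ a = a' ∧ b = b' := by
  rw [← Subtype.coe_inj]
  simp [IsFlag.toFlag]

lemma toFlag_val (i : flagSet K) : IsFlag.toFlag i.2 = i := rfl

/-- The flag with the endpoints of the edge interchanged. -/
def swapFlag (i : flagSet K) : flagSet K := (IsFlag.symm i.2).toFlag

/-- This turns an identity that holds for all nodal values `X` into two scalar equations; `X = u`
and `X = w` suffice. -/
lemma eq_zero_of_cross {u w : Plane} (h : cross u w ≠ 0) {p q : ℝ}
    (h0 : ∀ X, cross X (p • u + q • w) = 0) : p = 0 ∧ q = 0 := by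
  have h1 := h0 u
  have h2 := h0 w
  have e1 : cross u (p • u + q • w) = q * cross u w := by
    simp only [cross, PiLp.add_apply, PiLp.smul_apply, smul_eq_mul]; ring
  have e2 : cross w (p • u + q • w) = -(p * cross u w) := by
    simp only [cross, PiLp.add_apply, PiLp.smul_apply, smul_eq_mul]; ring
  rw [e1, mul_eq_zero, or_iff_left h] at h1
  rw [e2, neg_eq_zero, mul_eq_zero, or_iff_left h] at h2
  exact ⟨h2, h1⟩

lemma flag_edge_cases {a b p q : Plane} (hpq : ({p, q} : Finset Plane) = {a, b}) :
    (p = a ∧ q = b) ∨ (p = b ∧ q = a) := by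
  rw [← Finset.coe_inj, Finset.coe_pair, Finset.coe_pair] at hpq
  exact Set.pair_eq_pair_iff.1 hpq

/-- The sum over the flags of a weighted divergence. -/
lemma flag_sum_eq [Fintype (flagSet K)] (n : flagSet K → ℝ) (v : C(closure Ω, Plane)) :
    ∑ i, divMap K Ω v i * n i =
      ∑ i, n i / cross (cenOf i - splOf Ω i) (vertOf i - splOf Ω i) *
        (cross (extend v (cenOf i) - extend v (splOf Ω i)) (vertOf i - splOf Ω i) +
          cross (cenOf i - splOf Ω i) (extend v (vertOf i) - extend v (splOf Ω i))) := by
  refine Finset.sum_congr rfl fun i _ => ?_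
  simp only [divMap, LinearMap.coe_mk, AddHom.coe_mk]
  ring

section domain
variable (hΩ : IsPolygonalDomain Ω) (hK : IsTriangulation K Ω) [Fintype (flagSet K)]
  {n : flagSet K → ℝ}
  (hn : ∀ v ∈ velocitySpaceZero K Ω, ∑ i, divMap K Ω v i * n i = 0)
include hΩ hK hn

/-- Orthogonality to the nodal fields at the split point of `{a, b}` says that the sum of `m i •
(cenOf i - vertOf i)` over its four cells vanishes. If `m` is antisymmetric on the edge in `s`, this
is a relation between the independent vectors `b - a` and `cen s' - a`. It carries the antisymmetry
to `s'` and fixes the values there. -/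
lemma annihilator_spl {a b : Plane} {s s' : Finset Plane} (h : IsFlag K s a b)
    (h' : IsFlag K s' a b) (hne : s ≠ s') {m : flagSet K → ℝ}
    (hm : ∀ i, m i = n i / cross (cenOf i - splOf Ω i) (vertOf i - splOf Ω i))
    (hanti : m h.toFlag + m h.symm.toFlag = 0) :
    m h'.toFlag = -m h.toFlag ∧ m h'.symm.toFlag = m h.toFlag := by
  have he : ({a, b} : Finset Plane) ∈ interiorEdges K Ω :=
    (mem_interiorEdges_iff hΩ hK h.edge).2
      ⟨s, h.tri, s', h'.tri, hne, h.pair_subset, h'.pair_subset⟩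
  obtain ⟨d, had, hbd, e⟩ := h'.third
  have hc : cross (b - a) (cen s' - a) ≠ 0 := by
    obtain ⟨δ, hδ, hx⟩ := cross_pos_of_mem_openTri ((isIncenter_cen h'.tri).mem_openTri
      (a := a) (b := b) (d := d) (by simp [e]) (by simp [e]) (by simp [e]) h'.ne had hbd)
    rw [hx]
    exact mul_ne_zero hδ.ne' (triple_area h'.tri e h'.ne had hbd)
  have key := eq_zero_of_cross hc (p := m h.toFlag - m h'.symm.toFlag)
    (q := m h'.toFlag + m h'.symm.toFlag) ?_
  · exact ⟨by linarith [key.1, key.2], by linarith [key.1]⟩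
  intro X
  obtain ⟨v, hv, hv'⟩ := exists_spl_hat hΩ hK he X
  have hs := hn v hv
  rw [flag_sum_eq] at hs
  have hrw : ∀ i : flagSet K, n i / cross (cenOf i - splOf Ω i) (vertOf i - splOf Ω i) *
        (cross (extend v (cenOf i) - extend v (splOf Ω i)) (vertOf i - splOf Ω i) +
          cross (cenOf i - splOf Ω i) (extend v (vertOf i) - extend v (splOf Ω i))) =
      if ({i.1.2.1, i.1.2.2} : Finset Plane) = {a, b} then
        m i * cross X (cenOf i - vertOf i) else 0 := by
    intro i
    rw [(hv' i).1, (hv' i).2.1, (hv' i).2.2, ← hm]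
    split_ifs
    · simp only [cross, PiLp.sub_apply, PiLp.zero_apply]; ring
    · simp only [cross, PiLp.sub_apply, PiLp.zero_apply]; ring
  rw [Finset.sum_congr rfl fun i _ => hrw i, sum_ite_eq_sum _ _ {h.toFlag,
    h.symm.toFlag, h'.toFlag, h'.symm.toFlag}] at hs
  · rw [Finset.sum_insert (by simp [toFlag_eq_iff, hne, h.ne]), Finset.sum_insert (by simp [toFlag_eq_iff, hne]),
      Finset.sum_insert (by simp [toFlag_eq_iff, h.ne]), Finset.sum_singleton] at hs
    have hma : m h.symm.toFlag = -m h.toFlag := by linarith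
    rw [hma] at hs
    simp only [cenOf, vertOf, toFlag_coe] at hs
    rw [← hs]
    simp only [cross, PiLp.sub_apply, PiLp.add_apply, PiLp.smul_apply, smul_eq_mul]; ring
  · rintro ⟨⟨t, p, q⟩, hi⟩
    have hi' : IsFlag K t p q := hi
    have h_eq : (⟨(t, p, q), hi⟩ : flagSet K) = hi'.toFlag := rfl
    simp only [Finset.mem_insert, Finset.mem_singleton, h_eq, toFlag_eq_iff]
    constructor
    · intro hpq
      have ht : t = s ∨ t = s' := by
        refine eq_or_eq_of_edge h.tri h'.tri hi.tri hne (e := {a, b}) (Finset.card_pair h.ne)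
          h.pair_subset h'.pair_subset ?_
        rw [← hpq]
        exact hi.pair_subset
      rcases flag_edge_cases hpq with ⟨rfl, rfl⟩ | ⟨rfl, rfl⟩ <;> tauto
    · rintro (⟨-, rfl, rfl⟩ | ⟨-, rfl, rfl⟩ | ⟨-, rfl, rfl⟩ | ⟨-, rfl, rfl⟩)
      exacts [rfl, Finset.pair_comm _ _, rfl, Finset.pair_comm _ _]

set_option linter.unusedSimpArgs false in
-- Orthogonality to the nodal fields at the incenter says that the sum of `m i • (vertOf i - splOf Ω
-- i)` over the six cells vanishes. Under antisymmetry the split points drop out, and a combination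
-- of the three side vectors remains. The only relation between these is that their sum is zero, so
-- the coefficients agree.
lemma annihilator_cen {a b d : Plane} {s : Finset Plane} (hs : s ∈ macroTriangles K)
    (e : s = {a, b, d}) (hab : a ≠ b) (had : a ≠ d) (hbd : b ≠ d) {m : flagSet K → ℝ}
    (hm : ∀ i, m i = n i / cross (cenOf i - splOf Ω i) (vertOf i - splOf Ω i))
    (hanti : ∀ i, m i + m (swapFlag i) = 0) :
    m ((isFlag_triple hs e hab had hbd).1).toFlag =
        m ((isFlag_triple hs e hab had hbd).2.1).toFlag ∧
      m ((isFlag_triple hs e hab had hbd).2.1).toFlag =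
        m ((isFlag_triple hs e hab had hbd).2.2).toFlag := by
  obtain ⟨f1, f2, f3⟩ := isFlag_triple hs e hab had hbd
  have hΔ := triple_area hs e hab had hbd
  have key := eq_zero_of_cross hΔ (p := m f2.toFlag - m f1.toFlag)
    (q := m f3.toFlag - m f2.toFlag) ?_
  · exact ⟨by linarith [key.1], by linarith [key.2]⟩
  intro X
  obtain ⟨v, hv, hv'⟩ := exists_cen_hat hΩ hK s X
  have hsum := hn v hv
  rw [flag_sum_eq] at hsum
  have hrw : ∀ i : flagSet K, n i / cross (cenOf i - splOf Ω i) (vertOf i - splOf Ω i) *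
        (cross (extend v (cenOf i) - extend v (splOf Ω i)) (vertOf i - splOf Ω i) +
          cross (cenOf i - splOf Ω i) (extend v (vertOf i) - extend v (splOf Ω i))) =
      if i.1.1 = s then m i * cross X (vertOf i - splOf Ω i) else 0 := by
    intro i
    rw [(hv' i).1, (hv' i).2.1, (hv' i).2.2, ← hm]
    split_ifs
    · simp only [cross, PiLp.sub_apply, PiLp.zero_apply]; ring
    · simp only [cross, PiLp.sub_apply, PiLp.zero_apply]; ring
  rw [Finset.sum_congr rfl fun i _ => hrw i, sum_ite_eq_sum _ _ {f1.toFlag,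
    f1.symm.toFlag, f2.toFlag, f2.symm.toFlag, f3.toFlag,
    f3.symm.toFlag}] at hsum
  · rw [Finset.sum_insert (by simp [toFlag_eq_iff, hab, had, hbd, hab.symm, had.symm, hbd.symm]),
      Finset.sum_insert (by simp [toFlag_eq_iff, hab, had, hbd, hab.symm, had.symm, hbd.symm]),
      Finset.sum_insert (by simp [toFlag_eq_iff, hab, had, hbd, hab.symm, had.symm, hbd.symm]),
      Finset.sum_insert (by simp [toFlag_eq_iff, hab, had, hbd, hab.symm, had.symm, hbd.symm]),
      Finset.sum_insert (by simp [toFlag_eq_iff, hab, had, hbd, hab.symm, had.symm, hbd.symm]),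
      Finset.sum_singleton] at hsum
    have h1 : m f1.symm.toFlag = -m f1.toFlag :=
      eq_neg_of_add_eq_zero_right (hanti f1.toFlag)
    have h2 : m f2.symm.toFlag = -m f2.toFlag :=
      eq_neg_of_add_eq_zero_right (hanti f2.toFlag)
    have h3 : m f3.symm.toFlag = -m f3.toFlag :=
      eq_neg_of_add_eq_zero_right (hanti f3.toFlag)
    rw [h1, h2, h3] at hsum
    simp only [splOf, vertOf, toFlag_coe, Finset.pair_comm b a, Finset.pair_comm d b,
      Finset.pair_comm a d] at hsum
    rw [← hsum]
    simp only [cross, PiLp.sub_apply, PiLp.add_apply, PiLp.smul_apply, smul_eq_mul]; ring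
  · rintro ⟨⟨t, p, q⟩, hi⟩
    have hi' : IsFlag K t p q := hi
    have h_eq : (⟨(t, p, q), hi⟩ : flagSet K) = hi'.toFlag := rfl
    simp only [Finset.mem_insert, Finset.mem_singleton, h_eq, toFlag_eq_iff]
    constructor
    · rintro rfl
      have hp := hi.left
      have hq := hi.right
      have hpq := hi.ne
      simp only at hp hq hpq
      rw [e] at hp hq
      simp only [Finset.mem_insert, Finset.mem_singleton] at hp hq
      rcases hp with rfl | rfl | rfl <;> rcases hq with rfl | rfl | rfl <;>
        first | exact absurd rfl hpq | tauto
    · tauto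

omit [Fintype (flagSet K)] hn in
/-- The orientation of a cell is that of the flag. -/
lemma sign_cellArea {s : Finset Plane} {a b d : Plane} (hs : s ∈ macroTriangles K)
    (e : s = {a, b, d}) (hab : a ≠ b) (had : a ≠ d) (hbd : b ≠ d) (hf : IsFlag K s a b) :
    SignType.sign (cross (cenOf (hf.toFlag : flagSet K) - splOf Ω hf.toFlag)
      (vertOf (hf.toFlag : flagSet K) - splOf Ω hf.toFlag)) =
      SignType.sign (cross (b - a) (d - a)) := by
  obtain ⟨k, hk, h⟩ := cell_area hΩ hK hs e hab had hbd
  simp only [cenOf, splOf, vertOf, toFlag_coe, h, sign_mul, sign_pos hk, one_mul]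

end domain

/-- A function on the macro-triangles that does not jump across an edge is constant. -/
def DualConnected (K : Geometry.SimplicialComplex ℝ Plane) : Prop :=
  ∀ p : Finset Plane → ℝ, (∀ s s' a b, IsFlag K s a b → IsFlag K s' a b → p s = p s') →
    ∀ s ∈ macroTriangles K, ∀ s' ∈ macroTriangles K, p s = p s'

/-- The area of a cell, up to a positive factor the oriented area of the flag. -/
def cellArea (Ω : Set Plane) (i : flagSet K) : ℝ :=
  cross (cenOf i - splOf Ω i) (vertOf i - splOf Ω i)

/-- The orientation of a cell. -/
def orient (Ω : Set Plane) (i : flagSet K) : ℝ := SignType.sign (cellArea Ω i)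

lemma swapFlag_toFlag {s : Finset Plane} {a b : Plane} (h : IsFlag K s a b) :
    swapFlag h.toFlag = h.symm.toFlag := rfl

/-! ### Orientation of cells and the orthogonal complement of the range -/

section domain
variable (hΩ : IsPolygonalDomain Ω) (hK : IsTriangulation K Ω)
include hΩ hK

lemma orient_mul_self (i : flagSet K) : orient Ω i * orient Ω i = 1 := by
  have h := cellArea_ne_zero hΩ hK i
  unfold orient cellArea
  rcases h.lt_or_gt with h | h
  · rw [sign_neg h]; norm_num
  · rw [sign_pos h]; norm_num

lemma orient_toFlag {s : Finset Plane} {a b d : Plane} (hs : s ∈ macroTriangles K)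
    (e : s = {a, b, d}) (hab : a ≠ b) (had : a ≠ d) (hbd : b ≠ d) (hf : IsFlag K s a b) :
    orient Ω hf.toFlag = SignType.sign (cross (b - a) (d - a)) := by
  rw [orient, cellArea, sign_cellArea hΩ hK hs e hab had hbd hf]

lemma orient_swap (i : flagSet K) : orient Ω (swapFlag i) = -orient Ω i := by
  obtain ⟨d, had, hbd, e⟩ := i.2.third
  have h1 := orient_toFlag hΩ hK i.2.tri e i.2.ne had hbd i.2
  have h2 := orient_toFlag hΩ hK i.2.tri (e.trans (Finset.insert_comm _ _ _)) i.2.ne.symm hbd had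
    (IsFlag.symm i.2)
  rw [toFlag_val] at h1
  rw [swapFlag, h1, h2]
  have : cross (i.1.2.1 - i.1.2.2) (d - i.1.2.2) = -cross (i.1.2.2 - i.1.2.1) (d - i.1.2.1) := by
    simp only [cross, PiLp.sub_apply]; ring
  rw [this, Left.sign_neg]
  simp

lemma orient_opposite {s s' : Finset Plane} {a b : Plane} (h : IsFlag K s a b)
    (h' : IsFlag K s' a b) (hne : s ≠ s') : orient Ω h'.toFlag = -orient Ω h.toFlag := by
  obtain ⟨d, had, hbd, e⟩ := h.third
  obtain ⟨d', had', hbd', e'⟩ := h'.third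
  rw [orient_toFlag hΩ hK h.tri e h.ne had hbd, orient_toFlag hΩ hK h'.tri e' h'.ne had' hbd']
  have hneg := area_mul_neg h.tri h'.tri hne e e' h.ne had hbd had' hbd'
  rcases mul_neg_iff.1 hneg with hh | hh
  · rw [sign_pos hh.1, sign_neg hh.2]; simp
  · rw [sign_neg hh.1, sign_pos hh.2]; simp

lemma exists_rep : ∃ rep : macroEdges K → flagSet K,
    ∀ e : macroEdges K, ({(rep e).1.2.1, (rep e).1.2.2} : Finset Plane) = e := by
  have : ∀ e : macroEdges K, ∃ i : flagSet K, ({i.1.2.1, i.1.2.2} : Finset Plane) = e := by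
    rintro ⟨e, he⟩
    obtain ⟨s, hs, hes⟩ := exists_triangle_superset hΩ hK he.1
    obtain ⟨a, b, hab, rfl⟩ := Finset.card_eq_two.1 he.2
    simp only [Finset.insert_subset_iff, Finset.singleton_subset_iff] at hes
    exact ⟨IsFlag.toFlag ⟨hs, hes.1, hes.2, hab⟩, rfl⟩
  choose rep hrep using this
  exact ⟨rep, hrep⟩

variable [Fintype (flagSet K)]

/-- With `m` the quotient of `n` by the signed cell area, antisymmetry in one triangle on each edge
spreads to all cells. Then `orient Ω i * m i` does not change within a triangle or across an edge,
so it is constant, and it vanishes at `i₀`. -/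
lemma annihilator_eq_zero (hconn : DualConnected K) {n : flagSet K → ℝ}
    (hn : ∀ v ∈ velocitySpaceZero K Ω, ∑ i, divMap K Ω v i * n i = 0)
    (rep : macroEdges K → flagSet K)
    (hrep : ∀ e : macroEdges K, ({(rep e).1.2.1, (rep e).1.2.2} : Finset Plane) = e)
    (hanti : ∀ e, n (rep e) / cellArea Ω (rep e) +
      n (swapFlag (rep e)) / cellArea Ω (swapFlag (rep e)) = 0)
    (i₀ : flagSet K) (h₀ : n i₀ = 0) : n = 0 := by
  set m : flagSet K → ℝ := fun i => n i / cellArea Ω i with hm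
  have hm' : ∀ i, m i = n i / cross (cenOf i - splOf Ω i) (vertOf i - splOf Ω i) := fun _ => rfl
  -- The hypothesis covers one representative triangle of each edge; `annihilator_spl` carries it to
  -- the other one.
  have anti : ∀ i, m i + m (swapFlag i) = 0 := by
    rintro ⟨⟨s, a, b⟩, hi⟩
    have hi' : IsFlag K s a b := hi
    change m hi'.toFlag + m hi'.symm.toFlag = 0
    have h1 := hrep ⟨{a, b}, hi'.edge⟩
    have h2 := hanti ⟨{a, b}, hi'.edge⟩
    generalize rep ⟨{a, b}, hi'.edge⟩ = r at h1 h2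
    obtain ⟨⟨s', p, q⟩, hr⟩ := r
    have hr' : IsFlag K s' p q := hr
    change m hr'.toFlag + m hr'.symm.toFlag = 0 at h2
    by_cases hs : s = s'
    · subst hs
      rcases flag_edge_cases h1 with ⟨rfl, rfl⟩ | ⟨rfl, rfl⟩
      · exact h2
      · rw [add_comm]; exact h2
    · rcases flag_edge_cases h1 with ⟨rfl, rfl⟩ | ⟨rfl, rfl⟩
      · obtain ⟨k1, k2⟩ := annihilator_spl hΩ hK hn hr' hi' (Ne.symm hs) hm' h2
        rw [k1, k2]; ring
      · obtain ⟨k1, k2⟩ := annihilator_spl hΩ hK hn hr' hi'.symm (Ne.symm hs) hm' h2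
        rw [k1, k2]; ring
  set Q : flagSet K → ℝ := fun i => orient Ω i * m i with hQ
  have Qswap : ∀ i, Q (swapFlag i) = Q i := by
    intro i
    simp only [hQ, orient_swap hΩ hK, eq_neg_of_add_eq_zero_right (anti i)]
    ring
  have Qtri : ∀ s a b p q, ∀ (h : IsFlag K s a b) (h' : IsFlag K s p q),
      Q h'.toFlag = Q h.toFlag := by
    intro s a b p q h h'
    obtain ⟨d, had, hbd, e⟩ := h.third
    obtain ⟨f1, f2, f3⟩ := isFlag_triple h.tri e h.ne had hbd
    obtain ⟨k1, k2⟩ := annihilator_cen hΩ hK hn h.tri e h.ne had hbd hm' anti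
    have e2 : s = {b, d, a} := by
      rw [e]; ext; simp only [Finset.mem_insert, Finset.mem_singleton]; tauto
    have e3 : s = {d, a, b} := by
      rw [e]; ext; simp only [Finset.mem_insert, Finset.mem_singleton]; tauto
    have o1 := orient_toFlag hΩ hK h.tri e h.ne had hbd f1
    have o2 := orient_toFlag hΩ hK h.tri e2 hbd h.ne.symm had.symm f2
    have o3 := orient_toFlag hΩ hK h.tri e3 had.symm hbd.symm h.ne f3
    rw [area_rotate] at o2
    rw [← area_rotate d a b] at o3
    have q2 : Q f2.toFlag = Q f1.toFlag := by simp only [hQ, o1, o2, k1]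
    have q3 : Q f3.toFlag = Q f1.toFlag := by simp only [hQ, o1, o3, k1, k2]
    have q1' := Qswap f1.toFlag
    have q2' := Qswap f2.toFlag
    have q3' := Qswap f3.toFlag
    rw [swapFlag_toFlag] at q1' q2' q3'
    have hp := h'.left
    have hq := h'.right
    have hpq := h'.ne
    rw [e] at hp hq
    simp only [Finset.mem_insert, Finset.mem_singleton] at hp hq
    rcases hp with rfl | rfl | rfl <;> rcases hq with rfl | rfl | rfl <;>
      first
      | exact absurd rfl hpq
      | rfl
      | exact q2
      | exact q3
      | exact q1'
      | exact q2'.trans q2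
      | exact q3'.trans q3
  have Qedge : ∀ s s' a b, ∀ (h : IsFlag K s a b) (h' : IsFlag K s' a b),
      Q h.toFlag = Q h'.toFlag := by
    intro s s' a b h h'
    by_cases hs : s = s'
    · subst hs; rfl
    · obtain ⟨k1, -⟩ := annihilator_spl hΩ hK hn h h' hs hm' (anti h.toFlag)
      simp only [hQ, orient_opposite hΩ hK h h' hs, k1]
      ring
  -- By `Qtri` the value does not depend on the chosen flag of the triangle.
  let p : Finset Plane → ℝ := fun s => if h : ∃ ab : Plane × Plane, IsFlag K s ab.1 ab.2 then
    Q h.choose_spec.toFlag else 0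
  have hp : ∀ s a b, ∀ h : IsFlag K s a b, p s = Q h.toFlag := by
    intro s a b h
    have hex : ∃ ab : Plane × Plane, IsFlag K s ab.1 ab.2 := ⟨(a, b), h⟩
    simp only [p, dif_pos hex]
    exact Qtri _ _ _ _ _ h hex.choose_spec
  have hconst := hconn p fun s s' a b h h' => by rw [hp s a b h, hp s' a b h', Qedge s s' a b h h']
  have hQ0 : Q i₀ = 0 := by simp [hQ, hm, h₀]
  funext i
  have hQi : Q i = 0 := by
    have := hconst _ i.2.tri _ i₀.2.tri
    rw [hp _ _ _ i.2, hp _ _ _ i₀.2, toFlag_val, toFlag_val, hQ0] at this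
    exact this
  have hmi : m i = 0 := by
    have h1 := orient_mul_self hΩ hK i
    rcases mul_eq_zero.1 hQi with h | h
    · rw [h] at h1; norm_num at h1
    · exact h
  exact (div_eq_zero_iff.1 hmi).resolve_right (cellArea_ne_zero hΩ hK i)

/-- The range of the divergence has at most as small a dimension as the number of constraints of
the pressure space allows. -/
lemma le_finrank_range (hconn : DualConnected K) [Fintype (macroEdges K)] :
    Fintype.card (flagSet K) ≤
      Module.finrank ℝ ((velocitySpaceZero K Ω).map (divMap K Ω)) +
        (Fintype.card (macroEdges K) + 1) := by
  obtain ⟨rep, hrep⟩ := exists_rep hΩ hK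
  set R := (velocitySpaceZero K Ω).map (divMap K Ω)
  by_cases hne : Nonempty (flagSet K)
  swap
  · rw [not_nonempty_iff] at hne
    simp
  obtain ⟨i₀⟩ := hne
  let ev : flagSet K → Module.Dual ℝ (flagSet K → ℝ) →ₗ[ℝ] ℝ := fun i =>
    (Module.Dual.eval ℝ (flagSet K → ℝ)) (Pi.single i 1)
  -- One antisymmetry functional per macro-edge and one evaluation. Their joint injectivity on the
  -- annihilator of the range bounds its dimension by the number of edges plus one.
  let L : Module.Dual ℝ (flagSet K → ℝ) →ₗ[ℝ] (macroEdges K → ℝ) × ℝ :=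
    (LinearMap.pi fun e => (cellArea Ω (rep e))⁻¹ • ev (rep e) +
      (cellArea Ω (swapFlag (rep e)))⁻¹ • ev (swapFlag (rep e))).prod (ev i₀)
  have hinj : Function.Injective (L.domRestrict R.dualAnnihilator) := by
    refine (injective_iff_map_eq_zero _).2 ?_
    rintro ⟨φ, hφ⟩ h0
    obtain ⟨h1, h2⟩ := Prod.ext_iff.1 h0
    replace h2 : φ (Pi.single i₀ 1) = 0 := h2
    have hn : ∀ v ∈ velocitySpaceZero K Ω, ∑ i, divMap K Ω v i * φ (Pi.single i 1) = 0 := by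
      intro v hv
      have h3 := (Submodule.mem_dualAnnihilator φ).1 hφ _ (Submodule.mem_map_of_mem hv)
      rw [LinearMap.pi_apply_eq_sum_univ] at h3
      simp only [smul_eq_mul] at h3
      rw [← h3]
      refine Finset.sum_congr rfl fun i _ => ?_
      congr 2
      funext j
      simp [Pi.single_apply, eq_comm]
    have := annihilator_eq_zero hΩ hK hconn hn rep hrep (fun e => ?_) i₀ h2
    · apply Subtype.ext
      refine LinearMap.ext fun x => ?_
      rw [LinearMap.pi_apply_eq_sum_univ]
      simp only [ZeroMemClass.coe_zero, LinearMap.zero_apply]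
      refine Finset.sum_eq_zero fun i _ => ?_
      have h4 := congrFun this i
      simp only [Pi.zero_apply] at h4
      refine smul_eq_zero_of_right _ ?_
      refine Eq.trans ?_ h4
      congr 1
      funext j
      simp [Pi.single_apply, eq_comm]
    · have h3 := congrFun h1 e
      replace h3 : (cellArea Ω (rep e))⁻¹ * φ (Pi.single (rep e) 1) +
        (cellArea Ω (swapFlag (rep e)))⁻¹ * φ (Pi.single (swapFlag (rep e)) 1) = 0 := h3
      rw [← h3]
      ring
  have h1 := LinearMap.finrank_le_finrank_of_injective hinj
  have h2 := Subspace.finrank_add_finrank_dualAnnihilator_eq R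
  simp only [Module.finrank_prod, Module.finrank_fintype_fun_eq_card, Module.finrank_self] at h1 h2
  omega

end domain

/-! ### Connectedness of the dual graph -/

lemma mem_hull_inter {s s' : Finset Plane} (hs : s ∈ K.faces) (hs' : s' ∈ K.faces) {x : Plane}
    (hx : x ∈ convexHull ℝ (s : Set Plane)) (hx' : x ∈ convexHull ℝ (s' : Set Plane)) :
    x ∈ convexHull ℝ ((s ∩ s' : Finset Plane) : Set Plane) := by
  rw [Finset.coe_inter]
  exact K.inter_subset_convexHull hs hs' ⟨hx, hx'⟩

lemma mem_hull_common_edge {s s' : Finset Plane} {a b : Plane} (h : IsFlag K s a b)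
    (h' : IsFlag K s' a b) (hne : s ≠ s') {x : Plane} (hx : x ∈ convexHull ℝ (s : Set Plane))
    (hx' : x ∈ convexHull ℝ (s' : Set Plane)) : x ∈ convexHull ℝ ({a, b} : Set Plane) := by
  have h1 : ({a, b} : Finset Plane) = s ∩ s' := by
    refine Finset.eq_of_subset_of_card_le (Finset.subset_inter h.pair_subset h'.pair_subset) ?_
    rw [Finset.card_pair h.ne]
    by_contra hlt
    have h2 : s ∩ s' = s := Finset.eq_of_subset_of_card_le Finset.inter_subset_left
      (by rw [h.tri.2]; omega)
    exact hne (Finset.eq_of_subset_of_card_le (Finset.inter_eq_left.1 h2)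
      (by rw [h.tri.2, h'.tri.2]))
  have h2 := mem_hull_inter h.tri.1 h'.tri.1 hx hx'
  rw [← h1] at h2
  simpa using h2

/-- The common face contains a point that is not a vertex, so it has at least two vertices. -/
lemma exists_common_edge {s s' : Finset Plane} (hs : s ∈ macroTriangles K)
    (hs' : s' ∈ macroTriangles K) {x : Plane}
    (hx : x ∈ convexHull ℝ (s : Set Plane)) (hx' : x ∈ convexHull ℝ (s' : Set Plane))
    (hv : x ∉ s) : ∃ a b, IsFlag K s a b ∧ IsFlag K s' a b := by
  have h2 := mem_hull_inter hs.1 hs'.1 hx hx'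
  have hcard : 1 < (s ∩ s').card := by
    by_contra hlt
    rcases (s ∩ s').eq_empty_or_nonempty with h0 | h0
    · rw [h0] at h2; simp at h2
    · obtain ⟨v, hv'⟩ := Finset.card_eq_one.1 (le_antisymm (not_lt.1 hlt) h0.card_pos)
      rw [hv'] at h2
      simp only [Finset.coe_singleton, convexHull_singleton, mem_singleton_iff] at h2
      have : v ∈ s ∩ s' := by rw [hv']; simp
      exact hv (h2 ▸ (Finset.mem_inter.1 this).1)
  obtain ⟨a, ha, b, hb, hab⟩ := Finset.one_lt_card.1 hcard
  rw [Finset.mem_inter] at ha hb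
  exact ⟨a, b, ⟨hs, ha.1, hb.1, hab⟩, ⟨hs', ha.2, hb.2, hab⟩⟩

lemma mem_of_vertex_mem_hull {s s' : Finset Plane} (hs : s ∈ K.faces) (hs' : s' ∈ K.faces) {v : Plane} (hv : v ∈ s)
    (hx : v ∈ convexHull ℝ (s' : Set Plane)) : v ∈ s' := by
  have hface : ({v} : Finset Plane) ∈ K.faces :=
    K.down_closed hs (by simpa using hv) (by simp)
  have h2 := mem_hull_inter hface hs' (x := v) (by simp) hx
  by_contra h0
  rw [Finset.singleton_inter_of_notMem h0] at h2
  simp at h2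

section domain
variable (hΩ : IsPolygonalDomain Ω) (hK : IsTriangulation K Ω)
include hK

/-- A function on the triangles that is well defined as a function of the points of a connected
set takes one value only. -/
lemma eq_of_isPreconnected {S : Set Plane} (hS : IsPreconnected S)
    (hcov : ∀ x ∈ S, ∃ s ∈ macroTriangles K, x ∈ convexHull ℝ (s : Set Plane))
    (p : Finset Plane → ℝ)
    (hp : ∀ x ∈ S, ∀ s ∈ macroTriangles K, ∀ s' ∈ macroTriangles K,
      x ∈ convexHull ℝ (s : Set Plane) → x ∈ convexHull ℝ (s' : Set Plane) → p s = p s')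
    {s s' : Finset Plane} (hs : s ∈ macroTriangles K) (hs' : s' ∈ macroTriangles K)
    (h : (S ∩ convexHull ℝ (s : Set Plane)).Nonempty)
    (h' : (S ∩ convexHull ℝ (s' : Set Plane)).Nonempty) : p s = p s' := by
  by_contra hne
  -- The triangles with value `p s` and those with another value give two closed sets that cover
  -- `S`. Both are met by `S`, so they have a common point there, which contradicts `hp`.
  have closed : ∀ P : Finset Plane → Prop,
      IsClosed (⋃ t ∈ {t | t ∈ macroTriangles K ∧ P t}, convexHull ℝ (t : Set Plane)) :=
    fun P => (hK.finite_macroTriangles.subset fun _ ht => ht.1).isClosed_biUnion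
      fun t _ => isClosed_hull t
  obtain ⟨x, hx, h1, h2⟩ := isPreconnected_closed_iff.1 hS _ _ (closed fun t => p t = p s)
    (closed fun t => p t ≠ p s) (by
      intro x hx
      obtain ⟨t, ht, hxt⟩ := hcov x hx
      by_cases hpt : p t = p s
      · exact Or.inl (mem_biUnion (x := t) ⟨ht, hpt⟩ hxt)
      · exact Or.inr (mem_biUnion (x := t) ⟨ht, hpt⟩ hxt))
    (by obtain ⟨x, hx, hxs⟩ := h; exact ⟨x, hx, mem_biUnion (x := s) ⟨hs, rfl⟩ hxs⟩)
    (by obtain ⟨x, hx, hxs⟩ := h'; exact ⟨x, hx, mem_biUnion (x := s') ⟨hs', Ne.symm hne⟩ hxs⟩)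
  simp only [mem_iUnion] at h1 h2
  obtain ⟨t, ⟨ht, hpt⟩, hxt⟩ := h1
  obtain ⟨t', ⟨ht', hpt'⟩, hxt'⟩ := h2
  exact hpt' ((hp x hx t' ht' t ht hxt' hxt).trans hpt)

include hΩ

/-- The triangles that contain a given point of the domain are connected through edges that contain
the point. -/
lemma locally_connected {y : Plane} (hy : y ∈ Ω) {p : Finset Plane → ℝ}
    (hp : ∀ s s' a b, IsFlag K s a b → IsFlag K s' a b →
      y ∈ convexHull ℝ ({a, b} : Set Plane) → p s = p s')
    {s s' : Finset Plane} (hs : s ∈ macroTriangles K) (hs' : s' ∈ macroTriangles K)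
    (hys : y ∈ convexHull ℝ (s : Set Plane)) (hys' : y ∈ convexHull ℝ (s' : Set Plane)) :
    p s = p s' := by
  have hfin : (⋃ t ∈ macroTriangles K, (t : Set Plane)).Finite :=
    hK.finite_macroTriangles.biUnion fun t _ => t.finite_toSet
  have hvert : ∀ᶠ x in 𝓝 y, ∀ t ∈ macroTriangles K, x ∈ t → x = y := by
    have h1 : (((⋃ t ∈ macroTriangles K, (t : Set Plane)) \ {y})ᶜ) ∈ 𝓝 y :=
      (hfin.subset sdiff_subset).isClosed.isOpen_compl.mem_nhds (by simp)
    filter_upwards [h1] with x hx t ht hxt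
    by_contra hne
    exact hx ⟨mem_biUnion ht hxt, hne⟩
  -- The ball is so small that it stays in Ω, contains no vertex except possibly `y`, and meets only
  -- triangles that contain `y`. Two triangles that meet on its boundary circle then share an edge
  -- through `y`, and the circle is connected.
  obtain ⟨r, hr, hball⟩ := Metric.nhds_basis_closedBall.eventually_iff.1
    ((eventually_mem_set.2 (hΩ.isOpen.mem_nhds hy)).and ((eventually_mem_hull hK y).and hvert))
  have hsph : ∀ x ∈ Metric.sphere y r, x ∈ Ω ∧
      (∀ t ∈ macroTriangles K, x ∈ convexHull ℝ (t : Set Plane) →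
        y ∈ convexHull ℝ (t : Set Plane)) ∧ ∀ t ∈ macroTriangles K, x ∉ t := by
    intro x hx
    obtain ⟨h1, h2, h3⟩ := hball (Metric.sphere_subset_closedBall hx)
    refine ⟨h1, h2, fun t ht hxt => ?_⟩
    have := h3 t ht hxt
    rw [this, Metric.mem_sphere, dist_self] at hx
    exact hr.ne hx
  have hmeet : ∀ t ∈ macroTriangles K, y ∈ convexHull ℝ (t : Set Plane) →
      (Metric.sphere y r ∩ convexHull ℝ (t : Set Plane)).Nonempty := by
    intro t ht hyt
    obtain ⟨a, b, hab⟩ := IsFlag.exists_isFlag ht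
    obtain ⟨v, hv, hvy⟩ : ∃ v ∈ t, v ≠ y := by
      by_cases h : a = y
      · exact ⟨b, hab.right, fun h' => hab.ne (h.trans h'.symm)⟩
      · exact ⟨a, hab.left, h⟩
    -- The vertex `v` lies outside the ball, so the segment from `y` to `v` crosses the circle
    -- inside the triangle.
    have hd : r < ‖v - y‖ := by
      by_contra hle
      exact hvy ((hball (x := v) (by rw [Metric.mem_closedBall, dist_eq_norm]; linarith)).2.2 t ht hv)
    have hpos : 0 < ‖v - y‖ := hr.trans hd
    refine ⟨y + (r / ‖v - y‖) • (v - y), ?_, ?_⟩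
    · rw [Metric.mem_sphere, dist_eq_norm, add_sub_cancel_left, norm_smul, norm_div, norm_norm,
        Real.norm_of_nonneg hr.le, div_mul_cancel₀ _ hpos.ne']
    · exact (convex_convexHull ℝ _).add_smul_sub_mem hyt (subset_convexHull ℝ _ hv)
        ⟨by positivity, (div_le_one hpos).2 hd.le⟩
  refine eq_of_isPreconnected hK (isPreconnected_sphere ?_ y r) ?_ p ?_ hs hs' (hmeet s hs hys)
    (hmeet s' hs' hys')
  · rw [← Module.finrank_eq_rank]
    norm_num
  · intro x hx
    have := closure_subset_triangles hΩ hK (subset_closure (hsph x hx).1)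
    simpa using this
  · intro x hx t ht t' ht' hxt hxt'
    by_cases htt : t = t'
    · rw [htt]
    obtain ⟨-, h2, h3⟩ := hsph x hx
    obtain ⟨a, b, hf, hf'⟩ := exists_common_edge ht ht' hxt hxt' (h3 t ht)
    exact hp t t' a b hf hf' (mem_hull_common_edge hf hf' htt (h2 t ht hxt) (h2 t' ht' hxt'))

lemma macro_openTri_subset {s : Finset Plane} (hs : s ∈ macroTriangles K) {a b d : Plane}
    (e : s = {a, b, d}) (hab : a ≠ b) (had : a ≠ d) (hbd : b ≠ d) : openTri a b d ⊆ Ω := by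
  intro x hx
  refine mem_of_mem_nhds_closure hΩ (Filter.mem_of_superset
    ((isOpen_openTri (triple_area hs e hab had hbd)).mem_nhds hx) ?_)
  refine (openTri_subset_hull a b d).trans ?_
  have := hull_subset_closure hK hs.1
  rwa [e, coe_triple] at this

lemma cen_mem_domain {s : Finset Plane} (hs : s ∈ macroTriangles K) : cen s ∈ Ω := by
  obtain ⟨a, b, hf⟩ := IsFlag.exists_isFlag hs
  obtain ⟨d, had, hbd, e⟩ := hf.third
  exact macro_openTri_subset hΩ hK hs e hf.ne had hbd
    ((mem_openTri_iff_coord hs e hf.ne had hbd).2 (coord_cen hs e hf.ne had hbd))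

omit hΩ hK in
lemma cen_mem_hull {s : Finset Plane} (hs : s ∈ macroTriangles K) :
    cen s ∈ convexHull ℝ (s : Set Plane) := by
  obtain ⟨a, b, hf⟩ := IsFlag.exists_isFlag hs
  obtain ⟨d, had, hbd, e⟩ := hf.third
  have h := coord_cen hs e hf.ne had hbd
  exact (mem_hull_iff_coord hs e hf.ne had hbd).2 ⟨h.1.le, h.2.1.le, h.2.2.le⟩

/-- Triangles through a point of Ω are linked by edges through that point, and Ω is connected. So
two triangles that touch only at a boundary vertex are linked as well. -/
lemma dualConnected : DualConnected K := by
  intro p hp s hs s' hs'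
  refine eq_of_isPreconnected hK hΩ.isConnected.isPreconnected ?_ p ?_ hs hs'
    ⟨_, cen_mem_domain hΩ hK hs, cen_mem_hull hs⟩ ⟨_, cen_mem_domain hΩ hK hs', cen_mem_hull hs'⟩
  · intro x hx
    simpa using closure_subset_triangles hΩ hK (subset_closure hx)
  · intro x hx t ht t' ht' hxt hxt'
    exact locally_connected hΩ hK hx (fun s s' a b h h' _ => hp s s' a b h h') ht ht' hxt hxt'

end domain

/-! ### Jumps across edges -/

/-- The sign that tells on which side of the line from `a` to `b` the triangle `s` lies. -/
def side (s : Finset Plane) (a b : Plane) : ℝ := SignType.sign (cross (b - a) (cen s - a))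

lemma side_eq {s : Finset Plane} (hs : s ∈ macroTriangles K) {a b d : Plane}
    (e : s = {a, b, d}) (hab : a ≠ b) (had : a ≠ d) (hbd : b ≠ d) :
    side s a b = SignType.sign (cross (b - a) (d - a)) := by
  obtain ⟨δ, hδ, h⟩ := cross_pos_of_mem_openTri
    ((mem_openTri_iff_coord hs e hab had hbd).2 (coord_cen hs e hab had hbd))
  rw [side, h, sign_mul, sign_pos hδ, one_mul]

lemma coe_sign_mul_self {x : ℝ} (hx : x ≠ 0) :
    ((SignType.sign x : SignType) : ℝ) * (SignType.sign x : SignType) = 1 := by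
  rcases hx.lt_or_gt with h | h
  · rw [sign_neg h]; norm_num
  · rw [sign_pos h]; norm_num

lemma side_mul_self {s : Finset Plane} {a b : Plane} (h : IsFlag K s a b) :
    side s a b * side s a b = 1 := by
  obtain ⟨d, had, hbd, e⟩ := h.third
  rw [side_eq h.tri e h.ne had hbd]
  exact coe_sign_mul_self (triple_area h.tri e h.ne had hbd)

lemma side_swap {s : Finset Plane} {a b : Plane} : side s b a = -side s a b := by
  have : cross (a - b) (cen s - b) = -cross (b - a) (cen s - a) := by
    simp only [cross, PiLp.sub_apply]; ring
  rw [side, side, this, Left.sign_neg]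
  simp

/-- The two edges of a triangle at `a` carry opposite signs; this is why jumps have no circulation
about a vertex. -/
lemma side_third {s : Finset Plane} (hs : s ∈ macroTriangles K) {a b d : Plane}
    (e : s = {a, b, d}) (hab : a ≠ b) (had : a ≠ d) (hbd : b ≠ d) :
    side s a d = -side s a b := by
  have e' : s = {a, d, b} := by rw [e, Finset.pair_comm]
  rw [side_eq hs e hab had hbd, side_eq hs e' had hab hbd.symm, area_swap, Left.sign_neg]
  simp

lemma side_opposite {s s' : Finset Plane} {a b : Plane} (h : IsFlag K s a b)
    (h' : IsFlag K s' a b) (hne : s ≠ s') : side s' a b = -side s a b := by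
  obtain ⟨d, had, hbd, e⟩ := h.third
  obtain ⟨d', had', hbd', e'⟩ := h'.third
  rw [side_eq h.tri e h.ne had hbd, side_eq h'.tri e' h'.ne had' hbd']
  have hneg := area_mul_neg h.tri h'.tri hne e e' h.ne had hbd had' hbd'
  rcases mul_neg_iff.1 hneg with hh | hh
  · rw [sign_pos hh.1, sign_neg hh.2]; simp
  · rw [sign_neg hh.1, sign_pos hh.2]; simp

/-- A chosen endpoint of an edge. -/
def head (e : Finset Plane) : Plane := if h : e.Nonempty then h.choose else 0

lemma head_mem {e : Finset Plane} (h : e.Nonempty) : head e ∈ e := by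
  rw [head, dif_pos h]; exact h.choose_spec

/-- The incidence number of a vertex and an edge. -/
def inc (v : Plane) (e : Finset Plane) : ℝ := if v ∈ e then (if v = head e then 1 else -1) else 0

lemma inc_mul_self {v : Plane} {e : Finset Plane} (h : v ∈ e) : inc v e * inc v e = 1 := by
  rw [inc, if_pos h]; split_ifs <;> norm_num

lemma inc_right {a b : Plane} (h : a ≠ b) : inc b {a, b} = -inc a {a, b} := by
  have := head_mem (e := {a, b}) ⟨a, by simp⟩
  simp only [Finset.mem_insert, Finset.mem_singleton] at this
  rcases this with h1 | h1 <;> simp [inc, h1, h, h.symm]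

/-- The jumps of `p` across the edges that contain `y` are given by `f`. -/
def IsPotential (K : Geometry.SimplicialComplex ℝ Plane) (f : Finset Plane → ℝ) (y : Plane)
    (p : Finset Plane → ℝ) : Prop :=
  ∀ s s' a b, IsFlag K s a b → IsFlag K s' a b → s ≠ s' →
    y ∈ convexHull ℝ ({a, b} : Set Plane) →
    p s - p s' = side s a b * inc a {a, b} * f {a, b}

/-- Interchanging the triangles flips `side`, interchanging the endpoints flips both `side` and
`inc`. So the relation need only be checked for one ordering. -/
lemma jump_of_jump {s s' t t' : Finset Plane} {a b a' b' : Plane} (h : IsFlag K s a b)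
    (h' : IsFlag K s' a b) (hne : s ≠ s') (g : IsFlag K t a' b') (g' : IsFlag K t' a' b')
    (hne' : t ≠ t') (he : ({a, b} : Finset Plane) = {a', b'}) {p : Finset Plane → ℝ} {c : ℝ}
    (hp : p s - p s' = side s a b * inc a {a, b} * c) :
    p t - p t' = side t a' b' * inc a' {a', b'} * c := by
  have key : p t - p t' = side t a b * inc a {a, b} * c := by
    have h1 := eq_or_eq_of_edge h.tri h'.tri g.tri hne (Finset.card_pair h.ne) h.pair_subset
      h'.pair_subset (he ▸ g.pair_subset)
    have h2 := eq_or_eq_of_edge h.tri h'.tri g'.tri hne (Finset.card_pair h.ne) h.pair_subset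
      h'.pair_subset (he ▸ g'.pair_subset)
    rcases h1 with rfl | rfl <;> rcases h2 with rfl | rfl
    · exact absurd rfl hne'
    · exact hp
    · rw [side_opposite h h' hne]; linarith
    · exact absurd rfl hne'
  rcases flag_edge_cases he with ⟨rfl, rfl⟩ | ⟨rfl, rfl⟩
  · exact key
  · rw [key, side_swap, ← he, inc_right h.ne]; ring

/-- The jumps of a function on the triangles. -/
def jump (K : Geometry.SimplicialComplex ℝ Plane) :
    (Finset Plane → ℝ) →ₗ[ℝ] (Finset Plane → ℝ) where
  toFun p e := if h : ∃ r : (Finset Plane × Finset Plane) × Plane × Plane,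
      IsFlag K r.1.1 r.2.1 r.2.2 ∧ IsFlag K r.1.2 r.2.1 r.2.2 ∧ r.1.1 ≠ r.1.2 ∧
        e = {r.2.1, r.2.2} then
      side h.choose.1.1 h.choose.2.1 h.choose.2.2 * inc h.choose.2.1 e *
        (p h.choose.1.1 - p h.choose.1.2) else 0
  map_add' p q := by
    funext e
    simp only [Pi.add_apply]
    split_ifs
    · ring
    · simp
  map_smul' c p := by
    funext e
    simp only [Pi.smul_apply, smul_eq_mul, RingHom.id_apply]
    split_ifs
    · ring
    · simp

lemma sub_eq_jump {s s' : Finset Plane} {a b : Plane} (h : IsFlag K s a b) (h' : IsFlag K s' a b)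
    (hne : s ≠ s') (p : Finset Plane → ℝ) :
    p s - p s' = side s a b * inc a {a, b} * jump K p {a, b} := by
  have hex : ∃ r : (Finset Plane × Finset Plane) × Plane × Plane,
      IsFlag K r.1.1 r.2.1 r.2.2 ∧ IsFlag K r.1.2 r.2.1 r.2.2 ∧ r.1.1 ≠ r.1.2 ∧
        ({a, b} : Finset Plane) = {r.2.1, r.2.2} := ⟨((s, s'), (a, b)), h, h', hne, rfl⟩
  have hj : jump K p {a, b} = side hex.choose.1.1 hex.choose.2.1 hex.choose.2.2 *
      inc hex.choose.2.1 {a, b} * (p hex.choose.1.1 - p hex.choose.1.2) := by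
    simp only [jump, LinearMap.coe_mk, AddHom.coe_mk, dif_pos hex]
  obtain ⟨h1, h2, h3, h4⟩ := hex.choose_spec
  generalize hex.choose = r at *
  refine jump_of_jump h1 h2 h3 h h' hne h4.symm ?_
  rw [hj, h4]
  have e1 := side_mul_self h1
  have e2 := inc_mul_self (v := r.2.1) (e := {r.2.1, r.2.2}) (by simp)
  linear_combination (-(inc r.2.1 {r.2.1, r.2.2} * inc r.2.1 {r.2.1, r.2.2}) *
    (p r.1.1 - p r.1.2)) * e1 - (p r.1.1 - p r.1.2) * e2

/-! ### The triangles and edges at an interior vertex -/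

section domain
variable (hΩ : IsPolygonalDomain Ω) (hK : IsTriangulation K Ω)
include hK

/-- Every edge that meets the domain belongs to two triangles. -/
lemma exists_two_triangles (hΩ : IsPolygonalDomain Ω) {e : Finset Plane} (he : e ∈ macroEdges K)
    {y : Plane} (hy : y ∈ Ω) (hye : y ∈ convexHull ℝ (e : Set Plane)) :
    ∃ s ∈ macroTriangles K, ∃ s' ∈ macroTriangles K, s ≠ s' ∧ e ⊆ s ∧ e ⊆ s' := by
  refine (mem_interiorEdges_iff hΩ hK he).1 ⟨he, fun h => ?_⟩
  have := h hye
  rw [frontier_eq hΩ] at this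
  exact this.2 hy

/-- The triangles at a vertex. -/
def trianglesAt (hK : IsTriangulation K Ω) (v : Plane) : Finset (Finset Plane) :=
  hK.finite_macroTriangles.toFinset.filter (v ∈ ·)

/-- The edges at a vertex. -/
def edgesAt (hK : IsTriangulation K Ω) (v : Plane) : Finset (Finset Plane) :=
  hK.finite_macroEdges.toFinset.filter (v ∈ ·)

lemma finite_flagsAt (v : Plane) :
    {r : Finset Plane × Plane | IsFlag K r.1 v r.2}.Finite := by
  refine Set.Finite.preimage (f := fun r : Finset Plane × Plane => (r.1, v, r.2)) ?_
    hK.finite_flagSet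
  rintro ⟨s, w⟩ - ⟨s', w'⟩ - h
  simp only [Prod.mk.injEq, true_and] at h
  simp [h.1, h.2]

/-- The flags at a vertex. -/
def flagsAt (hK : IsTriangulation K Ω) (v : Plane) : Finset (Finset Plane × Plane) :=
  (finite_flagsAt hK v).toFinset

omit hK in
lemma mem_trianglesAt {hK : IsTriangulation K Ω} {v : Plane} {s : Finset Plane} :
    s ∈ trianglesAt hK v ↔ s ∈ macroTriangles K ∧ v ∈ s := by simp [trianglesAt]

omit hK in
lemma mem_edgesAt {hK : IsTriangulation K Ω} {v : Plane} {e : Finset Plane} :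
    e ∈ edgesAt hK v ↔ e ∈ macroEdges K ∧ v ∈ e := by simp [edgesAt]

omit hK in
lemma mem_flagsAt {hK : IsTriangulation K Ω} {v w : Plane} {s : Finset Plane} :
    (s, w) ∈ flagsAt hK v ↔ IsFlag K s v w := by simp [flagsAt]

/-- Double counting at a vertex: each triangle there contains two flags. About a vertex in Ω each
edge also carries two flags, and comparing both groupings yields the identities about circulations.
-/
lemma sum_flagsAt_eq_sum_trianglesAt (v : Plane) (g : Finset Plane × Plane → ℝ)
    (G : Finset Plane → ℝ)
    (hG : ∀ s ∈ macroTriangles K, ∀ b d, v ≠ b → v ≠ d → b ≠ d → s = {v, b, d} →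
      g (s, b) + g (s, d) = G s) :
    ∑ r ∈ flagsAt hK v, g r = ∑ s ∈ trianglesAt hK v, G s := by
  rw [← Finset.sum_fiberwise_of_maps_to (s := flagsAt hK v) (t := trianglesAt hK v)
    (g := Prod.fst)]
  · refine Finset.sum_congr rfl fun s hs => ?_
    rw [mem_trianglesAt] at hs
    obtain ⟨b, hb, hbv⟩ := Finset.exists_mem_ne (by rw [hs.1.2]; norm_num) v
    obtain ⟨d, -, had, hbd, e⟩ := exists_third hs.1.2 hs.2 hb hbv.symm
    obtain ⟨f1, f2, f3⟩ := isFlag_triple hs.1 e hbv.symm had hbd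
    rw [← hG s hs.1 b d hbv.symm had hbd e, ← Finset.sum_pair (f := g) (by simp [hbd])]
    refine Finset.sum_congr ?_ fun _ _ => rfl
    ext ⟨t, w⟩
    simp only [Finset.mem_filter, mem_flagsAt, Finset.mem_insert, Finset.mem_singleton,
      Prod.mk.injEq]
    constructor
    · rintro ⟨hf, rfl⟩
      have := hf.right
      rw [e] at this
      simp only [Finset.mem_insert, Finset.mem_singleton] at this
      rcases this with h | h | h
      · exact absurd h.symm hf.ne
      · exact Or.inl ⟨rfl, h⟩
      · exact Or.inr ⟨rfl, h⟩
    · rintro (⟨rfl, rfl⟩ | ⟨rfl, rfl⟩)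
      · exact ⟨f1, rfl⟩
      · exact ⟨f3.symm, rfl⟩
  · rintro ⟨s, w⟩ h
    rw [mem_flagsAt] at h
    exact mem_trianglesAt.2 ⟨h.tri, h.left⟩

include hΩ

lemma sum_flagsAt_eq_sum_edgesAt {v : Plane} (hv : v ∈ Ω) (g : Finset Plane × Plane → ℝ)
    (G : Finset Plane → ℝ)
    (hG : ∀ s s' w, IsFlag K s v w → IsFlag K s' v w → s ≠ s' →
      g (s, w) + g (s', w) = G {v, w}) :
    ∑ r ∈ flagsAt hK v, g r = ∑ e ∈ edgesAt hK v, G e := by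
  rw [← Finset.sum_fiberwise_of_maps_to (s := flagsAt hK v) (t := edgesAt hK v)
    (g := fun r => {v, r.2})]
  · refine Finset.sum_congr rfl fun e he => ?_
    rw [mem_edgesAt] at he
    obtain ⟨s, hs, s', hs', hne, hes, hes'⟩ := exists_two_triangles hK hΩ he.1 hv
      (subset_convexHull ℝ _ he.2)
    obtain ⟨w, hw, hwv⟩ := Finset.exists_mem_ne (by rw [he.1.2]; norm_num) v
    have heq : e = {v, w} := (Finset.eq_of_subset_of_card_le
      (by simp [Finset.insert_subset_iff, he.2, hw]) (by rw [he.1.2, Finset.card_pair hwv.symm])).symm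
    subst heq
    have f1 : IsFlag K s v w := ⟨hs, hes he.2, hes hw, hwv.symm⟩
    have f2 : IsFlag K s' v w := ⟨hs', hes' he.2, hes' hw, hwv.symm⟩
    rw [← hG s s' w f1 f2 hne, ← Finset.sum_pair (f := g) (by simp [hne])]
    refine Finset.sum_congr ?_ fun _ _ => rfl
    ext ⟨t, u⟩
    simp only [Finset.mem_filter, mem_flagsAt, Finset.mem_insert, Finset.mem_singleton,
      Prod.mk.injEq]
    constructor
    · rintro ⟨hf, hu⟩
      rcases flag_edge_cases hu with ⟨-, rfl⟩ | ⟨h, -⟩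
      · rcases eq_or_eq_of_edge hs hs' hf.tri hne he.1.2 hes hes' hf.pair_subset with rfl | rfl
        · exact Or.inl ⟨rfl, rfl⟩
        · exact Or.inr ⟨rfl, rfl⟩
      · exact absurd h.symm hwv
    · rintro (⟨rfl, rfl⟩ | ⟨rfl, rfl⟩)
      · exact ⟨f1, rfl⟩
      · exact ⟨f2, rfl⟩
  · rintro ⟨s, w⟩ h
    rw [mem_flagsAt] at h
    exact mem_edgesAt.2 ⟨h.edge, by simp⟩

lemma card_trianglesAt {v : Plane} (hv : v ∈ Ω) :
    (trianglesAt hK v).card = (edgesAt hK v).card := by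
  have h1 := sum_flagsAt_eq_sum_trianglesAt hK v (fun _ => 1) (fun _ => 2)
    (fun _ _ _ _ _ _ _ _ => by norm_num)
  have h2 := sum_flagsAt_eq_sum_edgesAt hΩ hK hv (fun _ => 1) (fun _ => 2)
    (fun _ _ _ _ _ _ => by norm_num)
  rw [h1] at h2
  simp only [Finset.sum_const, nsmul_eq_mul] at h2
  have : ((trianglesAt hK v).card : ℝ) = (edgesAt hK v).card := by linarith
  exact_mod_cast this

/-- Jumps have no circulation about a vertex. -/
lemma sum_inc_jump {v : Plane} (hv : v ∈ Ω) (p : Finset Plane → ℝ) :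
    ∑ e ∈ edgesAt hK v, inc v e * jump K p e = 0 := by
  -- The sum of `side s v w * p s` over the flags at `v` is the circulation when grouped by edges,
  -- and zero when grouped by triangles.
  rw [← sum_flagsAt_eq_sum_edgesAt hΩ hK hv (fun r => side r.1 v r.2 * p r.1),
    sum_flagsAt_eq_sum_trianglesAt hK v _ (fun _ => 0), Finset.sum_const_zero]
  · intro s hs b d hb hd hbd e
    rw [side_third hs e hb hd hbd]
    ring
  · intro s s' w h h' hne
    have h1 := sub_eq_jump h h' hne p
    have h2 := side_mul_self h
    rw [side_opposite h h' hne]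
    linear_combination side s v w * h1 + inc v {v, w} * jump K p {v, w} * h2

/-- Jumps without circulation about a vertex come from a function on the triangles. -/
lemma exists_isPotential_vertex {v : Plane} (hv : v ∈ Ω) {s₀ : Finset Plane}
    (hs₀ : s₀ ∈ macroTriangles K) (hvs : v ∈ s₀) {f : Finset Plane → ℝ}
    (hf : ∑ e ∈ edgesAt hK v, inc v e * f e = 0) : ∃ p, IsPotential K f v p := by
  let ext : (trianglesAt hK v → ℝ) →ₗ[ℝ] (Finset Plane → ℝ) :=
    { toFun := fun p s => if h : s ∈ trianglesAt hK v then p ⟨s, h⟩ else 0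
      map_add' := fun p q => by funext s; by_cases h : s ∈ trianglesAt hK v <;> simp [h]
      map_smul' := fun c p => by funext s; by_cases h : s ∈ trianglesAt hK v <;> simp [h] }
  have hext : ∀ p s, ∀ h : s ∈ trianglesAt hK v, ext p s = p ⟨s, h⟩ := fun p s h => dif_pos h
  let D : (trianglesAt hK v → ℝ) →ₗ[ℝ] (edgesAt hK v → ℝ) :=
    LinearMap.funLeft ℝ ℝ Subtype.val ∘ₗ jump K ∘ₗ ext
  have hD : ∀ p e, D p e = jump K (ext p) e := fun p e => rfl
  let lam : (edgesAt hK v → ℝ) →ₗ[ℝ] ℝ := ∑ e : edgesAt hK v, inc v e • LinearMap.proj e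
  have hlam : ∀ g, lam g = ∑ e : edgesAt hK v, inc v e * g e := by
    intro g
    simp [lam]
  have mem_at : ∀ s ∈ macroTriangles K, v ∈ convexHull ℝ (s : Set Plane) →
      s ∈ trianglesAt hK v := fun s hs h =>
    mem_trianglesAt.2 ⟨hs, mem_of_vertex_mem_hull hs₀.1 hs.1 hvs h⟩
  have hker : Module.finrank ℝ (LinearMap.ker D) ≤ 1 := by
    refine (Submodule.finrank_mono (t := Submodule.span ℝ {fun _ => (1 : ℝ)}) ?_).trans ?_
    · intro p hp
      refine Submodule.mem_span_singleton.2 ⟨p ⟨s₀, mem_trianglesAt.2 ⟨hs₀, hvs⟩⟩, ?_⟩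
      funext ⟨s, hs⟩
      simp only [Pi.smul_apply, smul_eq_mul, mul_one]
      rw [← hext p s hs, ← hext p s₀]
      rw [mem_trianglesAt] at hs
      refine locally_connected hΩ hK hv (fun t t' a b h h' hab => ?_) hs₀ hs.1
        (subset_convexHull ℝ _ hvs) (subset_convexHull ℝ _ hs.2)
      by_cases htt : t = t'
      · rw [htt]
      rw [← sub_eq_zero, sub_eq_jump h h' htt]
      have hab' := mem_of_vertex_mem_hull hs₀.1 h.edge.1 hvs (by simpa using hab)
      have := congrFun (LinearMap.mem_ker.1 hp) ⟨{a, b}, mem_edgesAt.2 ⟨h.edge, hab'⟩⟩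
      rw [hD] at this
      simp only [Pi.zero_apply] at this
      rw [this, mul_zero]
    · exact (finrank_span_le_card _).trans (by simp)
  have hrange : LinearMap.range D ≤ LinearMap.ker lam := by
    rintro _ ⟨p, rfl⟩
    rw [LinearMap.mem_ker, hlam, ← sum_inc_jump hΩ hK hv (ext p)]
    exact Finset.sum_coe_sort (edgesAt hK v) (fun e => inc v e * jump K (ext p) e)
  have hne : lam ≠ 0 := by
    obtain ⟨b, hb, hbv⟩ := Finset.exists_mem_ne (by rw [hs₀.2]; norm_num) v
    have hf : IsFlag K s₀ v b := ⟨hs₀, hvs, hb, hbv.symm⟩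
    have he : {v, b} ∈ edgesAt hK v := mem_edgesAt.2 ⟨hf.edge, by simp⟩
    intro h0
    have h1 := hlam (Pi.single ⟨_, he⟩ 1)
    rw [h0] at h1
    simp only [LinearMap.zero_apply, Pi.single_apply, mul_ite, mul_one, mul_zero,
      Finset.sum_ite_eq', Finset.mem_univ, if_true] at h1
    have h2 := inc_mul_self (v := v) (e := {v, b}) (by simp)
    rw [← h1] at h2
    norm_num at h2
  have hcardker : Module.finrank ℝ (LinearMap.ker lam) + 1 = (edgesAt hK v).card := by
    have h1 := LinearMap.finrank_range_add_finrank_ker lam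
    rw [LinearMap.range_eq_top.2 (LinearMap.surjective hne), finrank_top, Module.finrank_self,
      Module.finrank_fintype_fun_eq_card, Fintype.card_coe] at h1
    omega
  -- As there are as many triangles as edges at `v` and the kernel is at most one-dimensional, the
  -- range of `D` has at least the dimension of the kernel of `lam`, in which it is contained.
  have hDrank := LinearMap.finrank_range_add_finrank_ker D
  rw [Module.finrank_fintype_fun_eq_card, Fintype.card_coe, card_trianglesAt hΩ hK hv] at hDrank
  have heq := Submodule.eq_of_le_of_finrank_le hrange (by omega)
  have hfk : (fun e : edgesAt hK v => f e) ∈ LinearMap.ker lam := by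
    rw [LinearMap.mem_ker, hlam, ← hf]
    exact Finset.sum_coe_sort (edgesAt hK v) (fun e => inc v e * f e)
  rw [← heq] at hfk
  obtain ⟨p, hp⟩ := hfk
  refine ⟨ext p, fun s s' a b h h' hne hab => ?_⟩
  rw [sub_eq_jump h h' hne]
  have hab' := mem_of_vertex_mem_hull hs₀.1 h.edge.1 hvs (by simpa using hab)
  have := congrFun hp ⟨{a, b}, mem_edgesAt.2 ⟨h.edge, hab'⟩⟩
  rw [hD] at this
  simp only at this
  rw [this]

/-- Local potentials exist at all points of the domain. -/
lemma exists_isPotential {y : Plane} (hy : y ∈ Ω) {f : Finset Plane → ℝ}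
    (hf : ∀ v ∈ Ω, ∑ e ∈ edgesAt hK v, inc v e * f e = 0) : ∃ p, IsPotential K f y p := by
  by_cases hvert : ∃ s ∈ macroTriangles K, y ∈ s
  · obtain ⟨s, hs, hys⟩ := hvert
    exact exists_isPotential_vertex hΩ hK hy hs hys (hf y hy)
  by_cases hedge : ∃ s s' a b, IsFlag K s a b ∧ IsFlag K s' a b ∧ s ≠ s' ∧
      y ∈ convexHull ℝ ({a, b} : Set Plane)
  · obtain ⟨s, s', a, b, h, h', hne, hyab⟩ := hedge
    -- At a relatively interior point of an edge only this edge matters, so a function supported on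
    -- one of its two triangles realises the jump.
    refine ⟨fun t => if t = s then side s a b * inc a {a, b} * f {a, b} else 0,
      fun t t' a' b' g g' hne' hyab' => ?_⟩
    have hmem : y ∈ openSegment ℝ a b := by
      rw [convexHull_pair] at hyab
      refine mem_openSegment_of_ne_left_right ?_ ?_ hyab
      · rintro rfl; exact hvert ⟨s, h.tri, h.left⟩
      · rintro rfl; exact hvert ⟨s, h.tri, h.right⟩
    have hsub := subset_of_mem_openSegment h.edge.1 h.ne rfl g.edge.1 hmem (by simpa using hyab')
    have heq := Finset.eq_of_subset_of_card_le hsub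
      (by rw [Finset.card_pair h.ne, Finset.card_pair g.ne])
    rw [← heq]
    have := jump_of_jump h h' hne g g' hne' heq (p := fun t => if t = s then
      side s a b * inc a {a, b} * f {a, b} else 0) (c := f {a, b}) (by simp [hne.symm])
    rw [← heq] at this
    exact this
  · push Not at hedge
    exact ⟨0, fun s s' a b h h' hne hyab => absurd hyab (hedge s s' a b h h' hne)⟩

end domain

/-! ### Gluing over a simply connected space -/

open scoped Bundle

/-- The real numbers with the discrete topology. -/
structure DiscreteReal where
  /-- The underlying real number. -/
  val : ℝ

instance : TopologicalSpace DiscreteReal := ⊥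
instance : DiscreteTopology DiscreteReal := ⟨rfl⟩

/-- On a simply connected space, functions `h x` on neighbourhoods of the points `x` whose
differences are locally constant can be corrected by constants so as to fit together. -/
lemma exists_glued_function {B : Type*} [TopologicalSpace B] [SimplyConnectedSpace B]
    [LocallyPathConnectedSpace B] (U : B → Set B) (hU : ∀ x, IsOpen (U x)) (hxU : ∀ x, x ∈ U x)
    (h : B → B → ℝ) (hh : ∀ x x' y, y ∈ U x → y ∈ U x' →
      ∀ᶠ y' in 𝓝 y, h x y' - h x' y' = h x y - h x' y) :
    ∃ C : B → ℝ, ∀ x, ∀ᶠ y in 𝓝 x, C y - h x y = C x - h x x := by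
  -- The constants by which a local function may be shifted form the fibre, and the differences of
  -- the local functions are the transitions. These are locally constant, so they are continuous for
  -- the discrete topology and the bundle is a covering.
  let Z : FiberBundleCore B B DiscreteReal :=
    { baseSet := U
      isOpen_baseSet := hU
      indexAt := id
      mem_baseSet_at := hxU
      coordChange := fun x x' y c => ⟨c.val + (h x y - h x' y)⟩
      coordChange_self := fun x y _ v => by
        simp
      continuousOn_coordChange := by
        rintro x x' ⟨y, c⟩ ⟨⟨hy, hy'⟩, -⟩
        refine ContinuousAt.continuousWithinAt ?_
        refine ContinuousAt.congr (continuousAt_const (y := DiscreteReal.mk (c.val + (h x y - h x' y)))) ?_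
        rw [nhds_prod_eq, nhds_discrete DiscreteReal]
        have h1 : ∀ᶠ z : B × DiscreteReal in 𝓝 y ×ˢ pure c,
          h x z.1 - h x' z.1 = h x y - h x' y := (hh x x' y hy hy').prod_inl _
        have h2 : ∀ᶠ z : B × DiscreteReal in 𝓝 y ×ˢ pure c, z.2 = c :=
          (Filter.Eventually.prod_inr (p := fun z => z = c) (by simp) _)
        filter_upwards [h1, h2] with z hz hz'
        rw [hz, hz']
      coordChange_comp := fun x x' x'' y _ v => by
        simp [add_assoc] }
  obtain ⟨b⟩ : Nonempty B := inferInstance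
  have cov : IsCoveringMap (π DiscreteReal Z.Fiber) := FiberBundle.isCoveringMap (F := DiscreteReal) (E := Z.Fiber)
  -- Over a simply connected and locally path connected base the identity lifts; the lift is a
  -- global section.
  obtain ⟨σ, ⟨-, hσ⟩, -⟩ := cov.existsUnique_continuousMap_lifts (ContinuousMap.id B) b
    (⟨b, ⟨0⟩⟩ : Z.TotalSpace) rfl
  have hproj : ∀ y, (σ y).1 = y := fun y => congrFun hσ y
  -- The fibre over `y` is trivialised by the local function with index `y`, hence the term `h y y`.
  -- In the trivialisation at `x` the section reads as `C y - h x y` and is locally constant.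
  refine ⟨fun y => DiscreteReal.val (σ y).2 + h y y, fun x => ?_⟩
  have h1 : ContinuousAt (fun y => (Z.localTriv x (σ y)).2) x := by
    refine continuousAt_snd.comp (ContinuousAt.comp (f := σ) ?_ σ.continuous.continuousAt)
    refine (Z.localTriv x).continuousAt ?_
    rw [(Z.localTriv x).mem_source]
    change (σ x).1 ∈ U x
    rw [hproj]
    exact hxU x
  rw [ContinuousAt, nhds_discrete DiscreteReal, tendsto_pure] at h1
  filter_upwards [h1] with y hy
  have h2 : ∀ y, (Z.localTriv x (σ y)).2.val =
      DiscreteReal.val (σ y).2 + (h y y - h x y) := by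
    intro y
    change DiscreteReal.val (σ y).2 + (h (σ y).1 (σ y).1 - h x (σ y).1) = _
    rw [hproj]
  have h3 := h2 y
  rw [hy, h2 x] at h3
  linarith

/-! ### Euler's formula -/

lemma IsFlag.mem_hull {s : Finset Plane} {a b y : Plane} (h : IsFlag K s a b)
    (hy : y ∈ convexHull ℝ ({a, b} : Set Plane)) : y ∈ convexHull ℝ (s : Set Plane) :=
  convexHull_mono (by simp [Set.insert_subset_iff, h.left, h.right]) hy

section domain
variable (hΩ : IsPolygonalDomain Ω) (hK : IsTriangulation K Ω)
include hΩ hK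

/-- Every edge through `y` that two triangles share also contains `x` and `x'`, so the potentials
have the same jumps across it. Their difference is then constant on the triangles at `y`. -/
lemma sub_eq_sub_of_isPotential {f : Finset Plane → ℝ} {x x' y : Plane} (hy : y ∈ Ω)
    (hx : ∀ s ∈ macroTriangles K, y ∈ convexHull ℝ (s : Set Plane) →
      x ∈ convexHull ℝ (s : Set Plane))
    (hx' : ∀ s ∈ macroTriangles K, y ∈ convexHull ℝ (s : Set Plane) →
      x' ∈ convexHull ℝ (s : Set Plane))
    {p p' : Finset Plane → ℝ} (hp : IsPotential K f x p) (hp' : IsPotential K f x' p')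
    {s s' : Finset Plane} (hs : s ∈ macroTriangles K) (hs' : s' ∈ macroTriangles K)
    (hys : y ∈ convexHull ℝ (s : Set Plane)) (hys' : y ∈ convexHull ℝ (s' : Set Plane)) :
    p s - p' s = p s' - p' s' := by
  refine locally_connected hΩ hK hy (p := fun s => p s - p' s) (fun t t' a b h h' hab => ?_)
    hs hs' hys hys'
  by_cases hne : t = t'
  · rw [hne]
  have h1 := hp t t' a b h h' hne (mem_hull_common_edge h h' hne (hx t h.tri (h.mem_hull hab))
    (hx t' h'.tri (h'.mem_hull hab)))
  have h2 := hp' t t' a b h h' hne (mem_hull_common_edge h h' hne (hx' t h.tri (h.mem_hull hab))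
    (hx' t' h'.tri (h'.mem_hull hab)))
  linarith

/-- Every point of a triangle in the domain can be joined to the incenter inside both. -/
lemma isPreconnected_hull_inter {s : Finset Plane} (hs : s ∈ macroTriangles K) :
    IsPreconnected (Ω ∩ convexHull ℝ (s : Set Plane)) := by
  suffices h : StarConvex ℝ (cen s) (Ω ∩ convexHull ℝ (s : Set Plane)) from
    (h.isPathConnected ⟨cen_mem_domain hΩ hK hs, cen_mem_hull hs⟩).isConnected.isPreconnected
  intro y hy α β hα hβ hαβ
  refine ⟨?_, (convex_convexHull ℝ _) (cen_mem_hull hs) hy.2 hα hβ hαβ⟩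
  obtain ⟨a, b, hf⟩ := IsFlag.exists_isFlag hs
  obtain ⟨d, had, hbd, e⟩ := hf.third
  rcases hα.eq_or_lt with rfl | hα
  · have : β = 1 := by linarith
    subst this
    simpa using hy.1
  refine macro_openTri_subset hΩ hK hs e hf.ne had hbd
    ((mem_openTri_iff_coord hs e hf.ne had hbd).2 ?_)
  have h1 := coord_cen hs e hf.ne had hbd
  have h2 := (mem_hull_iff_coord hs e hf.ne had hbd).1 hy.2
  have h3 : α • cen s + β • y = comb α β 0 (cen s) y y := by simp [comb]
  rw [h3]
  simp only [coord_comb _ _ _ _ (show α + β + 0 = 1 by linarith)]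
  refine ⟨?_, ?_, ?_⟩
  · nlinarith [mul_pos hα h1.1, mul_nonneg hβ h2.1]
  · nlinarith [mul_pos hα h1.2.1, mul_nonneg hβ h2.2.1]
  · nlinarith [mul_pos hα h1.2.2, mul_nonneg hβ h2.2.2]

/-- On a simply connected domain, jumps without circulation come from a function on the
triangles. -/
lemma exists_jump_eq (hsc : SimplyConnectedSpace Ω) {f : Finset Plane → ℝ}
    (hf : ∀ v ∈ Ω, ∑ e ∈ edgesAt hK v, inc v e * f e = 0) :
    ∃ p : Finset Plane → ℝ, ∀ s s' a b, IsFlag K s a b → IsFlag K s' a b → s ≠ s' →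
      p s - p s' = side s a b * inc a {a, b} * f {a, b} := by
  have hP : ∀ y : Ω, ∃ p, IsPotential K f y p := fun y => exists_isPotential hΩ hK y.2 hf
  choose P hP using hP
  have htri : ∀ y : Ω, ∃ s ∈ macroTriangles K, (y : Plane) ∈ convexHull ℝ (s : Set Plane) := by
    intro y
    simpa using closure_subset_triangles hΩ hK (subset_closure y.2)
  choose tri htri hmem using htri
  have : LocallyPathConnectedSpace Ω := hΩ.isOpen.locallyPathConnectedSpace
  -- Near `x` no triangle appears that does not contain `x`; there the potential at `x` is still a
  -- local potential.
  let U : Ω → Set Ω := fun x => {y | ∀ s ∈ macroTriangles K,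
    (y : Plane) ∈ convexHull ℝ (s : Set Plane) → (x : Plane) ∈ convexHull ℝ (s : Set Plane)}
  have hU : ∀ x, IsOpen (U x) := by
    intro x
    have hc : IsClosed (⋃ s ∈ {s | s ∈ macroTriangles K ∧
        (x : Plane) ∉ convexHull ℝ (s : Set Plane)}, convexHull ℝ (s : Set Plane)) :=
      (hK.finite_macroTriangles.subset fun _ ht => ht.1).isClosed_biUnion
        fun t _ => isClosed_hull t
    convert hc.isOpen_compl.preimage continuous_subtype_val using 1
    ext y
    simp only [U, mem_ofPred_eq, mem_preimage, mem_compl_iff, mem_iUnion, not_exists]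
    exact ⟨fun h s hs hy => hs.2 (h s hs.1 hy), fun h s hs hy => by
      by_contra hx; exact h s ⟨hs, hx⟩ hy⟩
  have hxU : ∀ x, x ∈ U x := fun x s _ h => h
  have hdiff : ∀ x x' y : Ω, y ∈ U x → y ∈ U x' → ∀ s ∈ macroTriangles K,
      ∀ s' ∈ macroTriangles K, (y : Plane) ∈ convexHull ℝ (s : Set Plane) →
      (y : Plane) ∈ convexHull ℝ (s' : Set Plane) → P x s - P x' s = P x s' - P x' s' :=
    fun x x' y hy hy' s hs s' hs' h h' =>
      sub_eq_sub_of_isPotential hΩ hK y.2 hy hy' (hP x) (hP x') hs hs' h h'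
  obtain ⟨C, hC⟩ := exists_glued_function U hU hxU (fun x y => P x (tri y)) (by
    intro x x' y hy hy'
    filter_upwards [(hU y).mem_nhds (hxU y)] with y' hyy'
    exact hdiff x x' y hy hy' _ (htri y') _ (htri y) (hyy' _ (htri y') (hmem y')) (hmem y))
  -- The potential at `y` shifted by the glued constant, evaluated at `s`. The auxiliary triangle
  -- `tri y` cancels, and `q s` is locally constant on the connected set of points of Ω in `s`.
  let q : Finset Plane → Ω → DiscreteReal := fun s y => ⟨C y + P y s - P y (tri y)⟩
  have hq : ∀ s ∈ macroTriangles K,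
      ContinuousOn (q s) {y : Ω | (y : Plane) ∈ convexHull ℝ (s : Set Plane)} := by
    intro s hs x hx
    refine ContinuousWithinAt.congr_of_eventuallyEq
      (continuousWithinAt_const (b := q s x)) ?_ rfl
    rw [EventuallyEq, eventually_nhdsWithin_iff]
    filter_upwards [hC x, (hU x).mem_nhds (hxU x)] with y h1 h2 hy
    have h3 := hdiff y x y (hxU y) h2 s hs (tri y) (htri y) hy (hmem y)
    simp only [q, DiscreteReal.mk.injEq]
    linarith
  have hpre : ∀ s ∈ macroTriangles K,
      IsPreconnected {y : Ω | (y : Plane) ∈ convexHull ℝ (s : Set Plane)} := by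
    intro s hs
    rw [← Topology.IsInducing.subtypeVal.isPreconnected_image]
    convert isPreconnected_hull_inter hΩ hK hs using 1
    ext y
    simp [and_comm]
  -- Evaluation at the incenter is a mere choice: for two triangles with a common edge it may be
  -- moved to the midpoint of that edge, where the jumps of the local potential are known.
  refine ⟨fun s => if h : s ∈ macroTriangles K then (q s ⟨cen s, cen_mem_domain hΩ hK h⟩).val
    else 0, fun s s' a b h h' hne => ?_⟩
  let y : Ω := ⟨midpoint ℝ a b, openSegment_subset_interior hΩ hK h.tri h'.tri hne h.ne h.left
    h.right h'.left h'.right (midpoint_mem_openSegment a b)⟩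
  have hy : (y : Plane) ∈ convexHull ℝ ({a, b} : Set Plane) := by
    rw [convexHull_pair]; exact midpoint_mem_segment a b
  have hcen : ∀ r (hr : IsFlag K r a b), q r ⟨cen r, cen_mem_domain hΩ hK hr.tri⟩ = q r y :=
    fun r hr => (hpre r hr.tri).constant (hq r hr.tri) (cen_mem_hull hr.tri) (hr.mem_hull hy)
  simp only [dif_pos h.tri, dif_pos h'.tri]
  rw [hcen s h, hcen s' h', ← hP y s s' a b h h' hne hy]
  simp only [q]
  ring

end domain

section domain
variable (hΩ : IsPolygonalDomain Ω) (hK : IsTriangulation K Ω)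
include hΩ hK

lemma mem_interiorEdges_of_mem {e : Finset Plane} (he : e ∈ macroEdges K) {y : Plane} (hy : y ∈ Ω)
    (hye : y ∈ convexHull ℝ (e : Set Plane)) : e ∈ interiorEdges K Ω :=
  (mem_interiorEdges_iff hΩ hK he).2 (exists_two_triangles hK hΩ he hy hye)

lemma mem_interiorVertices_iff {v : Plane} :
    v ∈ interiorVertices K Ω ↔ v ∈ Ω ∧ ∃ s ∈ macroTriangles K, v ∈ s := by
  constructor
  · rintro ⟨hv, hfr⟩
    have hv' : ({v} : Finset Plane) ∈ K.faces := hv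
    obtain ⟨s, hs, hvs⟩ := exists_triangle_superset hΩ hK hv'
    rw [frontier_eq hΩ] at hfr
    have : v ∈ closure Ω := hull_subset_closure hK hv' (by simp)
    exact ⟨by_contra fun h => hfr ⟨this, h⟩, s, hs, by simpa using hvs⟩
  · rintro ⟨hv, s, hs, hvs⟩
    refine ⟨K.down_closed hs.1 (by simpa using hvs) (by simp), ?_⟩
    rw [frontier_eq hΩ]
    exact fun h => h.2 hv

omit hΩ in
lemma finite_interiorEdges : (interiorEdges K Ω).Finite :=
  hK.finite_macroEdges.subset fun _ h => h.1

lemma finite_interiorVertices : (interiorVertices K Ω).Finite := by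
  refine (hK.finite_macroTriangles.biUnion fun t _ => t.finite_toSet).subset (fun v hv => ?_)
  obtain ⟨-, s, hs, hvs⟩ := (mem_interiorVertices_iff hΩ hK).1 hv
  exact mem_biUnion hs hvs

/-- A function on the vertices that vanishes on the boundary and is constant along interior edges
vanishes. -/
lemma eq_zero_of_eq_along_edges (A : Plane → ℝ)
    (hA : ∀ v ∉ interiorVertices K Ω, A v = 0)
    (hedge : ∀ v w, v ∈ Ω → v ≠ w → {v, w} ∈ macroEdges K → A v = A w) : A = 0 := by
  by_contra hne
  obtain ⟨v₀, hv₀⟩ := Function.ne_iff.1 hne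
  have hfin := finite_interiorVertices hΩ hK
  have memV : ∀ v, A v = A v₀ → v ∈ interiorVertices K Ω := fun v hv => by
    by_contra h
    exact hv₀ (hv.symm.trans (hA v h))
  -- Among the vertices with the nonzero value `A v₀`, all of them interior, take one that is
  -- furthest to the right. A triangle at `v` that contains points to its right must have a vertex
  -- there, and this vertex carries the same value.
  obtain ⟨v, hv, hmax⟩ := (hfin.toFinset.filter fun v => A v = A v₀).exists_max_image
    (fun v => v 0) ⟨v₀, by simpa using memV v₀ rfl⟩
  simp only [Finset.mem_filter, Finite.mem_toFinset] at hv hmax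
  obtain ⟨hvΩ, s₀, hs₀, hvs₀⟩ := (mem_interiorVertices_iff hΩ hK).1 hv.1
  have hcont : Tendsto (fun ε : ℝ => v + ε • EuclideanSpace.single (0 : Fin 2) (1 : ℝ)) (𝓝[>] 0)
      (𝓝 v) := by
    have h1 : Continuous fun ε : ℝ => v + ε • EuclideanSpace.single (0 : Fin 2) (1 : ℝ) := by
      fun_prop
    have h2 := h1.tendsto 0
    rw [zero_smul, add_zero] at h2
    exact h2.mono_left nhdsWithin_le_nhds
  obtain ⟨ε, ⟨hεΩ, hεs⟩, hε⟩ := ((hcont.eventually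
    ((eventually_mem_set.2 (hΩ.isOpen.mem_nhds hvΩ)).and (eventually_mem_hull hK v))).and
      self_mem_nhdsWithin).exists
  obtain ⟨s, hs, hys⟩ : ∃ s ∈ macroTriangles K,
      v + ε • EuclideanSpace.single (0 : Fin 2) (1 : ℝ) ∈ convexHull ℝ (s : Set Plane) := by
    simpa using closure_subset_triangles hΩ hK (subset_closure hεΩ)
  have hvs := mem_of_vertex_mem_hull hs₀.1 hs.1 hvs₀ (hεs s hs hys)
  have hle : convexHull ℝ (s : Set Plane) ⊆ {x : Plane | x 0 ≤ v 0} := by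
    refine convexHull_min (fun u hu => ?_)
      (convex_halfSpace_le (f := fun x : Plane => x 0) ⟨fun _ _ => rfl, fun _ _ => rfl⟩ _)
    by_cases huv : v = u
    · rw [huv]; exact (le_refl (u 0) : u 0 ≤ u 0)
    have hu' := hedge v u hvΩ huv (IsFlag.edge ⟨hs, hvs, hu, huv⟩)
    exact hmax u ⟨memV u (hu'.symm.trans hv.2), hu'.symm.trans hv.2⟩
  have h1 := hle hys
  simp only [mem_ofPred_eq, PiLp.add_apply, PiLp.smul_apply, PiLp.single_apply, if_true,
    smul_eq_mul, mul_one] at h1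
  have : (0 : ℝ) < ε := hε
  linarith

/-- Euler's formula for the triangulation of a simply connected domain. -/
theorem euler_formula (hsc : SimplyConnectedSpace Ω) :
    (macroTriangles K).ncard + (interiorVertices K Ω).ncard = (interiorEdges K Ω).ncard + 1 := by
  have := hK.finite_macroTriangles.fintype
  have := (finite_interiorEdges hK).fintype
  have := (finite_interiorVertices hΩ hK).fintype
  let ext : ∀ S : Set (Finset Plane), (S → ℝ) →ₗ[ℝ] (Finset Plane → ℝ) := fun S =>
    { toFun := fun p s => if h : s ∈ S then p ⟨s, h⟩ else 0
      map_add' := fun p q => by funext s; by_cases h : s ∈ S <;> simp [h]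
      map_smul' := fun c p => by funext s; by_cases h : s ∈ S <;> simp [h] }
  have hext : ∀ S p s, ∀ h : s ∈ S, ext S p s = p ⟨s, h⟩ := fun S p s h => dif_pos h
  let d₀ : (macroTriangles K → ℝ) →ₗ[ℝ] (interiorEdges K Ω → ℝ) :=
    LinearMap.funLeft ℝ ℝ Subtype.val ∘ₗ jump K ∘ₗ ext _
  have hd₀ : ∀ p e, d₀ p e = jump K (ext _ p) e := fun p e => rfl
  let d₁ : (interiorEdges K Ω → ℝ) →ₗ[ℝ] (interiorVertices K Ω → ℝ) :=
    LinearMap.pi fun v => ∑ e : interiorEdges K Ω, inc v e • LinearMap.proj e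
  have hd₁ : ∀ g v, d₁ g v = ∑ e : interiorEdges K Ω, inc v e * g e := fun g v => by simp [d₁]
  have circ : ∀ v ∈ Ω, ∀ F : Finset Plane → ℝ,
      ∑ e ∈ edgesAt hK v, inc v e * F e = ∑ e : interiorEdges K Ω, inc v e * F e := by
    intro v hv F
    rw [Finset.sum_set_coe (f := fun e => inc v e * F e)]
    refine Finset.sum_subset (fun e he => ?_) (fun e he he' => ?_)
    · rw [mem_edgesAt] at he
      exact mem_toFinset.2 (mem_interiorEdges_of_mem hΩ hK he.1 hv (subset_convexHull ℝ _ he.2))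
    · rw [mem_edgesAt] at he'
      rw [mem_toFinset] at he
      rw [inc, if_neg fun h => he' ⟨he.1, h⟩, zero_mul]
  -- Exactness in the middle; the inclusion of the kernel in the range is the only use of simple
  -- connectedness.
  have hker₁ : LinearMap.ker d₁ = LinearMap.range d₀ := by
    apply le_antisymm
    · intro g hg
      obtain ⟨p, hp⟩ := exists_jump_eq hΩ hK hsc (f := ext _ g) (by
        intro v hv
        by_cases hvert : ∃ s ∈ macroTriangles K, v ∈ s
        · have hvV := (mem_interiorVertices_iff hΩ hK).2 ⟨hv, hvert⟩
          have h1 := congrFun (LinearMap.mem_ker.1 hg) ⟨v, hvV⟩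
          rw [hd₁] at h1
          rw [circ v hv]
          refine Eq.trans (Finset.sum_congr rfl fun e _ => ?_) h1
          rw [hext _ _ _ e.2]
        · refine Finset.sum_eq_zero fun e he => ?_
          rw [mem_edgesAt] at he
          obtain ⟨s, hs, hes⟩ := exists_triangle_superset hΩ hK he.1.1
          exact absurd ⟨s, hs, hes he.2⟩ hvert)
      refine ⟨fun s => p s, ?_⟩
      funext ⟨e, he⟩
      obtain ⟨s, hs, s', hs', hne, hes, hes'⟩ := (mem_interiorEdges_iff hΩ hK he.1).1 he
      obtain ⟨a, b, hab, rfl⟩ := Finset.card_eq_two.1 he.1.2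
      simp only [Finset.insert_subset_iff, Finset.singleton_subset_iff] at hes hes'
      have h : IsFlag K s a b := ⟨hs, hes.1, hes.2, hab⟩
      have h' : IsFlag K s' a b := ⟨hs', hes'.1, hes'.2, hab⟩
      have h1 := sub_eq_jump h h' hne (ext (macroTriangles K) fun s => p s)
      rw [hext _ _ _ hs, hext _ _ _ hs', hp s s' a b h h' hne, hext _ _ _ he] at h1
      have h2 := side_mul_self h
      have h3 := inc_mul_self (v := a) (e := {a, b}) (by simp)
      rw [hd₀]
      refine mul_left_cancel₀ (a := side s a b * inc a {a, b}) ?_ h1.symm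
      intro h0
      have h4 : (side s a b * inc a {a, b}) * (side s a b * inc a {a, b}) = 1 := by
        linear_combination (inc a {a, b} * inc a {a, b}) * h2 + h3
      rw [h0] at h4
      norm_num at h4
    · rintro _ ⟨p, rfl⟩
      rw [LinearMap.mem_ker]
      funext ⟨v, hv⟩
      have hvΩ := ((mem_interiorVertices_iff hΩ hK).1 hv).1
      rw [hd₁, Pi.zero_apply, ← sum_inc_jump hΩ hK hvΩ (ext _ p), circ v hvΩ]
      rfl
  have hker₀ : LinearMap.ker d₀ = Submodule.span ℝ {fun _ => (1 : ℝ)} := by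
    apply le_antisymm
    · intro p hp
      obtain ⟨y, hy⟩ := hΩ.isConnected.nonempty
      obtain ⟨s₀, hs₀, -⟩ : ∃ s ∈ macroTriangles K, y ∈ convexHull ℝ (s : Set Plane) := by
        simpa using closure_subset_triangles hΩ hK (subset_closure hy)
      refine Submodule.mem_span_singleton.2 ⟨p ⟨s₀, hs₀⟩, ?_⟩
      funext ⟨s, hs⟩
      simp only [Pi.smul_apply, smul_eq_mul, mul_one]
      rw [← hext _ p s hs, ← hext _ p s₀]
      refine dualConnected hΩ hK _ (fun t t' a b h h' => ?_) s₀ hs₀ s hs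
      by_cases htt : t = t'
      · rw [htt]
      have he := (mem_interiorEdges_iff hΩ hK h.edge).2
        ⟨t, h.tri, t', h'.tri, htt, h.pair_subset, h'.pair_subset⟩
      have := congrFun (LinearMap.mem_ker.1 hp) ⟨{a, b}, he⟩
      rw [hd₀] at this
      simp only [Pi.zero_apply] at this
      rw [← sub_eq_zero, sub_eq_jump h h' htt, this, mul_zero]
    · rw [Submodule.span_singleton_le_iff_mem, LinearMap.mem_ker]
      funext ⟨e, he⟩
      obtain ⟨s, hs, s', hs', hne, hes, hes'⟩ := (mem_interiorEdges_iff hΩ hK he.1).1 he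
      obtain ⟨a, b, hab, rfl⟩ := Finset.card_eq_two.1 he.1.2
      simp only [Finset.insert_subset_iff, Finset.singleton_subset_iff] at hes hes'
      have h : IsFlag K s a b := ⟨hs, hes.1, hes.2, hab⟩
      have h' : IsFlag K s' a b := ⟨hs', hes'.1, hes'.2, hab⟩
      have h1 := sub_eq_jump h h' hne (ext (macroTriangles K) fun s => 1)
      rw [hext _ _ _ hs, hext _ _ _ hs', sub_self] at h1
      have h2 := side_mul_self h
      have h3 := inc_mul_self (v := a) (e := {a, b}) (by simp)
      rw [hd₀, Pi.zero_apply]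
      rcases mul_eq_zero.1 h1.symm with h4 | h4
      · rcases mul_eq_zero.1 h4 with h5 | h5
        · rw [h5] at h2; norm_num at h2
        · rw [h5] at h3; norm_num at h3
      · exact h4
  have hrange₁ : LinearMap.range d₁ = ⊤ := by
    by_contra hlt
    obtain ⟨φ, hφ, hφ0⟩ := Submodule.exists_dual_map_eq_bot_of_lt_top
      (lt_top_iff_ne_top.2 hlt) inferInstance
    -- A functional that kills the range of `d₁`, read as a function on the vertices that is zero
    -- off the interior ones. Testing it on a single edge shows that it takes equal values at the
    -- endpoints.
    let A : Plane → ℝ := fun v => if h : v ∈ interiorVertices K Ω then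
      φ (Pi.single ⟨v, h⟩ 1) else 0
    have hA0 : A = 0 := by
      refine eq_zero_of_eq_along_edges hΩ hK A (fun v hv => dif_neg hv) (fun v w hv hvw he => ?_)
      have heI := mem_interiorEdges_of_mem hΩ hK he hv (subset_convexHull ℝ _ (by simp))
      have h1 : φ (d₁ (Pi.single ⟨_, heI⟩ 1)) = 0 := by
        have : φ (d₁ (Pi.single ⟨_, heI⟩ 1)) ∈ (LinearMap.range d₁).map φ :=
          Submodule.mem_map_of_mem (LinearMap.mem_range_self _ _)
        rwa [hφ0, Submodule.mem_bot] at this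
      rw [LinearMap.pi_apply_eq_sum_univ] at h1
      have h2 : ∑ u : interiorVertices K Ω, A u * inc u {v, w} = 0 := by
        rw [← h1]
        refine Finset.sum_congr rfl fun u _ => ?_
        rw [hd₁]
        simp only [A, dif_pos u.2, Pi.single_apply, mul_ite, mul_one, mul_zero,
          Finset.sum_ite_eq', Finset.mem_univ, if_true, smul_eq_mul]
        rw [mul_comm]
        congr 2
        funext j
        simp [Pi.single_apply, eq_comm]
      have h3 : ∑ u ∈ (interiorVertices K Ω).toFinset ∪ {v, w}, A u * inc u {v, w} = 0 := by
        rw [← Finset.sum_subset (Finset.subset_union_left), ← h2]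
        · exact (Finset.sum_set_coe (f := fun u => A u * inc u {v, w}) _).symm
        · intro u _ hu
          rw [mem_toFinset] at hu
          simp [A, hu]
      rw [← Finset.sum_subset (Finset.subset_union_right), Finset.sum_pair hvw, inc_right hvw] at h3
      · have h4 : (A v - A w) * inc v {v, w} = 0 := by linarith
        rcases mul_eq_zero.1 h4 with h5 | h5
        · linarith
        · have h6 := inc_mul_self (v := v) (e := {v, w}) (by simp)
          rw [h5] at h6
          norm_num at h6
      · intro u _ hu
        simp [inc, hu]
    refine hφ (LinearMap.ext fun x => ?_)
    rw [LinearMap.pi_apply_eq_sum_univ]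
    refine Finset.sum_eq_zero fun u _ => smul_eq_zero_of_right _ ?_
    have := congrFun hA0 u
    simp only [A, dif_pos u.2, Pi.zero_apply] at this
    refine Eq.trans ?_ this
    congr 1
    funext j
    simp [Pi.single_apply, eq_comm]
  have h0 := LinearMap.finrank_range_add_finrank_ker d₀
  have h1 := LinearMap.finrank_range_add_finrank_ker d₁
  have hone : (fun _ : macroTriangles K => (1 : ℝ)) ≠ 0 := by
    obtain ⟨y, hy⟩ := hΩ.isConnected.nonempty
    obtain ⟨s₀, hs₀, -⟩ : ∃ s ∈ macroTriangles K, y ∈ convexHull ℝ (s : Set Plane) := by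
      simpa using closure_subset_triangles hΩ hK (subset_closure hy)
    intro h
    have := congrFun h ⟨s₀, hs₀⟩
    norm_num at this
  rw [hker₀, finrank_span_singleton hone, ← hker₁] at h0
  rw [hrange₁, finrank_top] at h1
  simp only [Module.finrank_fintype_fun_eq_card] at h0 h1
  simp only [← Nat.card_coe_set_eq, Nat.card_eq_fintype_card]
  omega

/-! ### Counting flags -/

omit hΩ in
lemma card_flagSet_eq_six : (flagSet K).ncard = 6 * (macroTriangles K).ncard := by
  rw [ncard_eq_toFinset_card _ hK.finite_flagSet,
    ncard_eq_toFinset_card _ hK.finite_macroTriangles,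
    Finset.card_eq_sum_card_fiberwise (f := Prod.fst) (t := hK.finite_macroTriangles.toFinset)
      (fun i hi => by
        simp only [Finset.mem_coe, Finite.mem_toFinset] at hi ⊢
        exact IsFlag.tri hi)]
  rw [Finset.sum_congr rfl (g := fun _ => 6), Finset.sum_const, smul_eq_mul, mul_comm]
  intro s hs
  rw [Finite.mem_toFinset] at hs
  have h1 : hK.finite_flagSet.toFinset.filter (fun i => i.1 = s) = {s} ×ˢ s.offDiag := by
    ext ⟨t, a, b⟩
    simp only [Finset.mem_filter, Finite.mem_toFinset, Finset.mem_product, Finset.mem_singleton,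
      Finset.mem_offDiag]
    constructor
    · rintro ⟨h, rfl⟩
      exact ⟨rfl, IsFlag.left h, IsFlag.right h, IsFlag.ne h⟩
    · rintro ⟨rfl, h⟩
      exact ⟨⟨hs, h.1, h.2.1, h.2.2⟩, rfl⟩
  rw [h1, Finset.card_product, Finset.card_singleton, Finset.offDiag_card, hs.2]

omit hΩ in
lemma ncard_macroEdges :
    (macroEdges K).ncard = (interiorEdges K Ω).ncard + (exteriorEdges K Ω).ncard := by
  rw [← ncard_union_eq ?_ (finite_interiorEdges hK)
    (hK.finite_macroEdges.subset fun _ h => h.1)]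
  · congr 1
    ext e
    simp only [interiorEdges, exteriorEdges, mem_union, mem_ofPred_eq]
    tauto
  · rw [disjoint_left]
    exact fun e h h' => h.2 h'.2

/-- The triangles that contain an edge. -/
def trianglesOn (hK : IsTriangulation K Ω) (e : Finset Plane) : Finset (Finset Plane) :=
  hK.finite_macroTriangles.toFinset.filter (e ⊆ ·)

lemma card_trianglesOn_interior {e : Finset Plane} (he : e ∈ interiorEdges K Ω) :
    (trianglesOn hK e).card = 2 := by
  obtain ⟨s, hs, s', hs', hne, hes, hes'⟩ := (mem_interiorEdges_iff hΩ hK he.1).1 he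
  rw [Finset.card_eq_two]
  refine ⟨s, s', hne, ?_⟩
  ext t
  simp only [trianglesOn, Finset.mem_filter, Finite.mem_toFinset, Finset.mem_insert,
    Finset.mem_singleton]
  constructor
  · rintro ⟨ht, het⟩
    exact eq_or_eq_of_edge hs hs' ht hne he.1.2 hes hes' het
  · rintro (rfl | rfl)
    · exact ⟨hs, hes⟩
    · exact ⟨hs', hes'⟩

lemma card_trianglesOn_exterior {e : Finset Plane} (he : e ∈ exteriorEdges K Ω) :
    (trianglesOn hK e).card = 1 := by
  obtain ⟨s, hs, hes⟩ := exists_triangle_superset hΩ hK he.1.1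
  have hn := (mem_exteriorEdges_iff he.1).1 he
  rw [mem_interiorEdges_iff hΩ hK he.1] at hn
  rw [Finset.card_eq_one]
  refine ⟨s, ?_⟩
  ext t
  simp only [trianglesOn, Finset.mem_filter, Finite.mem_toFinset, Finset.mem_singleton]
  constructor
  · rintro ⟨ht, het⟩
    by_contra hne
    exact hn ⟨t, ht, s, hs, hne, het, hes⟩
  · rintro rfl
    exact ⟨hs, hes⟩

omit hΩ in
lemma card_flags_on_edge {e : Finset Plane} (he : e ∈ macroEdges K) :
    (hK.finite_flagSet.toFinset.filter fun i => ({i.2.1, i.2.2} : Finset Plane) = e).card =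
      2 * (trianglesOn hK e).card := by
  obtain ⟨a, b, hab, rfl⟩ := Finset.card_eq_two.1 he.2
  have : (hK.finite_flagSet.toFinset.filter fun i => ({i.2.1, i.2.2} : Finset Plane) = {a, b}) =
      trianglesOn hK {a, b} ×ˢ {(a, b), (b, a)} := by
    ext ⟨t, p, q⟩
    simp only [Finset.mem_filter, Finite.mem_toFinset, Finset.mem_product, trianglesOn,
      Finset.mem_insert, Finset.mem_singleton, Prod.mk.injEq]
    constructor
    · rintro ⟨h, hpq⟩
      have h' : IsFlag K t p q := h
      exact ⟨⟨h'.tri, hpq ▸ h'.pair_subset⟩, flag_edge_cases hpq⟩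
    · rintro ⟨⟨ht, hsub⟩, h⟩
      simp only [Finset.insert_subset_iff, Finset.singleton_subset_iff] at hsub
      rcases h with ⟨rfl, rfl⟩ | ⟨rfl, rfl⟩
      · exact ⟨⟨ht, hsub.1, hsub.2, hab⟩, rfl⟩
      · exact ⟨⟨ht, hsub.2, hsub.1, hab.symm⟩, Finset.pair_comm _ _⟩
  rw [this, Finset.card_product, Finset.card_pair (by simp [hab]), mul_comm]

/-- Each triangle on an edge contributes two flags, and there are two triangles on an interior edge
and one on an exterior edge. With the count by triangles this eliminates the exterior edges. -/
lemma card_flagSet_eq_edges : (flagSet K).ncard =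
    4 * (interiorEdges K Ω).ncard + 2 * (exteriorEdges K Ω).ncard := by
  have hint := finite_interiorEdges hK
  have hext : (exteriorEdges K Ω).Finite := hK.finite_macroEdges.subset fun _ h => h.1
  rw [ncard_eq_toFinset_card _ hK.finite_flagSet, ncard_eq_toFinset_card _ hint,
    ncard_eq_toFinset_card _ hext,
    Finset.card_eq_sum_card_fiberwise (f := fun i => ({i.2.1, i.2.2} : Finset Plane))
      (t := hint.toFinset ∪ hext.toFinset)
      (fun i hi => by
        simp only [Finset.mem_coe, Finite.mem_toFinset, Finset.mem_union] at hi ⊢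
        have := IsFlag.edge hi
        rw [mem_exteriorEdges_iff this]
        tauto),
    Finset.sum_union (Finset.disjoint_left.2 fun e h h' => by
      rw [Finite.mem_toFinset] at h h'
      exact h.2 h'.2)]
  rw [Finset.sum_congr rfl (g := fun _ => 4), Finset.sum_congr (s₁ := hext.toFinset) rfl
    (g := fun _ => 2), Finset.sum_const, Finset.sum_const, smul_eq_mul, smul_eq_mul, mul_comm,
    mul_comm 2]
  · intro e he
    rw [Finite.mem_toFinset] at he
    rw [card_flags_on_edge hK he.1, card_trianglesOn_exterior hΩ hK he]
  · intro e he
    rw [Finite.mem_toFinset] at he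
    rw [card_flags_on_edge hK he.1, card_trianglesOn_interior hΩ hK he]

/-- The dimension of the pressure space in terms of the macro-mesh. -/
lemma card_flagSet_sub (hsc : SimplyConnectedSpace Ω) :
    ((flagSet K).ncard : ℤ) - 1 - (macroEdges K).ncard =
      2 * (macroTriangles K).ncard + 2 * (interiorEdges K Ω).ncard -
        (interiorVertices K Ω).ncard := by
  have h1 := euler_formula hΩ hK hsc
  have h2 := card_flagSet_eq_six hK
  have h3 := card_flagSet_eq_edges hΩ hK
  have h4 := ncard_macroEdges hK
  omega

end domain

/-! ### Lipschitz continuity of nodal fields -/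

/-- A continuous function that is Lipschitz on each of finitely many closed sets that cover the
space is Lipschitz. -/
lemma lipschitzWith_of_closed_cover {E : Type*} [NormedAddCommGroup E] [NormedSpace ℝ E]
    {f : E → ℝ} (hf : Continuous f) {ι : Type*} [Finite ι] {F : ι → Set E}
    (hF : ∀ i, IsClosed (F i)) (hcov : ∀ x, ∃ i, x ∈ F i) {C : ℝ≥0}
    (hC : ∀ i, LipschitzOnWith C f (F i)) : LipschitzWith C f := by
  refine LipschitzWith.of_dist_le_mul fun x y => ?_
  have near : ∀ z : E, ∀ᶠ w in 𝓝 z, ∀ i, w ∈ F i → z ∈ F i := by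
    intro z
    rw [eventually_all]
    intro i
    by_cases h : z ∈ F i
    · exact Eventually.of_forall fun _ _ => h
    · filter_upwards [(hF i).isOpen_compl.mem_nhds h] with w hw hwi using absurd hwi hw
  let γ : ℝ → E := fun t => y + t • (x - y)
  have hγ : Continuous γ := by fun_prop
  have hγd : ∀ s t, dist (γ s) (γ t) = |s - t| * dist x y := by
    intro s t
    simp only [γ, dist_eq_norm, add_sub_add_left_eq_sub, ← sub_smul, norm_smul, Real.norm_eq_abs]
  let S : Set ℝ := {t | dist (f (γ t)) (f (γ 0)) ≤ C * (t * dist x y)}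
  have hS : IsClosed S := isClosed_le (by fun_prop) (by fun_prop)
  -- Continuous induction along the segment. Slightly beyond the parameter `t`, the point lies in a
  -- closed piece that also contains the point at `t`, so the estimate extends.
  have key := IsClosed.Icc_subset_of_forall_exists_gt (a := (0 : ℝ)) (b := 1) (s := S)
    (hS.inter isClosed_Icc) (by simp [S]) (by
      rintro t ⟨ht, -⟩ u hu
      obtain ⟨s, hs, hus⟩ := ((((hγ.tendsto t).mono_left nhdsWithin_le_nhds).eventually
        (near (γ t))).and (Ioc_mem_nhdsGT hu)).exists
      obtain ⟨i, hi⟩ := hcov (γ s)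
      refine ⟨s, ?_, hus⟩
      have h1 := (hC i).dist_le_mul _ hi _ (hs i hi)
      rw [hγd, abs_of_pos (sub_pos.2 hus.1)] at h1
      have h2 : dist (f (γ t)) (f (γ 0)) ≤ C * (t * dist x y) := ht
      change dist (f (γ s)) (f (γ 0)) ≤ C * (s * dist x y)
      linarith [dist_triangle (f (γ s)) (f (γ t)) (f (γ 0))])
  have h1 : dist (f (γ 1)) (f (γ 0)) ≤ C * (1 * dist x y) := key ⟨zero_le_one, le_rfl⟩
  simpa [γ] using h1

lemma lineDeriv_affine (A : Plane →ᵃ[ℝ] Plane) (i : Fin 2) (x w : Plane) :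
    lineDeriv ℝ (fun y => A y i) x w = A.linear w i := by
  have : (fun t : ℝ => A (x + t • w) i) = fun t : ℝ => t * A.linear w i + A x i := by
    funext t
    rw [add_comm x, ← vadd_eq_add, A.map_vadd]
    simp
  rw [lineDeriv, this]
  simp

section domain
variable (hΩ : IsPolygonalDomain Ω) (hK : IsTriangulation K Ω)
include hΩ hK

lemma exists_affine_cell {v : C(closure Ω, Plane)} (hv : v ∈ velocitySpace K Ω) (i : flagSet K) :
    ∃ A : Plane →ᵃ[ℝ] Plane, ∀ x ∈ cellHull K Ω i, extend v x = A x := by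
  obtain ⟨A, hA⟩ := hv (cell K Ω i.1.1 i.1.2.1 i.1.2.2)
    ((mem_psTriangles_iff hΩ hK).2 ⟨_, _, _, i.2, rfl⟩)
  refine ⟨A, fun x hx => ?_⟩
  have hx' := cellHull_subset_closure hΩ hK i hx
  rw [← hA ⟨x, hx'⟩ hx]
  exact extend_apply v ⟨x, hx'⟩

/-- A nodal field is determined by its values at the nodes. -/
lemma finiteDimensional_velocitySpace : FiniteDimensional ℝ (velocitySpace K Ω) := by
  have := hK.finite_flagSet.fintype
  let N : velocitySpace K Ω →ₗ[ℝ] (flagSet K → Plane × Plane × Plane) :=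
    { toFun := fun v i => (extend v.1 (cenOf i), extend v.1 (splOf Ω i), extend v.1 (vertOf i))
      map_add' := fun v w => by funext i; simp [extend_add]
      map_smul' := fun r v => by funext i; simp [extend_smul] }
  refine Module.Finite.of_injective N ?_
  rintro ⟨v, hv⟩ ⟨w, hw⟩ h0
  ext1
  refine ContinuousMap.ext fun x => ?_
  obtain ⟨i, hi⟩ := exists_cellHull hΩ hK x.2
  obtain ⟨A, hA⟩ := exists_affine_cell hΩ hK hv i
  obtain ⟨B, hB⟩ := exists_affine_cell hΩ hK hw i
  obtain ⟨n1, n2, n3⟩ := nodes_mem_cellHull (Ω := Ω) i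
  have h1 : extend v (cenOf i) = extend w (cenOf i) ∧ extend v (splOf Ω i) = extend w (splOf Ω i) ∧
      extend v (vertOf i) = extend w (vertOf i) := by
    have := congrFun h0 i
    simpa [N] using this
  rw [hA _ n1, hA _ n2, hA _ n3, hB _ n1, hB _ n2, hB _ n3] at h1
  obtain ⟨α, β, δ, -, -, -, hsum, hx⟩ := mem_cellHull.1 hi
  rw [← extend_apply v, ← extend_apply w, hA _ hi, hB _ hi, hx, affineMap_comb A hsum,
    affineMap_comb B hsum, h1.1, h1.2.1, h1.2.2]

lemma finiteDimensional_velocitySpaceZero : FiniteDimensional ℝ (velocitySpaceZero K Ω) := by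
  have := finiteDimensional_velocitySpace hΩ hK
  exact Submodule.finiteDimensional_of_le (inf_le_left (a := velocitySpace K Ω))

omit hΩ hK in
lemma continuous_extend {v : C(closure Ω, Plane)} (hΩ : IsOpen Ω) (hv : v ∈ zeroOnBoundary Ω) :
    Continuous (extend v) := by
  rw [← continuousOn_univ, show (univ : Set Plane) = closure Ω ∪ Ωᶜ by
    ext x; simp only [mem_univ, mem_union, mem_compl_iff, true_iff]
    by_cases h : x ∈ Ω
    · exact Or.inl (subset_closure h)
    · exact Or.inr h]
  refine ContinuousOn.union_of_isClosed ?_ ?_ isClosed_closure hΩ.isClosed_compl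
  · rw [continuousOn_iff_continuous_domRestrict]
    convert v.continuous using 1
    funext x
    exact extend_apply v x
  · refine continuousOn_const (c := 0) |>.congr fun x hx => ?_
    by_cases h : x ∈ closure Ω
    · have := hv ⟨x, h⟩ (by rw [hΩ.frontier_eq]; exact ⟨h, hx⟩)
      rw [← this]
      exact extend_apply v ⟨x, h⟩
    · exact dif_neg h

omit hK in
lemma extend_eq_zero {v : C(closure Ω, Plane)} (hv : v ∈ zeroOnBoundary Ω) {x : Plane}
    (hx : x ∉ Ω) : extend v x = 0 := by
  by_cases h : x ∈ closure Ω
  · have := hv ⟨x, h⟩ (by rw [frontier_eq hΩ]; exact ⟨h, hx⟩)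
    rw [← this]
    exact extend_apply v ⟨x, h⟩
  · exact dif_neg h

/-- The plane is covered by the closed cells, where the field is affine, and the complement of Ω,
where its extension vanishes. The sum of the cellwise constants dominates each of them. -/
lemma exists_lipschitzWith {v : C(closure Ω, Plane)} (hv : v ∈ velocitySpaceZero K Ω)
    (i : Fin 2) : ∃ C : ℝ≥0, LipschitzWith C (component v i) := by
  have := hK.finite_flagSet.fintype
  have hA := fun j => exists_affine_cell hΩ hK hv.1 j
  choose A hA using hA
  have hlip : ∀ j : flagSet K, ∃ C : ℝ≥0, LipschitzWith C fun x => A j x i := by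
    intro j
    let L : Plane →L[ℝ] ℝ := (EuclideanSpace.proj i : Plane →L[ℝ] ℝ) ∘L
      LinearMap.toContinuousLinearMap (A j).linear
    refine ⟨‖L‖₊, LipschitzWith.of_dist_le_mul fun x y => ?_⟩
    have h1 : A j x i - A j y i = L (x - y) := by
      have := (A j).linearMap_vsub x y
      simp only [vsub_eq_sub] at this
      simp [L, this]
    rw [Real.dist_eq, h1, dist_eq_norm]
    exact L.le_opNorm _
  choose C hC using hlip
  refine ⟨∑ j, C j, lipschitzWith_of_closed_cover (ι := Option (flagSet K))
    (F := fun o => o.elim Ωᶜ fun j => cellHull K Ω j) ?_ ?_ ?_ ?_⟩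
  · have h1 := continuous_extend hΩ.isOpen hv.2
    have h2 : component v i = fun x => extend v x i := funext fun x => component_eq v i x
    rw [h2]
    fun_prop
  · rintro (_ | j)
    · exact hΩ.isOpen.isClosed_compl
    · exact isClosed_cellHull j
  · intro x
    by_cases h : x ∈ Ω
    · obtain ⟨j, hj⟩ := exists_cellHull hΩ hK (subset_closure h)
      exact ⟨some j, hj⟩
    · exact ⟨none, h⟩
  · rintro (_ | j)
    · refine LipschitzOnWith.of_dist_le_mul fun x hx y hy => ?_
      rw [component_eq, component_eq, extend_eq_zero hΩ hv.2 hx, extend_eq_zero hΩ hv.2 hy,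
        dist_self]
      positivity
    · refine LipschitzOnWith.of_dist_le_mul fun x hx y hy => ?_
      rw [component_eq, component_eq, hA j x hx, hA j y hy]
      exact ((hC j).weaken (Finset.single_le_sum (fun _ _ => zero_le)
        (Finset.mem_univ j))).dist_le_mul x y

end domain

/-! ### The divergence as a weak derivative -/

/-- The interior of a cell. -/
def openCell (Ω : Set Plane) (i : flagSet K) : Set Plane :=
  openTri (cenOf i) (splOf Ω i) (vertOf i)

/-- The divergence of a field on the plane. -/
def divergence (v : C(closure Ω, Plane)) (x : Plane) : ℝ :=
  lineDeriv ℝ (component v 0) x (EuclideanSpace.single 0 1) +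
    lineDeriv ℝ (component v 1) x (EuclideanSpace.single 1 1)

lemma lineDeriv_const_eq_zero (c : ℝ) (x w : Plane) : lineDeriv ℝ (fun _ => c) x w = 0 := by
  simp [lineDeriv]

section domain
variable (hΩ : IsPolygonalDomain Ω) (hK : IsTriangulation K Ω)
include hΩ hK

lemma isOpen_openCell (i : flagSet K) : IsOpen (openCell Ω i) :=
  isOpen_openTri (cellArea_ne_zero' hΩ hK i)

lemma openCell_subset (i : flagSet K) : openCell Ω i ⊆ Ω := openTri_subset_domain hΩ hK i.2

omit hΩ hK in
lemma openCell_subset_cellHull (i : flagSet K) : openCell Ω i ⊆ cellHull K Ω i :=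
  openTri_subset_hull _ _ _

lemma eq_of_mem_openCell {i j : flagSet K} {x : Plane} (hi : x ∈ openCell Ω i)
    (hj : x ∈ cellHull K Ω j) : i = j := by
  obtain ⟨h1, h2, h3⟩ := flag_eq_of_mem_openTri hΩ hK i.2 j.2 hi hj
  exact Subtype.ext (Prod.ext h1 (Prod.ext h2 h3))

lemma ae_mem_openCell : ∀ᵐ x : Plane, x ∈ closure Ω → ∃ i : flagSet K, x ∈ openCell Ω i := by
  have := hK.finite_flagSet.fintype
  have h : ∀ᵐ x : Plane, ∀ i : flagSet K, x ∉ cellHull K Ω i \ openCell Ω i := by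
    rw [ae_all_iff]
    intro i
    exact measure_eq_zero_iff_ae_notMem.1 (volume_hull_diff_openTri _ _ _)
  filter_upwards [h] with x hx hxΩ
  obtain ⟨i, hi⟩ := exists_cellHull hΩ hK hxΩ
  exact ⟨i, by_contra fun hn => hx i ⟨hi, hn⟩⟩

lemma divergence_eq {v : C(closure Ω, Plane)} (hv : v ∈ velocitySpace K Ω) (i : flagSet K)
    {x : Plane} (hx : x ∈ openCell Ω i) : divergence v x = divMap K Ω v i := by
  obtain ⟨A, hA⟩ := exists_affine_cell hΩ hK hv i
  have h1 : ∀ k, component v k =ᶠ[𝓝 x] fun y => A y k := by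
    intro k
    filter_upwards [(isOpen_openCell hΩ hK i).mem_nhds hx] with y hy
    rw [component_eq, hA y (openCell_subset_cellHull i hy)]
  obtain ⟨n1, n2, n3⟩ := nodes_mem_cellHull (Ω := Ω) i
  have hlin : ∀ p q, A p - A q = A.linear (p - q) := fun p q => by
    have := A.linearMap_vsub p q
    simpa only [vsub_eq_sub] using this.symm
  rw [divergence, (h1 0).lineDeriv_eq, (h1 1).lineDeriv_eq, lineDeriv_affine, lineDeriv_affine,
    eq_comm]
  change (cross (extend v (cenOf i) - extend v (splOf Ω i)) (vertOf i - splOf Ω i) +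
    cross (cenOf i - splOf Ω i) (extend v (vertOf i) - extend v (splOf Ω i))) /
      cross (cenOf i - splOf Ω i) (vertOf i - splOf Ω i) = _
  rw [hA _ n1, hA _ n2, hA _ n3, hlin, hlin, trace_identity,
    mul_div_cancel_right₀ _ (cellArea_ne_zero hΩ hK i)]

omit hK in
lemma component_eq_zero {v : C(closure Ω, Plane)} (hv : v ∈ zeroOnBoundary Ω) (k : Fin 2)
    {x : Plane} (hx : x ∉ Ω) : component v k x = 0 := by
  rw [component_eq, extend_eq_zero hΩ hv hx]; rfl

/-- The extension by zero is Lipschitz on the whole plane, where integration by parts against a test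
function is available; outside Ω both integrands vanish. -/
lemma isWeakPartial_lineDeriv {v : C(closure Ω, Plane)} (hv : v ∈ velocitySpaceZero K Ω)
    (k j : Fin 2) : IsWeakPartial Ω j (component v k)
      (fun x => lineDeriv ℝ (component v k) x (EuclideanSpace.single j 1)) := by
  intro φ hφ hc hs
  obtain ⟨C, hC⟩ := exists_lipschitzWith hΩ hK hv k
  obtain ⟨D, hD⟩ := hφ.lipschitzWith_of_hasCompactSupport hc (by simp)
  have h1 := hC.integral_lineDeriv_mul_eq (μ := volume) hD hc (EuclideanSpace.single j 1)
  rw [setIntegral_eq_integral_of_forall_compl_eq_zero, setIntegral_eq_integral_of_forall_compl_eq_zero,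
    h1, ← integral_neg]
  · refine integral_congr_ae (Eventually.of_forall fun x => ?_)
    simp only
    rw [(hφ.differentiable (by simp)).differentiableAt.lineDeriv_eq_fderiv, map_neg]
    ring
  · intro x hx
    rw [image_eq_zero_of_notMem_tsupport fun h => hx (hs h), mul_zero]
  · intro x hx
    rw [component_eq_zero hΩ hv.2 k hx, zero_mul]

lemma memLp_lineDeriv {v : C(closure Ω, Plane)} (hv : v ∈ velocitySpaceZero K Ω) (k j : Fin 2) :
    MemLp (fun x => lineDeriv ℝ (component v k) x (EuclideanSpace.single j 1)) 2
      (volume.restrict Ω) := by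
  obtain ⟨C, hC⟩ := exists_lipschitzWith hΩ hK hv k
  have : IsFiniteMeasure (volume.restrict Ω : Measure Plane) :=
    isFiniteMeasure_restrict.2 hΩ.isBounded.measure_lt_top.ne
  exact (hC.memLp_lineDeriv (μ := volume.restrict Ω) _).mono_exponent le_top

omit hK in
lemma hasCompactSupport_component {v : C(closure Ω, Plane)} (hv : v ∈ zeroOnBoundary Ω)
    (k : Fin 2) : HasCompactSupport (component v k) :=
  HasCompactSupport.intro hΩ.isBounded.isCompact_closure fun _ hx =>
    component_eq_zero hΩ hv k fun h => hx (subset_closure h)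

lemma memLp_component {v : C(closure Ω, Plane)} (hv : v ∈ velocitySpaceZero K Ω) (k : Fin 2) :
    MemLp (component v k) 2 (volume.restrict Ω) := by
  obtain ⟨C, hC⟩ := exists_lipschitzWith hΩ hK hv k
  exact hC.continuous.memLp_of_hasCompactSupport (hasCompactSupport_component hΩ hv.2 k)

lemma integral_divergence_mul {v : C(closure Ω, Plane)} (hv : v ∈ velocitySpaceZero K Ω)
    (i : flagSet K) {φ : Plane → ℝ} (hs : tsupport φ ⊆ openCell Ω i) :
    ∫ x in Ω, divergence v x * φ x = divMap K Ω v i * ∫ x in Ω, φ x := by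
  rw [← integral_const_mul]
  refine integral_congr_ae (Eventually.of_forall fun x => ?_)
  by_cases hx : x ∈ tsupport φ
  · simp only [divergence_eq hΩ hK hv.1 i (hs hx)]
  · simp only [image_eq_zero_of_notMem_tsupport hx, mul_zero]

/-- A field in `X_h⁰` is solenoidal if and only if its divergence vanishes on every cell. -/
lemma mem_solenoidal_iff {v : C(closure Ω, Plane)} (hv : v ∈ velocitySpaceZero K Ω) :
    v ∈ solenoidal Ω ↔ divMap K Ω v = 0 := by
  constructor
  · rintro ⟨-, G, hG, hG0⟩
    funext i
    obtain ⟨x, hx⟩ : (openCell Ω i).Nonempty := openTri_nonempty _ _ _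
    obtain ⟨r, hr, hball⟩ := Metric.nhds_basis_closedBall.mem_iff.1
      ((isOpen_openCell hΩ hK i).mem_nhds hx)
    -- A test function supported in one cell. There the divergence is constant, so testing the weak
    -- equation shows that this constant times a positive integral is zero.
    let φ : ContDiffBump x := ⟨r / 2, r, half_pos hr, half_lt_self hr⟩
    have hφ : ContDiff ℝ ∞ φ := φ.contDiff
    have hts : tsupport φ ⊆ openCell Ω i := by rw [φ.tsupport_eq]; exact hball
    have hsΩ := hts.trans (openCell_subset hΩ hK i)
    have hφ2 : MemLp φ 2 (volume.restrict Ω) :=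
      hφ.continuous.memLp_of_hasCompactSupport φ.hasCompactSupport
    have e1 := integral_add ((hG 0 0).1.integrable_mul hφ2) ((hG 1 1).1.integrable_mul hφ2)
    have e2 := integral_add ((memLp_lineDeriv hΩ hK hv 0 0).integrable_mul hφ2)
      ((memLp_lineDeriv hΩ hK hv 1 1).integrable_mul hφ2)
    simp only [Pi.mul_apply, ← add_mul] at e1 e2
    have e3 := (hG 0 0).2 φ hφ φ.hasCompactSupport hsΩ
    have e4 := (hG 1 1).2 φ hφ φ.hasCompactSupport hsΩ
    have e5 := isWeakPartial_lineDeriv hΩ hK hv 0 0 φ hφ φ.hasCompactSupport hsΩ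
    have e6 := isWeakPartial_lineDeriv hΩ hK hv 1 1 φ hφ φ.hasCompactSupport hsΩ
    have e7 : ∫ x in Ω, (G 0 0 x + G 1 1 x) * φ x = 0 := by
      rw [integral_eq_zero_of_ae]
      filter_upwards [hG0] with y hy
      rw [hy, zero_mul]; rfl
    have e8 := integral_divergence_mul hΩ hK hv i hts
    simp only [divergence] at e8
    have e9 : ∫ x in Ω, φ x = ∫ x, φ x :=
      setIntegral_eq_integral_of_forall_compl_eq_zero fun y hy =>
        image_eq_zero_of_notMem_tsupport fun h => hy (hsΩ h)
    have e10 : 0 < ∫ x, φ x := φ.integral_pos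
    have e11 : divMap K Ω v i * ∫ x, φ x = 0 := by rw [← e9]; linarith
    exact (mul_eq_zero.1 e11).resolve_right e10.ne'
  · intro h0
    refine ⟨memLp_component hΩ hK hv, fun k j x =>
      lineDeriv ℝ (component v k) x (EuclideanSpace.single j 1),
      fun k j => ⟨memLp_lineDeriv hΩ hK hv k j, isWeakPartial_lineDeriv hΩ hK hv k j⟩, ?_⟩
    filter_upwards [ae_restrict_of_ae (ae_mem_openCell hΩ hK),
      ae_restrict_mem hΩ.isOpen.measurableSet] with x hx hxΩ
    obtain ⟨i, hi⟩ := hx (subset_closure hxΩ)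
    have := divergence_eq hΩ hK hv.1 i hi
    rw [h0] at this
    exact this

/-- The integral of the divergence vanishes. -/
lemma sum_divMap_mul_volume [Fintype (flagSet K)] {v : C(closure Ω, Plane)}
    (hv : v ∈ velocitySpaceZero K Ω) :
    ∑ i, divMap K Ω v i * volume.real (openCell Ω i) = 0 := by
  have hint : ∀ k j, Integrable
      (fun x => lineDeriv ℝ (component v k) x (EuclideanSpace.single j 1)) := by
    intro k j
    obtain ⟨C, hC⟩ := exists_lipschitzWith hΩ hK hv k
    have h1 : HasCompactSupport
        (fun x => lineDeriv ℝ (component v k) x (EuclideanSpace.single j 1)) := by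
      refine HasCompactSupport.intro hΩ.isBounded.isCompact_closure fun x hx => ?_
      have : component v k =ᶠ[𝓝 x] fun _ => 0 := by
        filter_upwards [isClosed_closure.isOpen_compl.mem_nhds hx] with y hy
        exact component_eq_zero hΩ hv.2 k fun h => hy (subset_closure h)
      rw [this.lineDeriv_eq, lineDeriv_const_eq_zero]
    exact ((hC.locallyIntegrable_lineDeriv (μ := volume) _).integrableOn_isCompact
      h1).integrable_of_forall_notMem_eq_zero fun x hx =>
        image_eq_zero_of_notMem_tsupport (f := fun x =>
          lineDeriv ℝ (component v k) x (EuclideanSpace.single j 1)) hx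
  have hzero : ∀ k j, ∫ x, lineDeriv ℝ (component v k) x (EuclideanSpace.single j 1) = 0 := by
    intro k j
    obtain ⟨C, hC⟩ := exists_lipschitzWith hΩ hK hv k
    -- Integration by parts against the constant 1 is allowed since the field has compact support.
    have := (LipschitzWith.const' (1 : ℝ) (K := 0)).integral_lineDeriv_mul_eq (μ := volume) hC
      (hasCompactSupport_component hΩ hv.2 k) (-EuclideanSpace.single j 1)
    simpa [lineDeriv_const_eq_zero] using this.symm
  have h1 : ∫ x, divergence v x = 0 := by
    simp only [divergence]
    rw [integral_add (hint 0 0) (hint 1 1), hzero, hzero, add_zero]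
  have h2 : divergence v =ᵐ[volume]
      fun x => ∑ i, (openCell Ω i).indicator (fun _ => divMap K Ω v i) x := by
    filter_upwards [ae_mem_openCell hΩ hK] with x hx
    by_cases hxc : x ∈ closure Ω
    · obtain ⟨i, hi⟩ := hx hxc
      rw [divergence_eq hΩ hK hv.1 i hi, Finset.sum_eq_single i, indicator_of_mem hi]
      · intro j _ hji
        refine indicator_of_notMem (fun hj => hji ?_) _
        exact (eq_of_mem_openCell hΩ hK hi (openCell_subset_cellHull j hj)).symm
      · simp
    · have hk : ∀ k, component v k =ᶠ[𝓝 x] fun _ => 0 := by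
        intro k
        filter_upwards [isClosed_closure.isOpen_compl.mem_nhds hxc] with y hy
        exact component_eq_zero hΩ hv.2 k fun h => hy (subset_closure h)
      rw [divergence, (hk 0).lineDeriv_eq, (hk 1).lineDeriv_eq, lineDeriv_const_eq_zero,
        lineDeriv_const_eq_zero,
        add_zero, eq_comm]
      refine Finset.sum_eq_zero fun j _ => indicator_of_notMem (fun hj => hxc ?_) _
      exact subset_closure (openCell_subset hΩ hK j hj)
  have hfin : ∀ i : flagSet K, volume (openCell Ω i) ≠ ⊤ := fun i =>
    (hΩ.isBounded.subset (openCell_subset hΩ hK i)).measure_lt_top.ne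
  rw [integral_congr_ae h2, integral_finsetSum] at h1
  · rw [← h1]
    refine Finset.sum_congr rfl fun i _ => ?_
    rw [integral_indicator (isOpen_openCell hΩ hK i).measurableSet, setIntegral_const,
      smul_eq_mul, mul_comm]
  · intro i _
    exact (integrable_indicator_iff (isOpen_openCell hΩ hK i).measurableSet).2
      (integrableOn_const (hfin i))

end domain

/-! ### The constraints of the pressure space -/

section domain
variable (hΩ : IsPolygonalDomain Ω) (hK : IsTriangulation K Ω)

/-- An edge belongs to two triangles, or to one triangle and then to the boundary. -/
lemma edge_cases (hΩ : IsPolygonalDomain Ω) (hK : IsTriangulation K Ω) {e : Finset Plane}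
    (he : e ∈ macroEdges K) : ∃ s a b, IsFlag K s a b ∧ e = {a, b} ∧
      ((∃ s', IsFlag K s' a b ∧ s ≠ s') ∨
        (e ∈ exteriorEdges K Ω ∧ ∀ t, IsFlag K t a b → t = s)) := by
  by_cases hi : e ∈ interiorEdges K Ω
  · obtain ⟨s, hs, s', hs', hne, hes, hes'⟩ := (mem_interiorEdges_iff hΩ hK he).1 hi
    obtain ⟨a, b, hab, rfl⟩ := Finset.card_eq_two.1 he.2
    simp only [Finset.insert_subset_iff, Finset.singleton_subset_iff] at hes hes'
    exact ⟨s, a, b, ⟨hs, hes.1, hes.2, hab⟩, rfl, Or.inl ⟨s', ⟨hs', hes'.1, hes'.2, hab⟩, hne⟩⟩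
  · obtain ⟨s, hs, hes⟩ := exists_triangle_superset hΩ hK he.1
    have hi' := hi
    rw [mem_interiorEdges_iff hΩ hK he] at hi'
    obtain ⟨a, b, hab, rfl⟩ := Finset.card_eq_two.1 he.2
    have hes' := hes
    simp only [Finset.insert_subset_iff, Finset.singleton_subset_iff] at hes
    refine ⟨s, a, b, ⟨hs, hes.1, hes.2, hab⟩, rfl, Or.inr
      ⟨(mem_exteriorEdges_iff he).2 hi, fun t ht => ?_⟩⟩
    by_contra hne
    exact hi' ⟨t, ht.tri, s, hs, hne, ht.pair_subset, hes'⟩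

variable [Fintype (flagSet K)]

/-- The flags on an edge. -/
def edgeFlags (K : Geometry.SimplicialComplex ℝ Plane) [Fintype (flagSet K)] (e : Finset Plane) :
    Finset (flagSet K) :=
  Finset.univ.filter fun i => ({i.1.2.1, i.1.2.2} : Finset Plane) = e

lemma mem_edgeFlags {e : Finset Plane} {i : flagSet K} :
    i ∈ edgeFlags K e ↔ ({i.1.2.1, i.1.2.2} : Finset Plane) = e := by simp [edgeFlags]

lemma edgeFlags_interior {s s' : Finset Plane} {a b : Plane} (h : IsFlag K s a b)
    (h' : IsFlag K s' a b) (hne : s ≠ s') :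
    edgeFlags K {a, b} = {h.toFlag, h.symm.toFlag, h'.toFlag, h'.symm.toFlag} := by
  ext ⟨⟨t, p, q⟩, ht⟩
  have ht' : IsFlag K t p q := ht
  simp only [mem_edgeFlags, Finset.mem_insert, Finset.mem_singleton, Subtype.ext_iff, toFlag_coe,
    Prod.mk.injEq]
  constructor
  · intro hpq
    have hts := eq_or_eq_of_edge h.tri h'.tri ht'.tri hne (Finset.card_pair h.ne) h.pair_subset
      h'.pair_subset (hpq ▸ ht'.pair_subset)
    have := flag_edge_cases hpq
    tauto
  · rintro (⟨rfl, rfl, rfl⟩ | ⟨rfl, rfl, rfl⟩ | ⟨rfl, rfl, rfl⟩ | ⟨rfl, rfl, rfl⟩)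
    · rfl
    · exact Finset.pair_comm _ _
    · rfl
    · exact Finset.pair_comm _ _

lemma edgeFlags_exterior {s : Finset Plane} {a b : Plane} (h : IsFlag K s a b)
    (huniq : ∀ t, IsFlag K t a b → t = s) :
    edgeFlags K {a, b} = {h.toFlag, h.symm.toFlag} := by
  ext ⟨⟨t, p, q⟩, ht⟩
  have ht' : IsFlag K t p q := ht
  simp only [mem_edgeFlags, Finset.mem_insert, Finset.mem_singleton, Subtype.ext_iff, toFlag_coe,
    Prod.mk.injEq]
  constructor
  · intro hpq
    rcases flag_edge_cases hpq with ⟨rfl, rfl⟩ | ⟨rfl, rfl⟩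
    · exact Or.inl ⟨huniq t ht', rfl, rfl⟩
    · exact Or.inr ⟨huniq t ht'.symm, rfl, rfl⟩
  · rintro (⟨rfl, rfl, rfl⟩ | ⟨rfl, rfl, rfl⟩)
    · rfl
    · exact Finset.pair_comm _ _

/-- The alternating sum of the values on the cells at the split point of an edge, up to sign. -/
def edgeTheta (Ω : Set Plane) (e : Finset Plane) : (flagSet K → ℝ) →ₗ[ℝ] ℝ :=
  ∑ i ∈ edgeFlags K e, orient Ω i • LinearMap.proj i

lemma edgeTheta_apply (e : Finset Plane) (x : flagSet K → ℝ) :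
    edgeTheta Ω e x = ∑ i ∈ edgeFlags K e, orient Ω i * x i := by
  simp [edgeTheta]

include hΩ hK

lemma edgeTheta_interior {s s' : Finset Plane} {a b : Plane} (h : IsFlag K s a b)
    (h' : IsFlag K s' a b) (hne : s ≠ s') (x : flagSet K → ℝ) :
    edgeTheta Ω {a, b} x = orient Ω h.toFlag *
      (x h.toFlag - x h.symm.toFlag - x h'.toFlag + x h'.symm.toFlag) := by
  rw [edgeTheta_apply, edgeFlags_interior h h' hne, Finset.sum_insert, Finset.sum_insert,
    Finset.sum_pair]
  · have h1 := orient_swap hΩ hK h.toFlag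
    have h2 := orient_swap hΩ hK h'.toFlag
    rw [swapFlag_toFlag] at h1 h2
    rw [h1, h2, orient_opposite hΩ hK h h' hne]
    ring
  all_goals simp [toFlag_eq_iff, hne, h.ne, h.ne.symm]

lemma edgeTheta_exterior {s : Finset Plane} {a b : Plane} (h : IsFlag K s a b)
    (huniq : ∀ t, IsFlag K t a b → t = s) (x : flagSet K → ℝ) :
    edgeTheta Ω {a, b} x = orient Ω h.toFlag * (x h.toFlag - x h.symm.toFlag) := by
  rw [edgeTheta_apply, edgeFlags_exterior h huniq, Finset.sum_pair]
  · have h1 := orient_swap hΩ hK h.toFlag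
    rw [swapFlag_toFlag] at h1
    rw [h1]
    ring
  · simp [toFlag_eq_iff, h.ne]

omit hΩ hK [Fintype (flagSet K)] in
lemma exists_sub_eq_smul {a b z : Plane} (hz : z ∈ openSegment ℝ a b) :
    ∃ r : ℝ, r < 0 ∧ b - z = r • (a - z) := by
  obtain ⟨α, β, hα, hβ, hsum, rfl⟩ := hz
  refine ⟨-(α / β), by simpa using div_pos hα hβ, ?_⟩
  have hβ' : α = 1 - β := by linarith
  subst hβ'
  ext k
  simp only [PiLp.sub_apply, PiLp.add_apply, PiLp.smul_apply, smul_eq_mul]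
  field_simp
  ring

omit hΩ hK [Fintype (flagSet K)] in
lemma divMap_toFlag {s : Finset Plane} {a b z : Plane} (h : IsFlag K s a b)
    (hz : z = spl K Ω {a, b}) (v : C(closure Ω, Plane)) :
    divMap K Ω v h.toFlag = (cross (extend v (cen s) - extend v z) (a - z) +
      cross (cen s - z) (extend v a - extend v z)) / cross (cen s - z) (a - z) := by
  subst hz; rfl

/-- The divergence of a field in `X_h⁰` satisfies the constraint at every split point. -/
lemma edgeTheta_divMap {v : C(closure Ω, Plane)} (hv : v ∈ velocitySpaceZero K Ω)
    {e : Finset Plane} (he : e ∈ macroEdges K) : edgeTheta Ω e (divMap K Ω v) = 0 := by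
  obtain ⟨s, a, b, h, rfl, ⟨s', h', hne⟩ | ⟨hext, huniq⟩⟩ := edge_cases hΩ hK he
  · rw [edgeTheta_interior hΩ hK h h' hne]
    set z := spl K Ω {a, b} with hz
    have hz' : z = spl K Ω {b, a} := by rw [hz, Finset.pair_comm]
    obtain ⟨β, hβ, hb⟩ := exists_sub_eq_smul (spl_mem_openSegment hΩ hK h.ne h.edge)
    obtain ⟨μ, hμ, hc⟩ := exists_sub_eq_smul
      (spl_mem_openSegment_cen hΩ hK h.tri h'.tri hne h.edge h.pair_subset h'.pair_subset)
    rw [← hz] at hb hc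
    have hA : cross (cen s - z) (a - z) ≠ 0 := h.area_ne_zero hΩ hK
    rw [divMap_toFlag h hz, divMap_toFlag h.symm hz', divMap_toFlag h' hz,
      divMap_toFlag h'.symm hz', hb, hc]
    generalize extend v (cen s) - extend v z = V1
    generalize extend v (cen s') - extend v z = V2
    generalize extend v a - extend v z = V3
    generalize extend v b - extend v z = V4
    generalize cen s - z = w at *
    generalize a - z = u at *
    have hβ' := hβ.ne
    have hμ' := hμ.ne
    have sr : ∀ (r : ℝ) (x y : Plane), cross x (r • y) = r * cross x y := fun r x y => by
      simp only [cross, PiLp.smul_apply, smul_eq_mul]; ring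
    have sl : ∀ (r : ℝ) (x y : Plane), cross (r • x) y = r * cross x y := fun r x y => by
      simp only [cross, PiLp.smul_apply, smul_eq_mul]; ring
    -- The factors `β` and `μ` cancel in each quotient, so the divergence on a cell is a term of its
    -- incenter plus a term of its macro-vertex. The alternating sum over the four combinations
    -- vanishes.
    simp only [sr, sl]
    refine mul_eq_zero_of_right _ ?_
    field_simp
    ring
  · rw [edgeTheta_exterior hΩ hK h huniq]
    set z := spl K Ω {a, b} with hz
    have hz' : z = spl K Ω {b, a} := by rw [hz, Finset.pair_comm]
    have hzs := spl_mem_openSegment hΩ hK h.ne h.edge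
    obtain ⟨β, hβ, hb⟩ := exists_sub_eq_smul hzs
    rw [← hz] at hb hzs
    have hA : cross (cen s - z) (a - z) ≠ 0 := h.area_ne_zero hΩ hK
    -- The field vanishes along an exterior edge. Only the term of the incenter is left, and it is
    -- the same on both cells.
    have hzero : ∀ x ∈ segment ℝ a b, extend v x = 0 := by
      intro x hx
      refine extend_eq_zero hΩ hv.2 fun hxΩ => ?_
      have := hext.2 (by simpa [convexHull_pair] using hx)
      rw [frontier_eq hΩ] at this
      exact this.2 hxΩ
    rw [divMap_toFlag h hz, divMap_toFlag h.symm hz', hb,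
      hzero z (openSegment_subset_segment _ _ _ hzs), hzero a (left_mem_segment _ _ _),
      hzero b (right_mem_segment _ _ _)]
    generalize extend v (cen s) - 0 = V1
    generalize cen s - z = w at *
    generalize a - z = u at *
    have hβ' := hβ.ne
    have sr : ∀ (r : ℝ) (x y : Plane), cross x (r • y) = r * cross x y := fun r x y => by
      simp only [cross, PiLp.smul_apply, smul_eq_mul]; ring
    have s0 : ∀ x : Plane, cross x (0 - 0) = 0 := fun x => by simp [cross]
    simp only [sr, s0]
    refine mul_eq_zero_of_right _ ?_
    field_simp
    ring

/-- The constraints of the pressure space. -/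
def constraints (Ω : Set Plane) : (flagSet K → ℝ) →ₗ[ℝ] (macroEdges K → ℝ) × ℝ :=
  (LinearMap.pi fun e : macroEdges K => edgeTheta Ω e.1).prod
    (∑ i : flagSet K, volume.real (openCell Ω i) • LinearMap.proj i)

omit hΩ hK in
lemma mem_ker_constraints {x : flagSet K → ℝ} : x ∈ LinearMap.ker (constraints (K := K) Ω) ↔
    (∀ e ∈ macroEdges K, edgeTheta Ω e x = 0) ∧ ∑ i, x i * volume.real (openCell Ω i) = 0 := by
  rw [LinearMap.mem_ker, Prod.ext_iff, funext_iff, Subtype.forall]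
  simp [constraints, mul_comm]

/-- Interchanging the endpoints of the edge pairs the cells with opposite orientations. So constants
can be used to adjust the integral without affecting the edges. -/
lemma edgeTheta_one (e : Finset Plane) : edgeTheta (K := K) Ω e (fun _ => 1) = 0 := by
  rw [edgeTheta_apply]
  refine Finset.sum_involution (fun i _ => swapFlag i) ?_ ?_ ?_ ?_
  · intro i _
    rw [orient_swap hΩ hK]
    ring
  · intro i _ _ h
    exact (IsFlag.ne i.2) (Prod.mk.inj (Prod.mk.inj (Subtype.ext_iff.1 h)).2).2
  · intro i hi
    rw [mem_edgeFlags] at hi ⊢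
    rw [← hi]
    exact Finset.pair_comm _ _
  · intro i _
    rfl

omit [Fintype (flagSet K)] in
lemma volume_openCell_pos (i : flagSet K) : 0 < volume.real (openCell Ω i) := by
  refine ENNReal.toReal_pos ?_
    (hΩ.isBounded.subset (openCell_subset hΩ hK i)).measure_lt_top.ne
  exact (volume_openTri_pos (cellArea_ne_zero' hΩ hK i)).ne'

omit [Fintype (flagSet K)] in
lemma nonempty_flagSet : Nonempty (flagSet K) := by
  obtain ⟨y, hy⟩ := hΩ.isConnected.nonempty
  obtain ⟨i, -⟩ := exists_cellHull hΩ hK (subset_closure hy)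
  exact ⟨i⟩

lemma constraints_surjective : Function.Surjective (constraints (K := K) Ω) := by
  rintro ⟨y, c⟩
  let Y : Finset Plane → ℝ := fun e => if h : e ∈ macroEdges K then y ⟨e, h⟩ else 0
  -- Different edges involve disjoint sets of cells. The prescribed value of an edge is distributed
  -- evenly over its cells, with signs that match those of the constraint.
  let x₀ : flagSet K → ℝ := fun i =>
    Y {i.1.2.1, i.1.2.2} / (edgeFlags K {i.1.2.1, i.1.2.2}).card * orient Ω i
  have h₀ : ∀ e ∈ macroEdges K, edgeTheta Ω e x₀ = Y e := by
    intro e he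
    rw [edgeTheta_apply]
    have h1 : ∀ i ∈ edgeFlags K e, orient Ω i * x₀ i = Y e / (edgeFlags K e).card := by
      intro i hi
      rw [mem_edgeFlags] at hi
      simp only [x₀, hi]
      linear_combination (Y e / (edgeFlags K e).card) * orient_mul_self hΩ hK i
    rw [Finset.sum_congr rfl h1, Finset.sum_const, nsmul_eq_mul, mul_div_cancel₀]
    obtain ⟨s, a, b, h, rfl, -⟩ := edge_cases hΩ hK he
    have : h.toFlag ∈ edgeFlags K {a, b} := mem_edgeFlags.2 rfl
    exact_mod_cast (Finset.card_pos.2 ⟨_, this⟩).ne'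
  have hvol : 0 < ∑ i : flagSet K, volume.real (openCell Ω i) :=
    Finset.sum_pos (fun i _ => volume_openCell_pos hΩ hK i)
      (Finset.univ_nonempty_iff.2 (nonempty_flagSet hΩ hK))
  let t : ℝ := (c - ∑ i, volume.real (openCell Ω i) * x₀ i) / ∑ i : flagSet K, volume.real (openCell Ω i)
  refine ⟨x₀ + t • fun _ => 1, Prod.ext ?_ ?_⟩
  · funext e
    change edgeTheta Ω e.1 (x₀ + t • fun _ => 1) = y e
    rw [map_add, map_smul, edgeTheta_one hΩ hK, smul_zero, add_zero, h₀ e e.2]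
    exact dif_pos e.2
  · have : (constraints (K := K) Ω (x₀ + t • fun _ => 1)).2 =
        ∑ i, volume.real (openCell Ω i) * (x₀ i + t * 1) := by
      simp [constraints]
    rw [this]
    simp only [mul_one, mul_add, Finset.sum_add_distrib, ← Finset.sum_mul]
    simp only [t]
    field_simp
    ring

lemma finrank_ker_constraints [Fintype (macroEdges K)] :
    Module.finrank ℝ (LinearMap.ker (constraints (K := K) Ω)) + (Fintype.card (macroEdges K) + 1) =
      Fintype.card (flagSet K) := by
  have h := LinearMap.finrank_range_add_finrank_ker (constraints (K := K) Ω)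
  rw [LinearMap.range_eq_top.2 (constraints_surjective hΩ hK), finrank_top] at h
  simp only [Module.finrank_prod, Module.finrank_fintype_fun_eq_card, Module.finrank_self] at h
  omega

/-- The divergence maps `X_h⁰` onto the space cut out by the constraints. -/
lemma map_divMap_eq : (velocitySpaceZero K Ω).map (divMap K Ω) =
    LinearMap.ker (constraints (K := K) Ω) := by
  have := hK.finite_macroEdges.fintype
  refine Submodule.eq_of_le_of_finrank_le ?_ ?_
  · rintro _ ⟨v, hv, rfl⟩
    exact mem_ker_constraints.2 ⟨fun e he => edgeTheta_divMap hΩ hK hv he,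
      sum_divMap_mul_volume hΩ hK hv⟩
  · have h1 := le_finrank_range hΩ hK (dualConnected hΩ hK)
    have h2 := finrank_ker_constraints hΩ hK
    omega

end domain

/-! ### Singular vertices -/

lemma cross_eq_zero_of_mem_line {z w x : Plane} (h : x ∈ line[ℝ, z, w]) :
    cross (w - z) (x - z) = 0 := by
  obtain ⟨r, rfl⟩ := mem_affineSpan_pair_iff_exists_lineMap_eq.1 h
  simp only [AffineMap.lineMap_apply, vsub_eq_sub, vadd_eq_add, cross, PiLp.sub_apply,
    PiLp.add_apply, PiLp.smul_apply, smul_eq_mul]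
  ring

lemma line_ne_line {z w x : Plane} (h : cross (w - z) (x - z) ≠ 0) :
    line[ℝ, z, w] ≠ line[ℝ, z, x] := fun heq =>
  h (cross_eq_zero_of_mem_line (heq ▸ right_mem_affineSpan_pair ℝ z x))

lemma line_eq_line {z w x : Plane} {r : ℝ} (hr : r ≠ 0) (h : x - z = r • (w - z)) :
    line[ℝ, z, x] = line[ℝ, z, w] := by
  have hx : x = AffineMap.lineMap z w r := by
    rw [AffineMap.lineMap_apply, vsub_eq_sub, vadd_eq_add, ← h, sub_add_cancel]
  have hw : w = AffineMap.lineMap z x r⁻¹ := by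
    rw [AffineMap.lineMap_apply, vsub_eq_sub, vadd_eq_add, h, smul_smul, inv_mul_cancel₀ hr,
      one_smul, sub_add_cancel]
  apply le_antisymm
  · refine affineSpan_pair_le_of_mem_of_mem (left_mem_affineSpan_pair ℝ _ _) ?_
    rw [hx]
    exact AffineMap.lineMap_mem_affineSpan_pair _ _ _
  · refine affineSpan_pair_le_of_mem_of_mem (left_mem_affineSpan_pair ℝ _ _) ?_
    nth_rw 1 [hw]
    exact AffineMap.lineMap_mem_affineSpan_pair _ _ _

lemma ncard_ne_two {α : Type*} {S : Set α} {x y z : α} (hx : x ∈ S) (hy : y ∈ S) (hz : z ∈ S)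
    (hxy : x ≠ y) (hxz : x ≠ z) (hyz : y ≠ z) : S.ncard ≠ 2 := by
  intro h
  obtain ⟨p, q, -, rfl⟩ := ncard_eq_two.1 h
  simp only [mem_insert_iff, mem_singleton_iff] at hx hy hz
  rcases hx with rfl | rfl <;> rcases hy with rfl | rfl <;> rcases hz with rfl | rfl <;>
    simp at hxy hxz hyz

lemma mem_cell {s : Finset Plane} {a b x : Plane} :
    x ∈ cell K Ω s a b ↔ x = cen s ∨ x = spl K Ω {a, b} ∨ x = a := by
  simp [cell]

section domain
variable (hΩ : IsPolygonalDomain Ω) (hK : IsTriangulation K Ω)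
include hΩ hK

lemma spl_ne_vertex {s : Finset Plane} {a b : Plane} (h : IsFlag K s a b) :
    spl K Ω {a, b} ≠ a := by
  intro heq
  have := h.area_ne_zero hΩ hK
  rw [heq] at this
  simp [cross] at this

lemma spl_ne_cen {s : Finset Plane} {a b : Plane} (h : IsFlag K s a b) :
    spl K Ω {a, b} ≠ cen s := by
  intro heq
  have := h.area_ne_zero hΩ hK
  rw [heq] at this
  simp [cross] at this

lemma mem_psTriangles {s : Finset Plane} {a b : Plane} (h : IsFlag K s a b) :
    cell K Ω s a b ∈ psTriangles K Ω := (mem_psTriangles_iff hΩ hK).2 ⟨s, a, b, h, rfl⟩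

omit hΩ hK in
lemma cen_ne_vertex {s s' : Finset Plane} (hs : s ∈ macroTriangles K)
    (hs' : s' ∈ macroTriangles K) {v : Plane} (hv : v ∈ s') : cen s ≠ v := by
  rintro rfl
  have hvs := mem_of_vertex_mem_hull hs'.1 hs.1 hv (cen_mem_hull hs)
  obtain ⟨b, hb, hbv⟩ := Finset.exists_mem_ne (by rw [hs.2]; norm_num) (cen s)
  obtain ⟨d, -, had, hbd, e⟩ := exists_third hs.2 hvs hb hbv.symm
  have h1 := (coord_vertex hs e hbv.symm had hbd).2.1
  have h2 := (coord_cen hs e hbv.symm had hbd).2.1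
  exact h2.ne' h1

/-- The lines through a split point. -/
lemma spl_mem_singularVertices {e : Finset Plane} (he : e ∈ macroEdges K) :
    spl K Ω e ∈ singularVertices K Ω := by
  obtain ⟨s, a, b, h, rfl, -⟩ := edge_cases hΩ hK he
  refine ⟨⟨_, mem_psTriangles hΩ hK h, mem_cell.2 (Or.inr (Or.inl rfl))⟩, ?_⟩
  set z := spl K Ω {a, b} with hz
  have himage : (fun w : Plane => line[ℝ, z, w]) '' psNeighbors K Ω z =
      {line[ℝ, z, cen s], line[ℝ, z, a]} := by
    ext l
    simp only [mem_image, mem_insert_iff, mem_singleton_iff]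
    constructor
    · rintro ⟨w, ⟨hwz, t, ht, hzt, hwt⟩, rfl⟩
      obtain ⟨s', p, q, h', rfl⟩ := (mem_psTriangles_iff hΩ hK).1 ht
      have hpq := spl_mem_hull_cell hΩ hK h h' (subset_convexHull ℝ _ hzt)
      rcases mem_cell.1 hwt with rfl | rfl | rfl
      · left
        by_cases hss : s = s'
        · rw [hss]
        obtain ⟨r, hr, hc⟩ := exists_sub_eq_smul (spl_mem_openSegment_cen hΩ hK h.tri h'.tri hss
          h.edge h.pair_subset (hpq ▸ h'.pair_subset))
        exact line_eq_line hr.ne hc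
      · exact absurd (by rw [hz, hpq]) hwz
      · right
        rcases flag_edge_cases hpq.symm with ⟨rfl, rfl⟩ | ⟨rfl, rfl⟩
        · rfl
        · obtain ⟨r, hr, hb⟩ := exists_sub_eq_smul (spl_mem_openSegment hΩ hK h.ne h.edge)
          exact line_eq_line hr.ne hb
    · rintro (rfl | rfl)
      · exact ⟨cen s, ⟨(spl_ne_cen hΩ hK h).symm, _, mem_psTriangles hΩ hK h,
          mem_cell.2 (Or.inr (Or.inl rfl)), mem_cell.2 (Or.inl rfl)⟩, rfl⟩
      · exact ⟨a, ⟨(spl_ne_vertex hΩ hK h).symm, _, mem_psTriangles hΩ hK h,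
          mem_cell.2 (Or.inr (Or.inl rfl)), mem_cell.2 (Or.inr (Or.inr rfl))⟩, rfl⟩
  rw [himage, ncard_pair (line_ne_line (h.area_ne_zero hΩ hK))]

/-- Only the split points are singular. -/
lemma exists_eq_spl {z : Plane} (hz : z ∈ singularVertices K Ω) :
    ∃ e ∈ macroEdges K, z = spl K Ω e := by
  obtain ⟨⟨t, ht, hzt⟩, hcard⟩ := hz
  obtain ⟨s, a, b, h, rfl⟩ := (mem_psTriangles_iff hΩ hK).1 ht
  obtain ⟨d, had, hbd, e⟩ := h.third
  obtain ⟨f1, f2, f3⟩ := isFlag_triple h.tri e h.ne had hbd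
  have mem : ∀ {p q w : Plane}, IsFlag K s p q → z ∈ cell K Ω s p q → w ∈ cell K Ω s p q →
      w ≠ z → line[ℝ, z, w] ∈ (fun w : Plane => line[ℝ, z, w]) '' psNeighbors K Ω z :=
    fun hf hz hw hwz => ⟨_, ⟨hwz, _, mem_psTriangles hΩ hK hf, hz, hw⟩, rfl⟩
  rcases mem_cell.1 hzt with rfl | rfl | rfl
  -- At an incenter the lines to the three macro-vertices are already distinct, because the incenter
  -- lies on no side.
  · exfalso
    obtain ⟨h1, h2, h3⟩ := coord_cen h.tri e h.ne had hbd
    obtain ⟨c1, c2, c3⟩ := coord_triple e h.ne had hbd (cen s)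
    rw [c1, bary] at h1
    rw [c2, bary] at h2
    rw [c3, bary] at h3
    have n1 := (div_ne_zero_iff.1 h1.ne').1
    have n2 := (div_ne_zero_iff.1 h2.ne').1
    have n3 := (div_ne_zero_iff.1 h3.ne').1
    exact ncard_ne_two
      (mem f1 (mem_cell.2 (Or.inl rfl)) (mem_cell.2 (Or.inr (Or.inr rfl)))
        (cen_ne_vertex h.tri h.tri h.left).symm)
      (mem f2 (mem_cell.2 (Or.inl rfl)) (mem_cell.2 (Or.inr (Or.inr rfl)))
        (cen_ne_vertex h.tri h.tri h.right).symm)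
      (mem f3 (mem_cell.2 (Or.inl rfl)) (mem_cell.2 (Or.inr (Or.inr rfl)))
        (cen_ne_vertex h.tri h.tri f3.left).symm)
      (line_ne_line n3) (line_ne_line n2).symm (line_ne_line n1) hcard
  · exact ⟨_, h.edge, rfl⟩
  -- At a macro-vertex, the lines to the incenter and to the split points of two sides are distinct.
  · exfalso
    have k1 := h.area_ne_zero hΩ hK
    have k2 := f3.symm.area_ne_zero hΩ hK
    rw [area_rotate] at k1 k2
    obtain ⟨α, β, hα, hβ, hsum, h1⟩ := spl_mem_openSegment hΩ hK h.ne h.edge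
    obtain ⟨α', β', hα', hβ', hsum', h2⟩ := spl_mem_openSegment hΩ hK had f3.symm.edge
    have k3 : cross (spl K Ω {z, b} - z) (spl K Ω {z, d} - z) ≠ 0 := by
      have : cross (spl K Ω {z, b} - z) (spl K Ω {z, d} - z) =
          β * β' * cross (b - z) (d - z) := by
        rw [← h1, ← h2]
        have e1 : α = 1 - β := by linarith
        have e2 : α' = 1 - β' := by linarith
        subst e1 e2
        simp only [cross, PiLp.sub_apply, PiLp.add_apply, PiLp.smul_apply, smul_eq_mul]
        ring
      rw [this]
      exact mul_ne_zero (mul_ne_zero hβ.ne' hβ'.ne') (triple_area h.tri e h.ne had hbd)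
    exact ncard_ne_two
      (mem h (mem_cell.2 (Or.inr (Or.inr rfl))) (mem_cell.2 (Or.inl rfl))
        (cen_ne_vertex h.tri h.tri h.left))
      (mem h (mem_cell.2 (Or.inr (Or.inr rfl))) (mem_cell.2 (Or.inr (Or.inl rfl)))
        (spl_ne_vertex hΩ hK h))
      (mem f3.symm (mem_cell.2 (Or.inr (Or.inr rfl))) (mem_cell.2 (Or.inr (Or.inl rfl)))
        (spl_ne_vertex hΩ hK f3.symm))
      (line_ne_line fun h0 => k1 (by rw [cross_swap, h0, neg_zero]))
      (line_ne_line fun h0 => k2 (by rw [cross_swap, h0, neg_zero])) (line_ne_line k3) hcard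

end domain

/-! ### Local orderings at the split points -/

/-- The set of vertices of a cell. -/
def cellSet (K : Geometry.SimplicialComplex ℝ Plane) (Ω : Set Plane) (i : flagSet K) : Set Plane :=
  {cenOf i, splOf Ω i, vertOf i}

lemma orient_of_pos {i : flagSet K}
    (h : 0 < cross (cenOf i - splOf Ω i) (vertOf i - splOf Ω i)) : orient Ω i = 1 := by
  rw [orient, cellArea, sign_pos h]; rfl

lemma orient_of_neg {i : flagSet K}
    (h : 0 < cross (vertOf i - splOf Ω i) (cenOf i - splOf Ω i)) : orient Ω i = -1 := by
  rw [orient, cellArea, cross_swap, Left.sign_neg, sign_pos h]; rfl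

lemma pos_of_orient {i : flagSet K} (h : orient Ω i = 1) :
    0 < cross (cenOf i - splOf Ω i) (vertOf i - splOf Ω i) := by
  by_contra hle
  rcases (not_lt.1 hle).lt_or_eq with h0 | h0
  · rw [orient, cellArea, sign_neg h0] at h
    norm_num at h
  · rw [orient, cellArea, h0, sign_zero] at h
    norm_num at h

lemma pos_of_orient_neg {i : flagSet K} (h : orient Ω i = -1) :
    0 < cross (vertOf i - splOf Ω i) (cenOf i - splOf Ω i) := by
  rw [cross_swap, neg_pos]
  by_contra hle
  rcases (not_lt.1 hle).lt_or_eq with h0 | h0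
  · rw [orient, cellArea, sign_pos h0] at h
    norm_num at h
  · rw [orient, cellArea, ← h0, sign_zero] at h
    norm_num at h

lemma pair_eq_of_triple_eq {z p q c v : Plane} (h : ({c, z, v} : Set Plane) = {z, p, q})
    (hpq : cross (p - z) (q - z) ≠ 0) : (p = c ∧ q = v) ∨ (p = v ∧ q = c) := by
  have hpz : p ≠ z := by rintro rfl; simp [cross] at hpq
  have hqz : q ≠ z := by rintro rfl; simp [cross] at hpq
  have hne : p ≠ q := by rintro rfl; exact hpq (by simp only [cross]; ring)
  have hp : p ∈ ({c, z, v} : Set Plane) := by rw [h]; simp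
  have hq : q ∈ ({c, z, v} : Set Plane) := by rw [h]; simp
  simp only [mem_insert_iff, mem_singleton_iff] at hp hq
  grind

/-- Consecutive cells at a split point have opposite orientations. -/
lemma orient_of_follows {i j : flagSet K} {z : Plane} (hi : splOf Ω i = z) (hj : splOf Ω j = z)
    (h : Follows z (cellSet K Ω i) (cellSet K Ω j)) : orient Ω j = -orient Ω i := by
  obtain ⟨p, q, r, h1, h2, hpq, hqr⟩ := h
  rw [cellSet, hi] at h1
  rw [cellSet, hj] at h2
  have hij : cenOf j ≠ vertOf i := cen_ne_vertex j.2.tri i.2.tri i.2.left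
  have hji : cenOf i ≠ vertOf j := cen_ne_vertex i.2.tri j.2.tri j.2.left
  rcases pair_eq_of_triple_eq h1 hpq.ne' with ⟨e1, e2⟩ | ⟨e1, e2⟩ <;>
    rcases pair_eq_of_triple_eq h2 hqr.ne' with ⟨e3, e4⟩ | ⟨e3, e4⟩
  · exact absurd (e3.symm.trans e2) hij
  · rw [orient_of_pos (i := i) (by rw [hi, ← e1, ← e2]; exact hpq),
      orient_of_neg (i := j) (by rw [hj, ← e3, ← e4]; exact hqr)]
  · rw [orient_of_neg (i := i) (by rw [hi, ← e1, ← e2]; exact hpq),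
      orient_of_pos (i := j) (by rw [hj, ← e3, ← e4]; exact hqr), neg_neg]
  · exact absurd (e2.symm.trans e3) hji

/-- About the split point, a positive cell is traversed from the incenter to the macro-vertex and a
negative one from the macro-vertex to the incenter. So a positive cell is left through its edge to
the macro-vertex. -/
lemma follows_of_orient_vert {i j : flagSet K} {z : Plane} (hi : splOf Ω i = z)
    (hj : splOf Ω j = z) (hv : vertOf i = vertOf j) (h1 : orient Ω i = 1) (h2 : orient Ω j = -1) :
    Follows z (cellSet K Ω i) (cellSet K Ω j) := by
  have p1 := pos_of_orient h1
  have p2 := pos_of_orient_neg h2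
  rw [hi] at p1
  rw [hj, ← hv] at p2
  refine ⟨cenOf i, vertOf i, cenOf j, ?_, ?_, p1, p2⟩
  · rw [cellSet, hi, insert_comm]
  · rw [cellSet, hj, hv, insert_comm, pair_comm]

lemma follows_of_orient_cen {i j : flagSet K} {z : Plane} (hi : splOf Ω i = z)
    (hj : splOf Ω j = z) (hc : cenOf i = cenOf j) (h1 : orient Ω i = -1) (h2 : orient Ω j = 1) :
    Follows z (cellSet K Ω i) (cellSet K Ω j) := by
  have p1 := pos_of_orient_neg h1
  have p2 := pos_of_orient h2
  rw [hi] at p1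
  rw [hj, ← hc] at p2
  refine ⟨vertOf i, cenOf i, vertOf j, ?_, ?_, p1, p2⟩
  · rw [cellSet, hi, insert_comm, pair_comm]
  · rw [cellSet, hj, hc, insert_comm]

section domain
variable (hΩ : IsPolygonalDomain Ω) (hK : IsTriangulation K Ω)
include hΩ hK

lemma cellSet_injective : Function.Injective (cellSet K Ω) := by
  intro i j hij
  obtain ⟨x, hx⟩ : (openCell Ω i).Nonempty := openTri_nonempty _ _ _
  have h1 := openCell_subset_cellHull i hx
  have h2 : x ∈ cellHull K Ω j := by
    change x ∈ convexHull ℝ (cellSet K Ω i) at h1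
    rw [hij] at h1
    exact h1
  exact eq_of_mem_openCell hΩ hK hx h2

lemma mem_psTriangles_iff_cellSet {t : Set Plane} :
    t ∈ psTriangles K Ω ↔ ∃ i : flagSet K, t = cellSet K Ω i := by
  rw [mem_psTriangles_iff hΩ hK]
  constructor
  · rintro ⟨s, a, b, h, rfl⟩
    exact ⟨h.toFlag, rfl⟩
  · rintro ⟨i, rfl⟩
    exact ⟨_, _, _, i.2, rfl⟩

variable [Fintype (flagSet K)]

lemma cells_at_spl {e : Finset Plane} (he : e ∈ macroEdges K) :
    {t | t ∈ psTriangles K Ω ∧ spl K Ω e ∈ t} = cellSet K Ω '' (edgeFlags K e : Set (flagSet K)) := by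
  obtain ⟨s, a, b, h, rfl, -⟩ := edge_cases hΩ hK he
  ext t
  simp only [mem_ofPred_eq, mem_psTriangles_iff_cellSet hΩ hK, mem_image, Finset.mem_coe,
    mem_edgeFlags]
  constructor
  · rintro ⟨⟨i, rfl⟩, hi⟩
    exact ⟨i, (spl_mem_hull_cell hΩ hK h i.2 (subset_convexHull ℝ _ hi)).symm, rfl⟩
  · rintro ⟨i, hi, rfl⟩
    refine ⟨⟨i, rfl⟩, ?_⟩
    rw [← hi]
    simp [cellSet, splOf]

/-- At a split point, the alternating sum along a local ordering is the constraint of the edge, up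
to sign. -/
lemma theta_eq {e : Finset Plane} (he : e ∈ macroEdges K) {n : ℕ} {T : Fin n → Set Plane}
    (hT : IsLocalOrdering K Ω (spl K Ω e) T) : ∃ ε : ℝ, ε ≠ 0 ∧ ∀ c : Set Plane → ℝ,
      theta T c = ε * edgeTheta Ω e fun i => c (cellSet K Ω i) := by
  have hrange := hT.range_eq
  rw [cells_at_spl hΩ hK he] at hrange
  have hI : ∀ j, ∃ i ∈ edgeFlags K e, cellSet K Ω i = T j := fun j => by
    have : T j ∈ range T := mem_range_self j
    rw [hrange] at this
    exact this
  choose I hIe hIT using hI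
  have hIinj : Function.Injective I := fun j k hjk =>
    hT.injective (by rw [← hIT, ← hIT, hjk])
  have hIimage : Finset.univ.image I = edgeFlags K e := by
    ext i
    simp only [Finset.mem_image, Finset.mem_univ, true_and]
    constructor
    · rintro ⟨j, rfl⟩; exact hIe j
    · intro hi
      have : cellSet K Ω i ∈ range T := by rw [hrange]; exact mem_image_of_mem _ hi
      obtain ⟨j, hj⟩ := this
      exact ⟨j, cellSet_injective hΩ hK ((hIT j).trans hj)⟩
  have hspl : ∀ j, splOf Ω (I j) = spl K Ω e := fun j => by
    have := hIe j
    rw [mem_edgeFlags] at this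
    rw [splOf, this]
  obtain ⟨s, a, b, h, he', -⟩ := edge_cases hΩ hK he
  have hmem : h.toFlag ∈ edgeFlags K e := mem_edgeFlags.2 he'.symm
  have hn : 0 < n := by
    rw [← hIimage, Finset.mem_image] at hmem
    obtain ⟨j, -, -⟩ := hmem
    exact j.pos
  -- Consecutive cells have opposite orientations, so the signs of `theta` are those of `edgeTheta`
  -- up to the orientation of the first cell.
  have halt : ∀ (k : ℕ) (hk : k < n), orient Ω (I ⟨k, hk⟩) = (-1) ^ k * orient Ω (I ⟨0, hn⟩) := by
    intro k
    induction k with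
    | zero => intro hk; simp
    | succ k ih =>
      intro hk
      have hf := hT.follows ⟨k, by omega⟩ ⟨k + 1, hk⟩ rfl
      rw [← hIT, ← hIT] at hf
      rw [orient_of_follows (hspl _) (hspl _) hf, ih, pow_succ]
      ring
  have hone := orient_mul_self hΩ hK (I ⟨0, hn⟩)
  refine ⟨orient Ω (I ⟨0, hn⟩), fun h0 => by rw [h0] at hone; norm_num at hone, fun c => ?_⟩
  rw [edgeTheta_apply, ← hIimage, Finset.sum_image fun j _ k _ hjk => hIinj hjk, theta,
    Finset.mul_sum]
  refine Finset.sum_congr rfl fun j _ => ?_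
  rw [hIT, halt j j.2]
  linear_combination (-((-1) ^ (j : ℕ) * c (T j))) * hone

lemma isLocalOrdering_of_flags {e : Finset Plane} (he : e ∈ macroEdges K) {n : ℕ}
    {I : Fin n → flagSet K} (hI : Function.Injective I)
    (hrange : range I = (edgeFlags K e : Set (flagSet K)))
    (hfol : ∀ i j : Fin n, (j : ℕ) = (i : ℕ) + 1 →
      Follows (spl K Ω e) (cellSet K Ω (I i)) (cellSet K Ω (I j))) :
    IsLocalOrdering K Ω (spl K Ω e) (fun j => cellSet K Ω (I j)) where
  injective := (cellSet_injective hΩ hK).comp hI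
  range_eq := by
    rw [cells_at_spl hΩ hK he, ← hrange, ← range_comp]
    rfl
  follows := hfol

/-- The condition in `pressureSpace` ranges over all local orderings; without the existence of one
it would be vacuous. -/
lemma exists_isLocalOrdering {e : Finset Plane} (he : e ∈ macroEdges K) :
    ∃ (n : ℕ) (T : Fin n → Set Plane), IsLocalOrdering K Ω (spl K Ω e) T := by
  obtain ⟨s, a, b, h, rfl, hcase⟩ := edge_cases hΩ hK he
  have hswap : ∀ {t p q} (hf : IsFlag K t p q),
      orient Ω hf.symm.toFlag = -orient Ω hf.toFlag := fun hf => by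
    have := orient_swap hΩ hK hf.toFlag
    rwa [swapFlag_toFlag] at this
  obtain ⟨a', b', hab, h', ho⟩ : ∃ a' b', ({a, b} : Finset Plane) = {a', b'} ∧
      ∃ hf : IsFlag K s a' b', orient Ω hf.toFlag = 1 := by
    rcases mul_self_eq_one_iff.1 (orient_mul_self hΩ hK h.toFlag) with h1 | h1
    · exact ⟨a, b, rfl, h, h1⟩
    · exact ⟨b, a, Finset.pair_comm _ _, h.symm, by rw [hswap h, h1, neg_neg]⟩
  have hcase' : (∃ s', IsFlag K s' a' b' ∧ s ≠ s') ∨ ∀ t, IsFlag K t a' b' → t = s := by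
    rcases flag_edge_cases hab with ⟨rfl, rfl⟩ | ⟨rfl, rfl⟩
    · rcases hcase with hc | hc
      · exact Or.inl hc
      · exact Or.inr hc.2
    · rcases hcase with ⟨s', hs', hne⟩ | hc
      · exact Or.inl ⟨s', hs'.symm, hne⟩
      · exact Or.inr fun t ht => hc.2 t ht.symm
  rw [hab] at he ⊢
  have hs1 : splOf Ω h'.toFlag = spl K Ω {a', b'} := rfl
  have hs2 : splOf Ω h'.symm.toFlag = spl K Ω {a', b'} := by rw [Finset.pair_comm]; rfl
  have ho2 : orient Ω h'.symm.toFlag = -1 := by rw [hswap h', ho]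
  rcases hcase' with ⟨s', g, hne⟩ | huniq
  · have hs3 : splOf Ω g.toFlag = spl K Ω {a', b'} := rfl
    have hs4 : splOf Ω g.symm.toFlag = spl K Ω {a', b'} := by rw [Finset.pair_comm]; rfl
    have ho3 : orient Ω g.toFlag = -1 := by rw [orient_opposite hΩ hK h' g hne, ho]
    have ho4 : orient Ω g.symm.toFlag = 1 := by rw [hswap g, ho3, neg_neg]
    -- The counter-clockwise turn passes from the incenter of `s` to `a'`, to the incenter of `s'`,
    -- to `b'`, and back.
    refine ⟨4, _, isLocalOrdering_of_flags hΩ hK he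
      (I := ![h'.toFlag, g.toFlag, g.symm.toFlag, h'.symm.toFlag]) ?_ ?_ ?_⟩
    · intro i j hij
      fin_cases i <;> fin_cases j <;>
        simp [toFlag_eq_iff, hne, hne.symm, h'.ne, h'.ne.symm] at hij ⊢
    · rw [edgeFlags_interior h' g hne]
      ext i
      simp only [mem_range, Fin.exists_fin_succ, Finset.coe_insert, Finset.coe_singleton,
        mem_insert_iff, mem_singleton_iff]
      simp
      tauto
    · intro i j hij
      fin_cases i <;> fin_cases j <;> simp at hij
      · exact follows_of_orient_vert hs1 hs3 rfl ho ho3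
      · exact follows_of_orient_cen hs3 hs4 rfl ho3 ho4
      · exact follows_of_orient_vert hs4 hs2 rfl ho4 ho2
  -- At an exterior edge the two cells share only the edge to the incenter, so the turn has to start
  -- at `b'`.
  · refine ⟨2, _, isLocalOrdering_of_flags hΩ hK he
      (I := ![h'.symm.toFlag, h'.toFlag]) ?_ ?_ ?_⟩
    · intro i j hij
      fin_cases i <;> fin_cases j <;>
        simp [toFlag_eq_iff, h'.ne, h'.ne.symm] at hij ⊢
    · rw [edgeFlags_exterior h' huniq]
      ext i
      simp only [mem_range, Fin.exists_fin_succ, Finset.coe_insert, Finset.coe_singleton,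
        mem_insert_iff, mem_singleton_iff]
      simp
      tauto
    · intro i j hij
      fin_cases i <;> fin_cases j <;> simp at hij
      exact follows_of_orient_cen hs2 hs1 rfl ho2 ho

end domain

/-! ### The pressure space in coordinates -/

section domain
variable (hΩ : IsPolygonalDomain Ω) (hK : IsTriangulation K Ω) [Fintype (flagSet K)]

/-- The function with given constant values on the cells. -/
def stepFun (Ω : Set Plane) (x : flagSet K → ℝ) (y : Plane) : ℝ :=
  ∑ i, (openCell Ω i).indicator (fun _ => x i) y

lemma stepFun_add (x x' : flagSet K → ℝ) : stepFun Ω (x + x') = stepFun Ω x + stepFun Ω x' := by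
  funext y
  simp only [stepFun, Pi.add_apply, ← Finset.sum_add_distrib]
  refine Finset.sum_congr rfl fun i _ => ?_
  by_cases h : y ∈ openCell Ω i <;> simp [h]

lemma stepFun_smul (r : ℝ) (x : flagSet K → ℝ) : stepFun Ω (r • x) = r • stepFun Ω x := by
  funext y
  simp only [stepFun, Pi.smul_apply, smul_eq_mul, Finset.mul_sum]
  refine Finset.sum_congr rfl fun i _ => ?_
  by_cases h : y ∈ openCell Ω i <;> simp [h]

omit [Fintype (flagSet K)] in
lemma volume_openCell_ne_top (hΩ : IsPolygonalDomain Ω) (hK : IsTriangulation K Ω)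
    (i : flagSet K) : volume (openCell Ω i) ≠ ⊤ :=
  (hΩ.isBounded.subset (openCell_subset hΩ hK i)).measure_lt_top.ne

include hΩ hK

lemma stepFun_eq {x : flagSet K → ℝ} {i : flagSet K} {y : Plane} (hy : y ∈ openCell Ω i) :
    stepFun Ω x y = x i := by
  rw [stepFun, Finset.sum_eq_single i, indicator_of_mem hy]
  · intro j _ hji
    refine indicator_of_notMem (fun hj => hji ?_) _
    exact (eq_of_mem_openCell hΩ hK hy (openCell_subset_cellHull j hj)).symm
  · simp

lemma memLp_stepFun (x : flagSet K → ℝ) : MemLp (stepFun Ω x) 2 (volume.restrict Ω) := by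
  have h := memLp_finsetSum' (p := 2) (μ := volume.restrict Ω) Finset.univ
    (f := fun i : flagSet K => (openCell Ω i).indicator fun _ => x i) fun i _ =>
      (memLp_indicator_const 2 (isOpen_openCell hΩ hK i).measurableSet (x i)
        (Or.inr (volume_openCell_ne_top hΩ hK i))).restrict Ω
  convert h using 1
  funext y
  simp [stepFun]

lemma integral_stepFun (x : flagSet K → ℝ) :
    ∫ y in Ω, stepFun Ω x y = ∑ i, x i * volume.real (openCell Ω i) := by
  simp only [stepFun]
  rw [integral_finsetSum]
  · refine Finset.sum_congr rfl fun i _ => ?_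
    rw [integral_indicator (isOpen_openCell hΩ hK i).measurableSet, setIntegral_const,
      smul_eq_mul, mul_comm, measureReal_restrict_apply (isOpen_openCell hΩ hK i).measurableSet,
      inter_eq_left.2 (openCell_subset hΩ hK i)]
  · intro i _
    exact ((integrable_indicator_iff (isOpen_openCell hΩ hK i).measurableSet).2
      (integrableOn_const (volume_openCell_ne_top hΩ hK i))).restrict

/-- The step functions as elements of `L²(Ω)`. -/
def stepLp : (flagSet K → ℝ) →ₗ[ℝ] Lp ℝ 2 (volume.restrict Ω) where
  toFun x := (memLp_stepFun hΩ hK x).toLp _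
  map_add' x x' := by
    rw [← MemLp.toLp_add]
    exact MemLp.toLp_congr _ _ (Eventually.of_forall fun y => by rw [stepFun_add])
  map_smul' r x := by
    rw [RingHom.id_apply, ← MemLp.toLp_const_smul]
    exact MemLp.toLp_congr _ _ (Eventually.of_forall fun y => by rw [stepFun_smul])

lemma coeFn_stepLp (x : flagSet K → ℝ) :
    stepLp hΩ hK x =ᵐ[volume.restrict Ω] stepFun Ω x :=
  MemLp.coeFn_toLp (memLp_stepFun hΩ hK x)

omit [Fintype (flagSet K)] in
lemma eq_of_ae_openCell {i : flagSet K} {r r' : ℝ}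
    (h : ∀ᵐ y ∂(volume.restrict Ω), y ∈ openCell Ω i → r = r') : r = r' := by
  by_contra hne
  have h1 : ∀ᵐ y ∂(volume.restrict Ω), y ∉ openCell Ω i := by
    filter_upwards [h] with y hy hyi using hne (hy hyi)
  rw [← measure_eq_zero_iff_ae_notMem,
    Measure.restrict_apply (isOpen_openCell hΩ hK i).measurableSet,
    inter_eq_left.2 (openCell_subset hΩ hK i)] at h1
  exact (volume_openTri_pos (cellArea_ne_zero' hΩ hK i)).ne' h1

lemma stepLp_injective : Function.Injective (stepLp (K := K) hΩ hK) := by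
  intro x x' h
  funext i
  refine eq_of_ae_openCell hΩ hK (i := i) ?_
  have h1 := coeFn_stepLp hΩ hK x
  rw [h] at h1
  filter_upwards [h1, coeFn_stepLp hΩ hK x'] with y h2 h3 hy
  rw [← stepFun_eq hΩ hK (x := x) hy, ← stepFun_eq hΩ hK (x := x') hy, ← h2, h3]

/-- Up to null sets a pressure is the step function of its cell values. The singular vertices are
the split points, so its conditions are those of `constraints` up to nonzero factors. -/
lemma pressureSpace_eq_map :
    pressureSpace K Ω = (LinearMap.ker (constraints (K := K) Ω)).map (stepLp hΩ hK) := by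
  have hae : ∀ᵐ y ∂(volume.restrict Ω), ∃ i : flagSet K, y ∈ openCell Ω i := by
    filter_upwards [ae_restrict_of_ae (ae_mem_openCell hΩ hK),
      ae_restrict_mem hΩ.isOpen.measurableSet] with y hy hyΩ using hy (subset_closure hyΩ)
  apply le_antisymm
  · rintro q ⟨-, hint, c, hc, hS⟩
    have hq : q =ᵐ[volume.restrict Ω] stepFun Ω fun i : flagSet K => c (cellSet K Ω i) := by
      have h1 : ∀ᵐ y ∂(volume.restrict Ω), ∀ i : flagSet K,
          y ∈ convexHull ℝ (cellSet K Ω i) → q y = c (cellSet K Ω i) :=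
        ae_all_iff.2 fun i => hc _ ((mem_psTriangles_iff_cellSet hΩ hK).2 ⟨i, rfl⟩)
      filter_upwards [hae, h1] with y ⟨i, hi⟩ hy
      rw [stepFun_eq hΩ hK hi]
      exact hy i (openCell_subset_cellHull i hi)
    refine ⟨fun i => c (cellSet K Ω i), mem_ker_constraints.2 ⟨fun e he => ?_, ?_⟩, ?_⟩
    · obtain ⟨n, T, hT⟩ := exists_isLocalOrdering hΩ hK he
      obtain ⟨ε, hε, hθ⟩ := theta_eq hΩ hK he hT
      have h1 := hS _ (spl_mem_singularVertices hΩ hK he) n T hT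
      rw [hθ] at h1
      exact (mul_eq_zero.1 h1).resolve_left hε
    · rw [← integral_stepFun hΩ hK, ← integral_congr_ae hq, hint]
    · exact Lp.ext ((coeFn_stepLp hΩ hK _).trans hq.symm)
  · rintro _ ⟨x, hx, rfl⟩
    obtain ⟨hx1, hx2⟩ := mem_ker_constraints.1 hx
    have hq := coeFn_stepLp hΩ hK x
    have : IsFiniteMeasure (volume.restrict Ω : Measure Plane) :=
      isFiniteMeasure_restrict.2 hΩ.isBounded.measure_lt_top.ne
    -- Cell values as a function of vertex sets; this is well defined since a cell is determined by
    -- its vertices, and sets that are not cells get 0.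
    let c : Set Plane → ℝ := fun t => if h : ∃ i : flagSet K, t = cellSet K Ω i then
      x h.choose else 0
    have hc : ∀ i, c (cellSet K Ω i) = x i := by
      intro i
      have hex : ∃ j : flagSet K, cellSet K Ω i = cellSet K Ω j := ⟨i, rfl⟩
      simp only [c, dif_pos hex]
      rw [← cellSet_injective hΩ hK hex.choose_spec]
    refine ⟨(Lp.memLp _).integrable (by norm_num), ?_, c, ?_, ?_⟩
    · rw [integral_congr_ae hq, integral_stepFun hΩ hK, hx2]
    · intro t ht
      obtain ⟨i, rfl⟩ := (mem_psTriangles_iff_cellSet hΩ hK).1 ht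
      filter_upwards [hq, hae] with y hy ⟨j, hj⟩ hyi
      rw [hy, hc, stepFun_eq hΩ hK hj, eq_of_mem_openCell hΩ hK hj hyi]
    · intro z hz n T hT
      obtain ⟨e, he, rfl⟩ := exists_eq_spl hΩ hK hz
      obtain ⟨ε, -, hθ⟩ := theta_eq hΩ hK he hT
      rw [hθ]
      simp only [hc]
      rw [hx1 e he, mul_zero]

omit [Fintype (flagSet K)] in
lemma finiteDimensional_pressureSpace : FiniteDimensional ℝ (pressureSpace K Ω) := by
  have := hK.finite_flagSet.fintype
  rw [pressureSpace_eq_map hΩ hK]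
  infer_instance

lemma finrank_pressureSpace : Module.finrank ℝ (pressureSpace K Ω) =
    Module.finrank ℝ (LinearMap.ker (constraints (K := K) Ω)) := by
  rw [pressureSpace_eq_map hΩ hK]
  exact (Submodule.equivMapOfInjective (stepLp hΩ hK) (stepLp_injective hΩ hK) _).symm.finrank_eq

lemma finrank_ker_constraints_eq (hsc : SimplyConnectedSpace Ω) :
    (Module.finrank ℝ (LinearMap.ker (constraints (K := K) Ω)) : ℤ) =
      2 * (macroTriangles K).ncard + 2 * (interiorEdges K Ω).ncard -
        (interiorVertices K Ω).ncard := by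
  have := hK.finite_macroEdges.fintype
  rw [← card_flagSet_sub hΩ hK hsc]
  have h := finrank_ker_constraints hΩ hK
  simp only [← Nat.card_eq_fintype_card, Nat.card_coe_set_eq] at h
  omega

/-- A complement of the solenoidal fields has the dimension of the range of the divergence. -/
lemma finrank_complement {W : Submodule ℝ C(closure Ω, Plane)}
    (hdisj : Disjoint (solenoidalSpaceZero K Ω) W)
    (hsup : solenoidalSpaceZero K Ω ⊔ W = velocitySpaceZero K Ω) :
    Module.finrank ℝ W = Module.finrank ℝ (LinearMap.ker (constraints (K := K) Ω)) := by
  have hWX : W ≤ velocitySpaceZero K Ω := hsup ▸ le_sup_right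
  have hV : ∀ v ∈ velocitySpaceZero K Ω, divMap K Ω v = 0 → v ∈ solenoidalSpaceZero K Ω :=
    fun v hv h0 => ⟨⟨hv.1, (mem_solenoidal_iff hΩ hK hv).2 h0⟩, hv.2⟩
  have hV0 : ∀ v ∈ solenoidalSpaceZero K Ω, divMap K Ω v = 0 := fun v hv =>
    (mem_solenoidal_iff hΩ hK ⟨hv.1.1, hv.2⟩).1 hv.1.2
  -- The divergence kills V_h⁰, so W and X_h⁰ have the same image.
  have hmap : W.map (divMap K Ω) = LinearMap.ker (constraints (K := K) Ω) := by
    rw [← map_divMap_eq hΩ hK, ← hsup, Submodule.map_sup, eq_comm, sup_eq_right]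
    rintro _ ⟨v, hv, rfl⟩
    rw [hV0 v hv]
    exact zero_mem _
  have hinj : Function.Injective ((divMap K Ω).domRestrict W) := by
    rintro ⟨w, hw⟩ ⟨w', hw'⟩ h
    have h0 : divMap K Ω w = divMap K Ω w' := h
    have hsub : w - w' ∈ solenoidalSpaceZero K Ω :=
      hV _ (sub_mem (hWX hw) (hWX hw')) (by rw [map_sub, h0, sub_self])
    exact Subtype.ext (sub_eq_zero.1 (Submodule.disjoint_def.1 hdisj _ hsub (sub_mem hw hw')))
  rw [← hmap, ← LinearMap.range_domRestrict]
  exact (LinearEquiv.ofInjective _ hinj).finrank_eq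

end domain

end PowellSabin

end

/-- A subspace `W` with `X_h⁰ = V_h⁰ ⊕ W` is what the non-solenoidal complement `X_h⁰ ∖ V_h⁰` stands
for. The last clause says that the pressure system, with one equation for every member of a basis of
`W` and one unknown for every member of a basis of `P_h`, is square. -/
theorem mainTheorem4 (Ω : Set PowellSabin.Plane) (hΩ : PowellSabin.IsPolygonalDomain Ω)
    (hsc : SimplyConnectedSpace Ω)
    (K : Geometry.SimplicialComplex ℝ PowellSabin.Plane) (hK : PowellSabin.IsTriangulation K Ω) :
    FiniteDimensional ℝ (PowellSabin.velocitySpaceZero K Ω) ∧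
    FiniteDimensional ℝ (PowellSabin.pressureSpace K Ω) ∧
    (Module.finrank ℝ (PowellSabin.pressureSpace K Ω) : ℤ) =
      2 * (PowellSabin.macroTriangles K).ncard + 2 * (PowellSabin.interiorEdges K Ω).ncard
        - (PowellSabin.interiorVertices K Ω).ncard ∧
    ∀ W : Submodule ℝ C(closure Ω, PowellSabin.Plane),
      Disjoint (PowellSabin.solenoidalSpaceZero K Ω) W →
      PowellSabin.solenoidalSpaceZero K Ω ⊔ W = PowellSabin.velocitySpaceZero K Ω →
      (Module.finrank ℝ W : ℤ) =
        2 * (PowellSabin.macroTriangles K).ncard + 2 * (PowellSabin.interiorEdges K Ω).ncard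
          - (PowellSabin.interiorVertices K Ω).ncard ∧
      ∀ (m n : ℕ), Module.Basis (Fin m) ℝ W →
        Module.Basis (Fin n) ℝ (PowellSabin.pressureSpace K Ω) → m = n := by
  have := hK.finite_flagSet.fintype
  have hdim := PowellSabin.finrank_ker_constraints_eq hΩ hK hsc
  have hP := PowellSabin.finrank_pressureSpace hΩ hK
  refine ⟨PowellSabin.finiteDimensional_velocitySpaceZero hΩ hK,
    PowellSabin.finiteDimensional_pressureSpace hΩ hK, by rw [hP, hdim], fun W hdisj hsup => ?_⟩
  have hW := PowellSabin.finrank_complement hΩ hK hdisj hsup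
  refine ⟨by rw [hW, hdim], fun m n bW bP => ?_⟩
  rw [← Fintype.card_fin m, ← Fintype.card_fin n, ← Module.finrank_eq_card_basis bW,
    ← Module.finrank_eq_card_basis bP, hW, hP]
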